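/- Put $\boldsymbol\ell(x)=\frac{1}{-\log x}$, $\boldsymbol\ell_0=x$, $\boldsymbol\ell_{j+1}=\boldsymbol\ell\circ\boldsymbol\ell_j$, and let $\mathcal G_{AN}$ be the set of germs at $0^+$ that are analytic on some $(0,d)$, $d>0$. For $j\ge 0$ let $\widehat{\mathcal L}_j^\infty$ be the set of transseries $\sum_{i_0}\cdots\sum_{i_j}a_{i_0\ldots i_j}x^{\alpha_{i_0}}\boldsymbol\ell^{\alpha_{i_0i_1}}\cdots\boldsymbol\ell_j^{\alpha_{i_0\ldots i_j}}$ with real coefficients, where for each $k$ and fixed $i_0,\dots,i_{k-1}$ the exponents $\alpha_{i_0\ldots i_k}$ are finitely many or increase strictly to $+\infty$; $\widehat{\mathcal L}_j$ is the subset with all $\alpha_{i_0}>0$. A transseries is convergent if it converges absolutely at every point of some $(0,d)$. Its support in powers of $x$ is denoted by $\mathcal S_x$, and its blocks are the series $\widehat F_a$ in $\widehat F=\sum_a\widehat F_a(\boldsymbol\ell)x^a$. A Dulac series is a series $\sum_i P_i(\boldsymbol\ell^{-1})x^{\alpha_i}$ with polynomials $P_i$ and exponents $\alpha_i>0$, finite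 in number or increasing to $+\infty$, in a finitely generated additive semigroup of positive reals. A Dulac germ is a germ $g\in\mathcal G_{AN}$ that has a Dulac series $\widehat g$ as its asymptotic expansion (for every $M$, $g-\sum_{\alpha_i\le M}P_i(\boldsymbol\ell^{-1})x^{\alpha_i}=o(x^M)$ as $x\to0^+$) and that extends to a bounded analytic function on a standard quadratic domain, i.e. in the chart $\zeta=-\log z$, on the image of $\{\operatorname{Re}\zeta>0,\ |\zeta|>R\}$ under $\zeta\mapsto\zeta+C(\zeta+1)^{1/2}$, for some $C,R>0$. Sectional asymptotic expansions with respect to a map $\mathbf s$ from transseries to germs: a germ $f\in\mathcal G_{AN}$ has $\widehat F\in\widehat{\mathcal L}_0^\infty$ as its expansion if $\widehat F$ is its power asymptotic expansion; it has $\widehat F=\sum_a \widehat F_a(\boldsymbol\ell)x^a\in\widehat{\mathcal L}_{j+1}^\infty$ as its expansion if every block $\widehat F_a\in\widehat{\mathcal L}_j^\infty$ is the sectional expansion of some germ and $f-\sum_{a\le M}\mathbf s(\widehat F_a)(\boldsymbol\ell)\,x^a=o(x^M)$ for every $M$. The map $\mathbf s$ is a section if $\mathbf s(\widehat F)$ has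 the expansion $\widehat F$ whenever some germ has; it is coherent if it sends convergent transseries to their sums; and an integral section is a coherent section whose value at each integrally summable transseries of $\widehat{\mathcal L}_1^\infty$ is one of its integral sums. (The last two conditions are imposed on a transseries only when its sum, respectively one of its integral sums, has it as its sectional expansion.) Here: (0) A formal Laurent series $\widehat f(y)=\sum_{n\ge N}a_ny^n$ is integrally summable if it is convergent, its integral sum being its sum, or if it is divergent and $\frac{d}{dx}\big(x^{\kappa}\widehat f(\boldsymbol\ell)\big)=x^{\kappa-1}R(\boldsymbol\ell)$ formally for some real $\kappa\ne0$ and convergent Laurent series $R$, its integral sums being $e^{\kappa/y}\int_d^{e^{-1/y}}t^{\kappa-1}R(\boldsymbol\ell(t))\,dt$, with $d=0$ if $\kappa>0$ and $d>0$ small if $\kappa<0$. (1) A transseries $\widehat F\in\widehat{\mathcal L}_1^\infty$ is integrally summable if it is convergent, its integral sum being its sum, or if $\widehat F(y)=\widehat G_1(y)\widehat f\big(\boldsymbol\ell(e^{-\gamma/y}\widehat h(y))\big)+\widehat G_0(y)$ with $\gamma>0$, $\widehat f$ as in (0), and $\widehat G_0,\widehat G_1,\widehat h\in\widehat{\mathcal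 L}_1^\infty$ convergent together with their derivatives, with sums $G_0,G_1,h$ commuting with the derivative, the leading term of $\widehat h$ having positive coefficient and not containing $\boldsymbol\ell$; its integral sums are $G_1(y)f\big(\boldsymbol\ell(e^{-\gamma/y}h(y))\big)+G_0(y)$ with $f$ an integral sum of $\widehat f$. **Proposition.** Let $g$ be a Dulac germ with Dulac expansion $\widehat g=ax^\alpha\boldsymbol\ell^{-m}+\text{h.o.t.}$, $a>0$, $\alpha>0$, $m\in\mathbb N_0$. Then $g$ has an inverse germ $g^{-1}\in\mathcal G_{AN}$, $\widehat g$ has a unique formal compositional inverse $\widehat g^{-1}\in\widehat{\mathcal L}_2$, and for every integral section $\mathbf s$ the formal inverse $\widehat g^{-1}$ is the unique sectional asymptotic expansion of $g^{-1}$ in $\widehat{\mathcal L}_2^\infty$ with respect to $\mathbf s$. More precisely, let $\widetilde{\mathcal A}$ be the additive semigroup generated by $0$ and $\{\beta-\alpha:\beta\in\mathcal S_x(\widehat g)\}$ and $\mathcal A=1+\widetilde{\mathcal A}$. Then $$\widehat g^{-1}(x)=\sum_{\beta\in\mathcal A}\widehat f_\beta(\boldsymbol\ell)\,x^{\beta/\alpha},\qquad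 \widehat f_\beta(y)=y^{-M_\beta+\frac{m\beta}{\alpha}}\,\widehat G_\beta\Big(\boldsymbol\ell(y),\frac{y}{\boldsymbol\ell(y)}\Big),\quad M_\beta\in\mathbb N_0,$$ where $\widehat G_\beta$ is the Taylor expansion at $(0,0)$ of an analytic germ $G_\beta$ of two variables; the block $\widehat f_\beta$ is convergent with sum $f_\beta(y)=y^{-M_\beta+\frac{m\beta}{\alpha}}G_\beta\big(\boldsymbol\ell(y),\frac{y}{\boldsymbol\ell(y)}\big)\in\mathcal G_{AN}$; and for every $b\in\mathcal A$, $$g^{-1}(x)-\sum_{\beta\in\mathcal A,\ \beta\le b}f_\beta(\boldsymbol\ell)\,x^{\beta/\alpha}=o\big(x^{b/\alpha}\big),\qquad x\to0^+.$$ -/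

import Mathlib

open Set Filter Topology Asymptotics

namespace Dulac

noncomputable section

/-! ### Iterated logarithms and germs at `0⁺`

Germs on positive neighbourhoods of the origin are represented by functions `ℝ → ℝ`, and equality
of germs is eventual equality along `𝓝[>] 0`. -/

/-- `ℓ(x) = 1 / (-log x)`. -/
def ell (x : ℝ) : ℝ := (-Real.log x)⁻¹

/-- `ℓ₀ = x`, `ℓ₁ = ℓ`, `ℓ_{j+1} = ℓ ∘ ℓ_j`. -/
def ellIter : ℕ → ℝ → ℝ
  | 0, x => x
  | j + 1, x => ell (ellIter j x)

/-- The germ is analytic on some `(0, d)`, `d > 0`. -/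
def IsAnalyticGerm (f : ℝ → ℝ) : Prop :=
  ∃ d : ℝ, 0 < d ∧ AnalyticOnNhd ℝ f (Ioo 0 d)

/-- `f` and `h` are compositional inverses of each other as germs at `0⁺`. -/
def IsInverseGerm (f h : ℝ → ℝ) : Prop :=
  Tendsto f (𝓝[>] 0) (𝓝[>] 0) ∧ Tendsto h (𝓝[>] 0) (𝓝[>] 0) ∧
    (∀ᶠ x in 𝓝[>] (0 : ℝ), f (h x) = x) ∧ (∀ᶠ x in 𝓝[>] (0 : ℝ), h (f x) = x)

/-! ### Transseries -/

/-- Exponents `e = (e₀, e₁, e₂, …)`, finitely many nonzero, of the monomials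
`x^{e₀} ℓ^{e₁} ℓ₂^{e₂} ⋯`, ordered lexicographically. -/
abbrev Expo : Type := Lex (ℕ →₀ ℝ)

/-- Formal series of power-iterated logarithm monomials with well-ordered support. -/
abbrev Series : Type := HahnSeries Expo ℝ

/-- The `i`-th exponent. -/
def Expo.at (e : Expo) (i : ℕ) : ℝ := ofLex e i

/-- The monomial function `x^{e₀} ℓ(x)^{e₁} ℓ₂(x)^{e₂} ⋯`. -/
def monomialFun (e : Expo) (x : ℝ) : ℝ :=
  (ofLex e).prod fun j r => ellIter j x ^ r

/-- The exponent of `x^a ℓ^b`. -/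
def expo₂ (a b : ℝ) : Expo := toLex (Finsupp.single 0 a + Finsupp.single 1 b)

/-- The formal monomial `ℓ_j^r` (with `ℓ₀ = x`). -/
def ellPow (j : ℕ) (r : ℝ) : Series := HahnSeries.single (toLex (Finsupp.single j r)) 1

/-- The formal identity `x`. -/
def idSeries : Series := ellPow 0 1

/-- The class `L̂_j^∞`: only `x, ℓ, …, ℓ_j` occur, and for each choice of the first `k` exponents
the `k`-th exponents form a finite set or a sequence that increases to `+∞`. -/
def IsTransseries (j : ℕ) (F : Series) : Prop :=
  (∀ e ∈ F.support, ∀ i, j < i → e.at i = 0) ∧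
  ∀ k ≤ j, ∀ p : ℕ → ℝ, ∀ M : ℝ,
    {r : ℝ | r ≤ M ∧ ∃ e ∈ F.support, (∀ i < k, e.at i = p i) ∧ e.at k = r}.Finite

/-- The class `L̂_j` of infinitesimal elements of `L̂_j^∞`. -/
def IsInfTransseries (j : ℕ) (F : Series) : Prop :=
  IsTransseries j F ∧ ∀ e ∈ F.support, 0 < e.at 0

/-- The class `L̂`: elements of `L̂₁` with integer powers of `ℓ`. -/
def IsPowerLog (F : Series) : Prop :=
  IsInfTransseries 1 F ∧ ∀ e ∈ F.support, ∃ n : ℤ, e.at 1 = n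

/-- The support `S_x(F)` with respect to powers of `x` only. -/
def xSupport (F : Series) : Set ℝ := (fun e : Expo => e.at 0) '' F.support

/-! #### Blocks -/

/-- `(a, e) ↦ (a, e₀, e₁, …)`. -/
def consExpo (a : ℝ) (e : Expo) : Expo :=
  toLex (Finsupp.single 0 a + (ofLex e).mapDomain Nat.succ)

theorem consExpo_zero (a : ℝ) (e : Expo) : (ofLex (consExpo a e)) 0 = a := by
  have : (Finsupp.mapDomain Nat.succ (ofLex e)) 0 = 0 :=
    Finsupp.mapDomain_of_notMem_range _ _ (by simp)
  simp [consExpo, this]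

theorem consExpo_succ (a : ℝ) (e : Expo) (i : ℕ) :
    (ofLex (consExpo a e)) (i + 1) = ofLex e i := by
  have : (Finsupp.mapDomain Nat.succ (ofLex e)) (i + 1) = ofLex e i :=
    Finsupp.mapDomain_apply Nat.succ_injective _ _
  simp [consExpo, this]

theorem consExpo_strictMono (a : ℝ) : StrictMono (consExpo a) := by
  intro e e' h
  obtain ⟨j, hj, hlt⟩ := Finsupp.Lex.lt_iff.1 h
  refine Finsupp.Lex.lt_iff.2 ⟨j + 1, ?_, ?_⟩
  · intro i hi
    cases i with
    | zero => rw [consExpo_zero, consExpo_zero]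
    | succ i => rw [consExpo_succ, consExpo_succ]; exact hj i (by omega)
  · rw [consExpo_succ, consExpo_succ]; exact hlt

/-- `consExpo a` as an order embedding. -/
def consEmb (a : ℝ) : Expo ↪o Expo := OrderEmbedding.ofStrictMono _ (consExpo_strictMono a)

/-- The block `F_a` of `F = ∑_a F_a(ℓ) x^a`, a series in its own variable. -/
def block (a : ℝ) (F : Series) : Series where
  coeff e := F.coeff (consExpo a e)
  isPWO_support' :=
    Set.isPWO_iff_isWF.2 <| by
      have h : (F.support).IsWF := F.isWF_support
      rw [Set.isWF_iff_no_descending_seq] at h ⊢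
      intro f hf hmem
      exact h (fun n => consExpo a (f n)) (fun m n hmn => consExpo_strictMono a (hf hmn))
        (fun n => hmem n)

/-- The series `x^a F(ℓ)`. -/
def powMulEll (a : ℝ) (F : Series) : Series := HahnSeries.embDomain (consEmb a) F

/-! #### Formal composition -/

/-- The infinitesimal `ε` in `F = (leading term) * (1 + ε)`. -/
def smallPart (F : Series) : Series :=
  F * HahnSeries.single (-F.order) (F.leadingCoeff)⁻¹ - 1

/-- The formal real power `F^r` of a series with positive leading coefficient, by the binomial
expansion. -/
def fpow (F : Series) (r : ℝ) : Series :=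
  HahnSeries.single (toLex (r • ofLex F.order)) (F.leadingCoeff ^ r) *
    PowerSeries.heval (smallPart F) (PowerSeries.binomialSeries ℝ r)

/-- The formal logarithm of a series with positive leading coefficient; note that
`log ℓ_j = -ℓ_{j+1}⁻¹`. -/
def flog (F : Series) : Series :=
  HahnSeries.C (Real.log F.leadingCoeff)
    - ((ofLex F.order).sum fun j r => r • ellPow (j + 1) (-1))
    + PowerSeries.heval (smallPart F)
        (PowerSeries.mk fun n : ℕ => (-1 : ℝ) ^ (n + 1) / (n : ℝ))

/-- The formal `ℓ(F) = 1 / (-log F)`. -/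
def fell (F : Series) : Series := (-flog F)⁻¹

/-- The composition of the monomial `x^{e₀} ℓ^{e₁} ℓ₂^{e₂} ⋯` with `H`. -/
def monomialComp (e : Expo) (H : Series) : Series :=
  (ofLex e).prod fun j r => fpow (fell^[j] H) r

/-- `K` is the formal composition `F ∘ H`, for `H` infinitesimal with positive leading
coefficient. -/
def IsFormalComp (F H K : Series) : Prop :=
  0 < H.leadingCoeff ∧ 0 < H.order ∧
  ∃ S : HahnSeries.SummableFamily Expo ℝ Expo,
    (∀ e, S e = F.coeff e • monomialComp e H) ∧ S.hsum = K

/-- `F` and `H` are formal compositional inverses of each other. -/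
def IsFormalInverse (F H : Series) : Prop :=
  IsFormalComp F H idSeries ∧ IsFormalComp H F idSeries

/-! ### Dulac series and Dulac germs -/

/-- Dulac series: `∑ P_i(ℓ⁻¹) x^{α_i}` in `L̂`, with polynomials `P_i` and exponents `α_i > 0` in a
finitely generated semigroup. -/
def IsDulacSeries (F : Series) : Prop :=
  IsPowerLog F ∧ (∀ e ∈ F.support, e.at 1 ≤ 0) ∧
  (∀ a : ℝ, {e ∈ F.support | e.at 0 = a}.Finite) ∧
  ∃ T : Finset ℝ, (∀ t ∈ T, 0 < t) ∧ xSupport F ⊆ AddSubmonoid.closure (T : Set ℝ)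

/-- `F` is the Dulac asymptotic expansion of `f`. -/
def IsDulacExpansion (f : ℝ → ℝ) (F : Series) : Prop :=
  IsDulacSeries F ∧ ∀ M : ℝ,
    (fun x => f x - ∑ᶠ e ∈ {e ∈ F.support | e.at 0 ≤ M}, F.coeff e * monomialFun e x)
      =o[𝓝[>] 0] fun x => x ^ M

/-- A (germ at infinity of a) standard quadratic domain, in the logarithmic chart `ζ = -log z`:
the image of `{Re ζ > 0, |ζ| > R}` under `ζ ↦ ζ + C (ζ + 1)^{1/2}`. -/
def quadraticDomain (C R : ℝ) : Set ℂ :=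
  (fun ζ : ℂ => ζ + C * (ζ + 1) ^ (1 / 2 : ℂ)) '' {ζ | 0 < ζ.re ∧ R < ‖ζ‖}

/-- `f` extends to a bounded analytic function on a standard quadratic domain. -/
def IsQuasiAnalytic (f : ℝ → ℝ) : Prop :=
  ∃ C R : ℝ, 0 < C ∧ 0 < R ∧ ∃ Φ : ℂ → ℂ,
    DifferentiableOn ℂ Φ (quadraticDomain C R) ∧
    (∃ B : ℝ, ∀ ζ ∈ quadraticDomain C R, ‖Φ ζ‖ ≤ B) ∧
    ∀ᶠ t : ℝ in atTop, Φ t = (f (Real.exp (-t)) : ℂ)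

/-- Dulac germs. -/
def IsDulacGerm (f : ℝ → ℝ) : Prop :=
  IsAnalyticGerm f ∧ (∃ F, IsDulacExpansion f F) ∧ IsQuasiAnalytic f

/-! ### Convergent transseries -/

/-- `F` converges absolutely at every point of `(0, d)`. -/
def ConvergesOn (F : Series) (d : ℝ) : Prop :=
  ∀ x ∈ Ioo 0 d, Summable fun e => |F.coeff e * monomialFun e x|

/-- Convergent transseries. -/
def IsConvergent (F : Series) : Prop := ∃ d : ℝ, 0 < d ∧ ConvergesOn F d

/-- The pointwise sum. -/
def sumFun (F : Series) (x : ℝ) : ℝ := ∑' e, F.coeff e * monomialFun e x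

/-- `F` is convergent and the germ `f` is its sum. -/
def IsSum (F : Series) (f : ℝ → ℝ) : Prop :=
  IsConvergent F ∧ f =ᶠ[𝓝[>] 0] sumFun F

/-! ### Sectional asymptotic expansions -/

/-- `IsSectionalExpansion s j F f`: the germ `f` admits `F ∈ L̂_j^∞` as its sectional asymptotic
expansion with respect to `s`. In depth `0` this is the usual power asymptotic expansion; in depth
`j + 1`, `F = ∑_a F_a(ℓ) x^a`, where each block `F_a ∈ L̂_j^∞` is itself the sectional asymptotic
expansion of some germ, and `f` expands in increasing powers of `x` with the coefficients
`s(F_a)(ℓ)`. The values of `s` matter only on such expansions, and only as germs. -/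
def IsSectionalExpansion (s : Series → ℝ → ℝ) : ℕ → Series → (ℝ → ℝ) → Prop
  | 0, F, f =>
      IsTransseries 0 F ∧ IsAnalyticGerm f ∧ ∀ M : ℝ,
        (fun x => f x - ∑ᶠ a ∈ {a ∈ xSupport F | a ≤ M}, F.coeff (expo₂ a 0) * x ^ a)
          =o[𝓝[>] 0] fun x => x ^ M
  | j + 1, F, f =>
      IsTransseries (j + 1) F ∧ IsAnalyticGerm f ∧
      (∀ a ∈ xSupport F, ∃ h, IsSectionalExpansion s j (block a F) h) ∧ ∀ M : ℝ,
        (fun x => f x - ∑ᶠ a ∈ {a ∈ xSupport F | a ≤ M}, s (block a F) (ell x) * x ^ a)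
          =o[𝓝[>] 0] fun x => x ^ M

/-- `s` is a section: it attributes to every transseries that is the sectional asymptotic expansion
of some germ a germ with this expansion. -/
def IsSection (s : Series → ℝ → ℝ) : Prop :=
  ∀ j F f, IsSectionalExpansion s j F f → IsSectionalExpansion s j F (s F)

/-- Coherence: convergent transseries are sent to their sums. (For a convergent transseries whose
sum does not have it as its expansion, no section could do so, and nothing is required.) -/
def IsCoherent (s : Series → ℝ → ℝ) : Prop :=
  ∀ j F f, IsSectionalExpansion s j F f → IsSum F f → s F =ᶠ[𝓝[>] 0] f

/-! ### Integral sums and integral sections -/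

/-- The operator `x^{e₀} ℓ^{e₁} ⋯ ↦ e_i x^{e₀} ℓ^{e₁} ⋯`. -/
def theta (i : ℕ) (F : Series) : Series where
  coeff e := e.at i * F.coeff e
  isPWO_support' := F.isPWO_support.mono fun e he => by
    simp only [Function.mem_support, ne_eq, mul_eq_zero, not_or] at he
    exact he.2

/-- The formal derivative on `L̂₁^∞`:
`(x^a ℓ^b)' = a x^{a-1} ℓ^b + b x^{a-1} ℓ^{b+1}`. -/
def formalDeriv (F : Series) : Series :=
  ellPow 0 (-1) * (theta 0 F + ellPow 1 1 * theta 1 F)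

/-- Formal Laurent series `∑_{n ≥ N} a_n y^n`, `N ∈ ℤ`. -/
def IsLaurent (F : Series) : Prop := ∀ e ∈ F.support, ∃ n : ℤ, e = expo₂ n 0

/-- `F ∈ L̂₀^I` is integrally summable and `f` is an integral sum of `F`. -/
def IsIntegralSum₀ (F : Series) (f : ℝ → ℝ) : Prop :=
  IsLaurent F ∧
  (IsSum F f ∨
    (¬ IsConvergent F ∧ ∃ α : ℝ, α ≠ 0 ∧ ∃ R : Series, IsLaurent R ∧
      formalDeriv (powMulEll α F) = powMulEll (α - 1) R ∧
      ∃ d ρ : ℝ, 0 < ρ ∧ ConvergesOn R ρ ∧ 0 ≤ d ∧ d < 1 ∧ ell d < ρ ∧ (d = 0 ↔ 0 < α) ∧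
        ∀ᶠ y in 𝓝[>] (0 : ℝ),
          f y = (∫ t in d..Real.exp (-1 / y), t ^ (α - 1) * sumFun R (ell t)) /
            Real.exp (-α / y)))

/-- `G ∈ L̂₁^∞` and its derivative converge, and the sum `g` of `G` commutes with the derivative. -/
def IsDiffSum (G : Series) (g : ℝ → ℝ) : Prop :=
  IsTransseries 1 G ∧ IsSum G g ∧ (∀ᶠ y in 𝓝[>] (0 : ℝ), DifferentiableAt ℝ g y) ∧
    IsSum (formalDeriv G) (deriv g)

/-- `F ∈ L̂₁^I` is integrally summable and `f` is an integral sum of `F`: either `F` is convergent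
and `f` is its sum, or `F(y) = G₁(y) F₀(ℓ(e^{-γ/y} h(y))) + G₀(y)` and `f` is obtained by replacing
`G₁, h, G₀` by their sums and `F₀ ∈ L̂₀^I` by an integral sum. Formally,
`ℓ(e^{-γ/y} h(y)) = 1 / (γ y⁻¹ - log h(y))`. -/
def IsIntegralSum (F : Series) (f : ℝ → ℝ) : Prop :=
  IsTransseries 1 F ∧
  (IsSum F f ∨
    ∃ (G₁ G₀ H F₀ K : Series) (g₁ g₀ h f₀ : ℝ → ℝ) (γ : ℝ), 0 < γ ∧
      IsDiffSum G₁ g₁ ∧ IsDiffSum G₀ g₀ ∧ IsDiffSum H h ∧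
      0 < H.leadingCoeff ∧ H.order.at 1 = 0 ∧
      IsIntegralSum₀ F₀ f₀ ∧
      IsFormalComp F₀ ((γ • ellPow 0 (-1) - flog H)⁻¹) K ∧
      F = G₁ * K + G₀ ∧
      ∀ᶠ y in 𝓝[>] (0 : ℝ), f y = g₁ y * f₀ (ell (Real.exp (-γ / y) * h y)) + g₀ y)

/-- Integral sections: coherent sections whose value at each integrally summable `F ∈ L̂₁^I` is an
integral sum of `F`. (As for coherence, nothing is required if no integral sum of `F` has `F` as
its expansion.) -/
def IsIntegralSection (s : Series → ℝ → ℝ) : Prop :=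
  IsSection s ∧ IsCoherent s ∧
  ∀ j F f, IsSectionalExpansion s j F f → IsIntegralSum F f → IsIntegralSum F (s F)

/-! ### Laurent blocks -/

/-- The germ `G` of two variables is analytic at `(0,0)` with Taylor expansion `∑ c i k u^i v^k`. -/
def HasTaylor₂ (G : ℝ → ℝ → ℝ) (c : ℕ → ℕ → ℝ) : Prop :=
  ∃ r : ℝ, 0 < r ∧ ∀ u v : ℝ, |u| < r → |v| < r →
    HasSum (fun p : ℕ × ℕ => c p.1 p.2 * u ^ p.1 * v ^ p.2) (G u v)

/-- `F = y^γ Ĝ(ℓ(y), y / ℓ(y))` with `Ĝ(u,v) = ∑ c i k u^i v^k`, that is,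
`F = ∑ c i k y^{γ+k} ℓ(y)^{i-k}`. -/
def IsLaurentBlock (F : Series) (γ : ℝ) (c : ℕ → ℕ → ℝ) : Prop :=
  (∀ i k : ℕ, F.coeff (expo₂ (γ + k) ((i : ℝ) - k)) = c i k) ∧
  ∀ e ∈ F.support, ∃ i k : ℕ, e = expo₂ (γ + k) ((i : ℝ) - k)

/-- The set `𝒜 = 1 + 𝒜̃`, where `𝒜̃` is the semigroup generated by `β - α`, `β ∈ S_x(F)`. -/
def exponentSet (F : Series) (α : ℝ) : Set ℝ :=
  (fun r => r + 1) '' (AddSubmonoid.closure ((fun β => β - α) '' xSupport F) : Set ℝ)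

end

end Dulac

open Dulac

namespace Dulac

noncomputable section

/-! The formal inverse is sought as y = c x^{1/α} ℓ^{m/α} exp θ with θ infinitesimal and c
normalised by a c^α α^{-m} = 1. Then -log y = (1+W)/(αℓ) with W = m ℓ/ℓ₂ - αℓ(log c + θ). Hence a
monomial x^{e₀} ℓ^{e₁} takes at y the value x · c^{e₀} α^{e₁} x^{e₀/α-1} ℓ^{m e₀/α+e₁} exp(e₀θ - e₁
log(1+W)). After division by x, the equation ĝ(y) = x reads exp(αθ + m log(1+W)) = 1 - B(θ), where B
collects the nonleading monomials, that is, θ = α⁻¹(log(1-B) - m log(1+W)). This is the fixed point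
equation of `invOp`.

Formal solution. On the right θ always carries an infinitesimal factor: ℓ in W, a monomial of
exponent `zExp` in B. Filtering by the number of generators (ℓ/ℓ₂, ℓ and the `zExp` monomials) makes
`invOp` a contraction, and `exists_fixedPoint` solves the equation. Composition is injective in its
inner argument (`comp_injective`), which gives uniqueness and, with associativity (`comp_comp`),
turns the one-sided inverse into a two-sided one. Counting generators also gives the shape of the
exponents (`exists_form`): for each power x^{β/α} only ℓ^{γ+K} ℓ₂^{-a} with 0 ≤ a ≤ K occur, which
is the two-variable form of the blocks.

Convergence. The values of the monomials at a small x are multiplicative weights, and they define a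
weighted ℓ¹ norm on series. If ĝ is truncated to finitely many terms, `invOp` preserves the unit
ball for all small x, so the truncated inverse converges absolutely, and its sum Y solves the
truncated equation exactly (`sum_monomialFun_evalSum`). A block depends only on a sufficiently long
truncation, so every block of the full inverse converges. The same norm with x replaced by x^η in
the powers of x leaves room to show that the terms beyond x^M are o(x^M) (`isLittleO_tail`).

The germ. Asymptotic expansions need not be differentiable, but a bounded extension to a quadratic
domain bounds the second derivative in t = -log x. Interpolation then gives g' ≥ κ x^α
(`DulacLead.deriv_lower_bound`), so g has an analytic inverse, and the mean value theorem bounds g⁻¹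
- Y by |g(Y) - x|, which is as small as desired for a long truncation (`isBigO_sub_truncated`).

Sections. As the blocks converge, coherence fixes the values of a section on them, so the expansion
of g⁻¹ by sums of blocks is the sectional one. Uniqueness is by induction on depth
(`isSectionalExpansion_unique`): at the first block where two expansions differ, the coefficients
evaluated at ℓ(x) differ by o(x^ε), hence are equal up to a flat germ of their own variable. -/

theorem smul_eq_C_mul' (r : ℝ) (F : Series) : r • F = HahnSeries.C r * F :=
  (HahnSeries.C_mul_eq_smul).symm

theorem smul_mul_smul' (r s : ℝ) (F G : Series) : (r • F) * (s • G) = (r * s) • (F * G) := by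
  simp only [smul_eq_C_mul', map_mul]; ring

theorem smul_smul' (r s : ℝ) (F : Series) : r • (s • F) = (r * s) • F := by
  ext; simp [mul_assoc]

theorem zero_smul' (F : Series) : (0 : ℝ) • F = 0 := by ext; simp

theorem one_smul' (F : Series) : (1 : ℝ) • F = F := by
  rw [smul_eq_C_mul', map_one, one_mul]

theorem add_smul' (r s : ℝ) (F : Series) : (r + s) • F = r • F + s • F := by
  ext; simp [add_mul]

theorem smul_add' (r : ℝ) (F G : Series) : r • (F + G) = r • F + r • G := by
  ext; simp

/-! ### Finite sums -/

theorem finsum_swap {ι κ : Type*} (f : ι → κ → ℝ)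
    (hf : {p : ι × κ | f p.1 p.2 ≠ 0}.Finite) :
    ∑ᶠ i, ∑ᶠ k, f i k = ∑ᶠ k, ∑ᶠ i, f i k := by
  have h1 := finsum_curry (fun p : ι × κ => f p.1 p.2) hf
  have hf' : {p : κ × ι | f p.2 p.1 ≠ 0}.Finite := by
    refine (hf.image Prod.swap).subset ?_
    rintro ⟨k, i⟩ h
    exact ⟨(i, k), h, rfl⟩
  have h2 := finsum_curry (fun p : κ × ι => f p.2 p.1) hf'
  rw [← h1, ← h2]
  exact (finsum_comp_equiv (Equiv.prodComm κ ι) (f := fun p : ι × κ => f p.1 p.2)).symm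

theorem finsum_fiberwise {ι κ : Type*} [DecidableEq κ] (h : ι → ℝ) (π : ι → κ)
    (hh : {i | h i ≠ 0}.Finite) :
    ∑ᶠ i, h i = ∑ᶠ k, ∑ᶠ i, if π i = k then h i else 0 := by
  rw [← finsum_swap]
  · refine finsum_congr fun i => ?_
    rw [finsum_eq_single _ (π i) (fun k hk => by simp [Ne.symm hk])]
    simp
  · refine (hh.image fun i => (i, π i)).subset ?_
    rintro ⟨i, k⟩ h'
    simp only [mem_ofPred_eq, ne_eq, ite_eq_right_iff, Classical.not_imp] at h'
    exact ⟨i, h'.2, by simp [h'.1]⟩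

/-! ### Supports of Hahn series -/

open HahnSeries in
theorem orderTop_pos_iff {F : Series} : 0 < F.orderTop ↔ F.support ⊆ Ioi 0 := by
  change _ ↔ ∀ e ∈ F.support, e ∈ Ioi (0 : Expo)
  simp only [mem_Ioi]
  constructor
  · intro h e he
    exact WithTop.coe_pos.1 (h.trans_le (orderTop_le_of_coeff_ne_zero he))
  · intro h
    by_cases hF : F = 0
    · simp [hF]
    · rw [zero_lt_orderTop_iff hF]
      exact h _ (coeff_order_eq_zero.not.2 hF)

theorem support_add_subset' {F G : Series} {J : Set Expo} (hF : F.support ⊆ J)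
    (hG : G.support ⊆ J) : (F + G).support ⊆ J :=
  (HahnSeries.support_add_subset _ _).trans (union_subset hF hG)

theorem support_neg_subset' {F : Series} {J : Set Expo} (hF : F.support ⊆ J) :
    (-F).support ⊆ J := by simpa using hF

theorem support_sub_subset' {F G : Series} {J : Set Expo} (hF : F.support ⊆ J)
    (hG : G.support ⊆ J) : (F - G).support ⊆ J := by
  rw [sub_eq_add_neg]; exact support_add_subset' hF (support_neg_subset' hG)

theorem support_smul_subset' {F : Series} {J : Set Expo} (r : ℝ) (hF : F.support ⊆ J) :
    (r • F).support ⊆ J := fun e he => hF fun h => he (by simp [h])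

theorem support_mul_subset' {F G : Series} {I J K : Set Expo} (hF : F.support ⊆ I)
    (hG : G.support ⊆ J) (h : ∀ a ∈ I, ∀ b ∈ J, a + b ∈ K) : (F * G).support ⊆ K := by
  intro e he
  obtain ⟨a, ha, b, hb, rfl⟩ := HahnSeries.support_mul_subset he
  exact h a (hF ha) b (hG hb)

theorem support_single_subset' {e : Expo} {c : ℝ} {J : Set Expo} (h : e ∈ J) :
    (HahnSeries.single e c : Series).support ⊆ J :=
  (HahnSeries.support_single_subset).trans (by simpa using h)

theorem support_pow_subset' {F : Series} {I : AddSubmonoid Expo} (hF : F.support ⊆ I) (n : ℕ) :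
    (F ^ n).support ⊆ I :=
  (HahnSeries.SummableFamily.support_pow_subset_closure F n).trans
    (AddSubmonoid.closure_le.2 hF)

/-- A set `J` absorbing the monoid `I` acts as an ideal: congruence modulo series supported in `J`
is preserved by products with series supported in `I`, and telescoping yields powers. All later
comparisons of two series use this device. -/
theorem support_pow_sub_pow_subset {x y : Series} {I : AddSubmonoid Expo} {J : Set Expo}
    (hJ : ∀ a ∈ J, ∀ b ∈ I, a + b ∈ J) (hx : x.support ⊆ I) (hy : y.support ⊆ I)
    (hxy : (x - y).support ⊆ J) (n : ℕ) : (x ^ n - y ^ n).support ⊆ J := by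
  induction n with
  | zero => simp
  | succ n ih =>
    have : x ^ (n + 1) - y ^ (n + 1) = (x ^ n - y ^ n) * x + (x - y) * y ^ n := by ring
    rw [this]
    exact support_add_subset' (support_mul_subset' ih hx hJ)
      (support_mul_subset' hxy (support_pow_subset' hy n) hJ)

/-! ### Evaluation of power series -/

open PowerSeries in
theorem coeff_heval' {x : Series} (hx : 0 < x.orderTop) (f : PowerSeries ℝ) (e : Expo) :
    (heval x f).coeff e = ∑ᶠ n, PowerSeries.coeff n f * (x ^ n).coeff e := by
  rw [coeff_heval]
  refine finsum_congr fun n => ?_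
  simp [hx]

theorem finite_coeff_pow {x : Series} (hx : 0 < x.orderTop) (e : Expo) :
    {n : ℕ | (x ^ n).coeff e ≠ 0}.Finite :=
  HahnSeries.SummableFamily.pow_finite_co_support hx e

open PowerSeries in
theorem support_heval_subset {x : Series} (hx : 0 < x.orderTop) (f : PowerSeries ℝ)
    {I : AddSubmonoid Expo} (hI : x.support ⊆ I) : (heval x f).support ⊆ I := by
  intro e he
  by_contra hne
  refine he ?_
  rw [coeff_heval' hx]
  refine finsum_eq_zero_of_forall_eq_zero fun n => ?_
  have : (x ^ n).coeff e = 0 := by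
    by_contra h; exact hne (support_pow_subset' hI n h)
  simp [this]

open PowerSeries in
theorem support_heval_sub_subset {x y : Series} (hx : 0 < x.orderTop) (hy : 0 < y.orderTop)
    (f : PowerSeries ℝ) {I : AddSubmonoid Expo} {J : Set Expo}
    (hJ : ∀ a ∈ J, ∀ b ∈ I, a + b ∈ J) (hxI : x.support ⊆ I) (hyI : y.support ⊆ I)
    (hxy : (x - y).support ⊆ J) : (heval x f - heval y f).support ⊆ J := by
  intro e he
  by_contra hne
  refine he ?_
  rw [HahnSeries.coeff_sub, coeff_heval' hx, coeff_heval' hy, sub_eq_zero]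
  refine finsum_congr fun n => ?_
  have : (x ^ n - y ^ n).coeff e = 0 := by
    by_contra h; exact hne (support_pow_sub_pow_subset hJ hxI hyI hxy n h)
  rw [HahnSeries.coeff_sub, sub_eq_zero] at this
  rw [this]

-- Congruence with the evaluation at 0, which vanishes because the constant coefficient does.
open PowerSeries in
theorem support_heval_subset_of_constantCoeff {x : Series} (hx : 0 < x.orderTop)
    (f : PowerSeries ℝ) (hf : constantCoeff f = 0) {I : AddSubmonoid Expo} {J : Set Expo}
    (hJ : ∀ a ∈ J, ∀ b ∈ I, a + b ∈ J) (hxI : x.support ⊆ I) (hxJ : x.support ⊆ J) :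
    (heval x f).support ⊆ J := by
  have h0 : heval (0 : Series) f = 0 := by
    ext e
    rw [coeff_heval' (by simp)]
    refine finsum_eq_zero_of_forall_eq_zero fun n => ?_
    rcases Nat.eq_zero_or_pos n with rfl | hn
    · simp [hf]
    · simp [zero_pow hn.ne']
  have := support_heval_sub_subset hx (y := 0) (by simp) f hJ hxI (by simp) (by simpa using hxJ)
  rwa [h0, sub_zero] at this

/-- Nonnegative exponents. -/
def nonnegExpo : AddSubmonoid Expo where
  carrier := Ici 0
  zero_mem' := mem_Ici.2 le_rfl
  add_mem' := fun ha hb => mem_Ici.2 (add_nonneg (mem_Ici.1 ha) (mem_Ici.1 hb))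

theorem mem_nonnegExpo {e : Expo} : e ∈ nonnegExpo ↔ 0 ≤ e := Iff.rfl

theorem pos_add_nonneg_mem : ∀ a ∈ Ioi (0 : Expo), ∀ b ∈ nonnegExpo, a + b ∈ Ioi (0 : Expo) :=
  fun _ ha _ hb => mem_Ioi.2 (add_pos_of_pos_of_nonneg (mem_Ioi.1 ha) (mem_nonnegExpo.1 hb))

theorem ici_add_nonneg_mem (ρ : Expo) : ∀ a ∈ Ici ρ, ∀ b ∈ nonnegExpo, a + b ∈ Ici ρ :=
  fun _ ha _ hb => mem_Ici.2 (le_add_of_le_of_nonneg (mem_Ici.1 ha) (mem_nonnegExpo.1 hb))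

theorem support_subset_nonneg {x : Series} (hx : 0 < x.orderTop) :
    x.support ⊆ nonnegExpo :=
  fun _ he => mem_nonnegExpo.2 (mem_Ioi.1 (orderTop_pos_iff.1 hx he)).le

open PowerSeries in
theorem heval_orderTop_pos {x : Series} (hx : 0 < x.orderTop) {f : PowerSeries ℝ}
    (hf : constantCoeff f = 0) : 0 < (heval x f).orderTop := by
  rw [orderTop_pos_iff]
  refine support_heval_subset_of_constantCoeff hx f hf (I := nonnegExpo) (J := Ioi 0)
    pos_add_nonneg_mem (support_subset_nonneg hx) ?_
  exact orderTop_pos_iff.1 hx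

open PowerSeries in
theorem coeff_pow_eq_zero_of_lt {f : PowerSeries ℝ} (hf : constantCoeff f = 0) {n k : ℕ}
    (h : k < n) : PowerSeries.coeff k (f ^ n) = 0 := by
  have : (X : PowerSeries ℝ) ^ n ∣ f ^ n := pow_dvd_pow_of_dvd (X_dvd_iff.2 hf) n
  exact X_pow_dvd_iff.1 this k h

-- Expanding both sides gives the same double sum in two orders. It is finite at each exponent: only
-- finitely many powers x^k reach it, and X^k does not occur in f^n once n > k.
open PowerSeries in
theorem heval_heval {x : Series} (hx : 0 < x.orderTop) {f : PowerSeries ℝ}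
    (hf : constantCoeff f = 0) (g : PowerSeries ℝ) :
    heval (heval x f) g = heval x (g.subst f) := by
  have hs : HasSubst f := HasSubst.of_constantCoeff_zero' hf
  ext e
  rw [coeff_heval' (heval_orderTop_pos hx hf), coeff_heval' hx]
  have hfin := finite_coeff_pow hx e
  have h1 : ∀ n, PowerSeries.coeff n g * ((heval x f) ^ n).coeff e =
      ∑ᶠ k, PowerSeries.coeff n g * (PowerSeries.coeff k (f ^ n) * (x ^ k).coeff e) := by
    intro n
    rw [← map_pow, coeff_heval' hx, mul_finsum]
  have h2 : ∀ k, PowerSeries.coeff k (g.subst f) * (x ^ k).coeff e =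
      ∑ᶠ n, PowerSeries.coeff n g * (PowerSeries.coeff k (f ^ n) * (x ^ k).coeff e) := by
    intro k
    rw [coeff_subst' hs, finsum_mul]
    exact finsum_congr fun n => by simp [mul_assoc]
  simp_rw [h1, h2]
  refine finsum_swap _ ?_
  refine ((hfin.biUnion (t := fun k => (fun n => (n, k)) '' {n | n ≤ k})
    fun k _ => (Set.finite_le_nat k).image _)).subset ?_
  rintro ⟨n, k⟩ h
  simp only [mem_ofPred_eq, ne_eq, mul_eq_zero, not_or] at h
  simp only [mem_iUnion]
  refine ⟨k, h.2.2, n, ?_, rfl⟩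
  by_contra hlt
  exact h.2.1 (coeff_pow_eq_zero_of_lt hf (not_le.1 hlt))

/-! ### Formal exponential and logarithm -/

/-- The formal exponential of an infinitesimal series. -/
def hexp (θ : Series) : Series := PowerSeries.heval θ (PowerSeries.exp ℝ)

/-- The power series of `log (1 + X)`. -/
def logSeries : PowerSeries ℝ := PowerSeries.mk fun n : ℕ => (-1 : ℝ) ^ (n + 1) / (n : ℝ)

/-- The formal logarithm of `1 + ε` for an infinitesimal series `ε`. -/
def hlog (ε : Series) : Series := PowerSeries.heval ε logSeries

open PowerSeries

theorem logSeries_eq : logSeries = PowerSeries.log ℝ := by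
  ext n
  rcases Nat.eq_zero_or_pos n with rfl | hn
  · simp [logSeries]
  · simp [logSeries, hn.ne']

theorem constantCoeff_logSeries : constantCoeff logSeries = 0 := by
  rw [logSeries_eq]; exact constantCoeff_log

theorem constantCoeff_exp_sub_one : constantCoeff (PowerSeries.exp ℝ - 1) = 0 := by simp

/-- Both sides have zero constant term, and by the chain rule both have derivative 1, since the
derivative of log(1+X) is the geometric series inverse to 1 + X. -/
theorem logSeries_subst_exp : logSeries.subst (PowerSeries.exp ℝ - 1) = (X : PowerSeries ℝ) := by
  have hs : HasSubst (PowerSeries.exp ℝ - 1) := HasSubst.exp_sub_one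
  refine derivative.ext (R := ℝ) ?_ ?_
  · rw [derivative_subst hs, logSeries_eq, deriv_log]
    have h1 : (PowerSeries.mk fun n ↦ algebraMap ℚ ℝ ((-1 : ℚ) ^ n)) * (1 + X) = 1 := by
      ext n
      rw [mul_add, mul_one, map_add]
      cases n with
      | zero => simp
      | succ n => simp [coeff_succ_mul_X, coeff_one, pow_succ]
    have h2 := congrArg (subst (PowerSeries.exp ℝ - 1)) h1
    rw [subst_mul hs, subst_add hs, subst_X hs] at h2
    have h3 : ((1 : PowerSeries ℝ).subst (PowerSeries.exp ℝ - 1) : PowerSeries ℝ) = 1 := by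
      rw [← coe_substAlgHom hs, map_one]
    rw [h3] at h2
    simpa [derivative_exp] using h2
  · rw [constantCoeff_X]
    exact constantCoeff_subst_eq_zero constantCoeff_exp_sub_one _
      constantCoeff_logSeries

theorem eq_of_derivative_eq_smul {f g : PowerSeries ℝ} {r : ℝ} (hf : d⁄dX ℝ f = r • f)
    (hg : d⁄dX ℝ g = r • g) (h0 : constantCoeff f = constantCoeff g) : f = g := by
  ext n
  induction n with
  | zero => simpa using h0
  | succ n ih =>
    have h1 := congrArg (PowerSeries.coeff n) hf
    have h2 := congrArg (PowerSeries.coeff n) hg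
    rw [coeff_derivative] at h1 h2
    have : (n : ℝ) + 1 ≠ 0 := by positivity
    apply mul_right_cancel₀ this
    rw [h1, h2]; simp [ih]

/-- The differential equation of (1+X)^r, coefficientwise the recursion (n+1) C(r,n+1) = (r-n)
C(r,n). -/
theorem derivative_binomialSeries (r : ℝ) :
    (1 + X) * d⁄dX ℝ (PowerSeries.binomialSeries ℝ r) = r • PowerSeries.binomialSeries ℝ r := by
  ext n
  have key : ∀ n : ℕ, Ring.choose r (n + 1) * ((n : ℝ) + 1) = (r - n) * Ring.choose r n := by
    intro n
    have h := Ring.descPochhammer_eq_factorial_smul_choose r n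
    have h' := Ring.descPochhammer_eq_factorial_smul_choose r (n + 1)
    rw [descPochhammer_succ_right] at h'
    simp only [Polynomial.smeval_mul, Polynomial.smeval_sub, Polynomial.smeval_X,
      Polynomial.smeval_natCast, h, pow_one, pow_zero] at h'
    simp only [nsmul_eq_mul, Nat.factorial_succ, Nat.cast_mul, mul_one] at h'
    have hn : (n.factorial : ℝ) ≠ 0 := by positivity
    apply mul_left_cancel₀ hn
    push_cast at h'
    linear_combination -h'
  rw [add_mul, one_mul, map_add]
  cases n with
  | zero =>
    have := key 0
    simp [coeff_derivative, binomialSeries_coeff] at this ⊢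
  | succ n =>
    have := key (n + 1)
    simp only [coeff_derivative, binomialSeries_coeff, coeff_succ_X_mul, map_smul, smul_eq_mul,
      mul_one] at this ⊢
    push_cast at this ⊢
    linear_combination this

/-- Both sides solve f' = r f with constant term 1. This identity is what makes formal real powers
act on the logarithm by scaling. -/
theorem binomialSeries_subst_exp (r : ℝ) :
    (PowerSeries.binomialSeries ℝ r).subst (PowerSeries.exp ℝ - 1) =
      (PowerSeries.exp ℝ).subst (r • (X : PowerSeries ℝ)) := by
  have hs : HasSubst (PowerSeries.exp ℝ - 1) := HasSubst.exp_sub_one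
  have hr : HasSubst (r • (X : PowerSeries ℝ)) := HasSubst.smul_X' r
  refine eq_of_derivative_eq_smul (r := r) ?_ ?_ ?_
  · have h := congrArg (subst (PowerSeries.exp ℝ - 1)) (derivative_binomialSeries r)
    have h3 : ((1 : PowerSeries ℝ).subst (PowerSeries.exp ℝ - 1) : PowerSeries ℝ) = 1 := by
      rw [← coe_substAlgHom hs, map_one]
    rw [subst_mul hs, subst_add hs, subst_X hs, h3, subst_smul hs] at h
    rw [derivative_subst hs, ← h]
    simp [derivative_exp, mul_comm]
  · rw [derivative_subst hr, derivative_exp]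
    simp [mul_comm, smul_eq_C_mul]
  · rw [← coeff_zero_eq_constantCoeff_apply, ← coeff_zero_eq_constantCoeff_apply,
      coeff_subst' hs, coeff_subst' hr, finsum_eq_single _ 0, finsum_eq_single _ 0]
    · simp
    · intro n hn; simp [hn]
    · intro n hn; simp [hn]

theorem hexp_sub_one (θ : Series) :
    hexp θ - 1 = heval θ (PowerSeries.exp ℝ - 1) := by
  rw [hexp, map_sub, map_one]

theorem hexp_sub_one_orderTop_pos {θ : Series} (hθ : 0 < θ.orderTop) :
    0 < (hexp θ - 1).orderTop := by
  rw [hexp_sub_one]; exact heval_orderTop_pos hθ constantCoeff_exp_sub_one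

theorem hlog_orderTop_pos {ε : Series} (hε : 0 < ε.orderTop) : 0 < (hlog ε).orderTop :=
  heval_orderTop_pos hε constantCoeff_logSeries

theorem hlog_hexp {θ : Series} (hθ : 0 < θ.orderTop) : hlog (hexp θ - 1) = θ := by
  rw [hexp_sub_one, hlog, heval_heval hθ constantCoeff_exp_sub_one, logSeries_subst_exp,
    heval_X _ hθ]

theorem smul_orderTop_pos {θ : Series} (hθ : 0 < θ.orderTop) (r : ℝ) : 0 < (r • θ).orderTop := by
  rw [orderTop_pos_iff] at *
  exact support_smul_subset' (J := Ioi 0) r hθ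

theorem add_orderTop_pos {θ η : Series} (hθ : 0 < θ.orderTop) (hη : 0 < η.orderTop) :
    0 < (θ + η).orderTop := by
  rw [orderTop_pos_iff] at *
  exact support_add_subset' (J := Ioi 0) hθ hη

theorem neg_orderTop_pos {θ : Series} (hθ : 0 < θ.orderTop) : 0 < (-θ).orderTop := by
  rw [orderTop_pos_iff] at *
  exact support_neg_subset' (J := Ioi 0) hθ

theorem sub_orderTop_pos {θ η : Series} (hθ : 0 < θ.orderTop) (hη : 0 < η.orderTop) :
    0 < (θ - η).orderTop := by
  rw [sub_eq_add_neg]; exact add_orderTop_pos hθ (neg_orderTop_pos hη)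

theorem mul_orderTop_pos {θ η : Series} (hθ : 0 < θ.orderTop) (hη : η.support ⊆ nonnegExpo) :
    0 < (θ * η).orderTop := by
  rw [orderTop_pos_iff] at *
  exact support_mul_subset' (K := Ioi 0) hθ hη
    pos_add_nonneg_mem

theorem heval_binomialSeries_hexp {θ : Series} (hθ : 0 < θ.orderTop) (r : ℝ) :
    heval (hexp θ - 1) (PowerSeries.binomialSeries ℝ r) = hexp (r • θ) := by
  have h0 : constantCoeff (r • (X : PowerSeries ℝ)) = 0 := by simp
  rw [hexp_sub_one, heval_heval hθ constantCoeff_exp_sub_one, binomialSeries_subst_exp,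
    ← heval_heval hθ h0, map_smul, heval_X _ hθ, hexp]

/-- Let ρ be the order of a - b. Writing log(1+X) = X + X²k(X), equality of the logarithms expresses
a - b through products of a - b, or of a difference congruent to it, with infinitesimal factors. Its
support would then lie strictly beyond ρ. -/
theorem hlog_injective {a b : Series} (ha : 0 < a.orderTop) (hb : 0 < b.orderTop)
    (h : hlog a = hlog b) : a = b := by
  by_contra hab
  have hne : a - b ≠ 0 := sub_ne_zero.2 hab
  have hd : 0 < (a - b).orderTop := sub_orderTop_pos ha hb
  set ρ := (a - b).order with hρ
  have hρ0 : 0 < ρ := (HahnSeries.zero_lt_orderTop_iff hne).1 hd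
  -- `log (1 + X) = X + X ^ 2 * h`
  obtain ⟨k, hk⟩ : (X : PowerSeries ℝ) ^ 2 ∣ logSeries - X := by
    rw [X_pow_dvd_iff]
    intro n hn
    interval_cases n
    · simp [logSeries]
    · simp [logSeries, coeff_one_X]
  have hlog_eq : ∀ x : Series, 0 < x.orderTop → hlog x = x + x ^ 2 * heval x k := by
    intro x hx
    have : logSeries = X + X ^ 2 * k := by rw [← hk]; ring
    rw [hlog, this, map_add, map_mul, map_pow, heval_X _ hx]
  have e1 : (a - b) = -((a - b) * ((a + b) * heval a k) + b ^ 2 * (heval a k - heval b k)) := by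
    have := h
    rw [hlog_eq a ha, hlog_eq b hb] at this
    linear_combination this
  have hsub : (a - b).support ⊆ Ici ρ := fun e he => mem_Ici.2 (HahnSeries.order_le_of_coeff_ne_zero he)
  have hpos : (a - b).support ⊆ Ioi ρ := by
    rw [e1]
    refine support_neg_subset' (support_add_subset' ?_ ?_)
    · refine support_mul_subset' (I := Ici ρ) (J := Ioi 0) hsub ?_
        (fun x hx y hy => mem_Ioi.2 (lt_add_of_le_of_pos (mem_Ici.1 hx) (mem_Ioi.1 hy)))
      refine support_mul_subset' (I := Ioi 0) (J := nonnegExpo) ?_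
        (support_heval_subset ha k (support_subset_nonneg ha))
        pos_add_nonneg_mem
      exact orderTop_pos_iff.1 (add_orderTop_pos ha hb)
    · refine support_mul_subset' (I := Ioi 0) (J := Ici ρ) ?_
        (support_heval_sub_subset ha hb k (ici_add_nonneg_mem ρ) (support_subset_nonneg ha)
          (support_subset_nonneg hb) hsub) (fun x hx y hy => mem_Ioi.2 (lt_add_of_pos_of_le (mem_Ioi.1 hx) (mem_Ici.1 hy)))
      rw [pow_two]
      exact orderTop_pos_iff.1 (mul_orderTop_pos hb (support_subset_nonneg hb))
  have : ρ ∈ Ioi ρ := hpos (HahnSeries.coeff_order_eq_zero.not.2 hne)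
  exact lt_irrefl _ (mem_Ioi.1 this)

/-- The identity log(exp θ) = θ gives equal logarithms of both sides, and injectivity of the
logarithm finishes, so no second power series identity is needed. -/
theorem hexp_hlog {ε : Series} (hε : 0 < ε.orderTop) : hexp (hlog ε) = 1 + ε := by
  have h := hlog_hexp (hlog_orderTop_pos hε)
  have := hlog_injective (hexp_sub_one_orderTop_pos (hlog_orderTop_pos hε)) hε h
  linear_combination this

/-- The Cauchy product of the two exponential families, grouped along antidiagonals, is the binomial
theorem. -/
theorem hexp_add {a b : Series} (ha : 0 < a.orderTop) (hb : 0 < b.orderTop) :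
    hexp (a + b) = hexp a * hexp b := by
  classical
  set s := HahnSeries.SummableFamily.powerSeriesFamily a (PowerSeries.exp ℝ)
  set t := HahnSeries.SummableFamily.powerSeriesFamily b (PowerSeries.exp ℝ)
  have hs : ∀ n, s n = ((n.factorial : ℝ)⁻¹) • a ^ n := by
    intro n; simp [s, ha, coeff_exp]
  have ht : ∀ n, t n = ((n.factorial : ℝ)⁻¹) • b ^ n := by
    intro n; simp [t, hb, coeff_exp]
  have h1 : hexp a * hexp b = (s.mul t).hsum := by
    rw [HahnSeries.SummableFamily.hsum_mul]; rfl
  rw [h1]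
  ext e
  rw [HahnSeries.SummableFamily.coeff_hsum, hexp, coeff_heval' (add_orderTop_pos ha hb)]
  rw [finsum_fiberwise (fun p : ℕ × ℕ => ((s.mul t) p).coeff e) (fun p => p.1 + p.2)
    ((s.mul t).finite_co_support e)]
  refine finsum_congr fun n => ?_
  rw [finsum_eq_sum_of_support_subset (s := Finset.HasAntidiagonal.antidiagonal n)]
  swap
  · intro p hp
    simp only [Function.mem_support, ne_eq, ite_eq_right_iff, Classical.not_imp] at hp
    simpa using hp.1
  have : ∀ p ∈ Finset.HasAntidiagonal.antidiagonal n,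
      (if p.1 + p.2 = n then ((s.mul t) p).coeff e else 0) =
        (((n.factorial : ℝ)⁻¹) • ((n.choose p.1 : ℝ) • (a ^ p.1 * b ^ p.2))).coeff e := by
    intro p hp
    rw [Finset.HasAntidiagonal.mem_antidiagonal] at hp
    rw [if_pos hp, HahnSeries.SummableFamily.mul_toFun, hs, ht, smul_mul_smul', smul_smul']
    congr 2
    subst hp
    have := Nat.add_choose_mul_factorial_mul_factorial p.1 p.2
    have h' : ((p.1 + p.2).choose p.1 : ℝ) * p.1.factorial * p.2.factorial
      = (p.1 + p.2).factorial := by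
      rw [Nat.choose_symm_add]; exact_mod_cast this
    have hp1 : (p.1.factorial : ℝ) ≠ 0 := by positivity
    have hp2 : (p.2.factorial : ℝ) ≠ 0 := by positivity
    have hp3 : ((p.1 + p.2).factorial : ℝ) ≠ 0 := by positivity
    field_simp
    linear_combination -h'
  rw [Finset.sum_congr rfl this, (Commute.all a b).add_pow']
  rw [← HahnSeries.coeff_sum, ← Finset.smul_sum, HahnSeries.coeff_smul, coeff_exp]
  simp [HahnSeries.coeff_sum, ← Nat.cast_smul_eq_nsmul ℝ]

theorem hexp_zero : hexp 0 = 1 := by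
  ext e
  rw [hexp, coeff_heval' (by simp), finsum_eq_single _ 0]
  · simp [coeff_exp]
  · intro n hn; simp [zero_pow hn]

theorem hexp_mul_neg {a : Series} (ha : 0 < a.orderTop) : hexp a * hexp (-a) = 1 := by
  rw [← hexp_add ha (neg_orderTop_pos ha), add_neg_cancel, hexp_zero]

end

noncomputable section

/-! ### Exponents -/

theorem Expo.at_add (e e' : Expo) (i : ℕ) : (e + e').at i = e.at i + e'.at i := rfl

theorem Expo.at_sub (e e' : Expo) (i : ℕ) : (e - e').at i = e.at i - e'.at i := rfl

theorem Expo.at_neg (e : Expo) (i : ℕ) : (-e).at i = -e.at i := rfl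

theorem Expo.at_zero (i : ℕ) : (0 : Expo).at i = 0 := rfl

/-- Multiplication of exponents by real scalars. -/
def Expo.scale (r : ℝ) (e : Expo) : Expo := toLex (r • ofLex e)

theorem Expo.at_scale (r : ℝ) (e : Expo) (i : ℕ) : (Expo.scale r e).at i = r * e.at i := rfl

theorem Expo.ext' {e e' : Expo} (h : ∀ i, e.at i = e'.at i) : e = e' :=
  ofLex_inj.1 (Finsupp.ext h)

/-- The exponent of `ℓ_j`. -/
def Expo.delta (j : ℕ) : Expo := toLex (Finsupp.single j 1)

theorem Expo.at_delta (j i : ℕ) : (Expo.delta j).at i = if j = i then 1 else 0 :=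
  Finsupp.single_apply

theorem Expo.at_single (j i : ℕ) (r : ℝ) :
    Expo.at (toLex (Finsupp.single j r)) i = if j = i then r else 0 :=
  Finsupp.single_apply

theorem Expo.lt_of_at {e e' : Expo} (j : ℕ) (h : ∀ i < j, e.at i = e'.at i)
    (hj : e.at j < e'.at j) : e < e' := Finsupp.Lex.lt_iff.2 ⟨j, h, hj⟩

theorem Expo.exists_of_lt {e e' : Expo} (h : e < e') :
    ∃ j, (∀ i < j, e.at i = e'.at i) ∧ e.at j < e'.at j := Finsupp.Lex.lt_iff.1 h

theorem Expo.at_zero_mono {e e' : Expo} (h : e ≤ e') : e.at 0 ≤ e'.at 0 := by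
  by_contra hlt
  exact absurd (Expo.lt_of_at 0 (by simp) (not_le.1 hlt)) (not_lt.2 h)

theorem Expo.delta_pos (j : ℕ) : 0 < Expo.delta j := by
  refine Expo.lt_of_at j (fun i hi => ?_) ?_
  · simp [Expo.at_zero, Expo.at_delta, hi.ne']
  · simp [Expo.at_zero, Expo.at_delta]

theorem Expo.scale_add (r : ℝ) (e e' : Expo) :
    Expo.scale r (e + e') = Expo.scale r e + Expo.scale r e' :=
  Expo.ext' fun i => by simp [Expo.at_scale, Expo.at_add, mul_add]

theorem Expo.add_scale (r s : ℝ) (e : Expo) :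
    Expo.scale (r + s) e = Expo.scale r e + Expo.scale s e :=
  Expo.ext' fun i => by simp [Expo.at_scale, Expo.at_add, add_mul]

theorem Expo.scale_scale (r s : ℝ) (e : Expo) :
    Expo.scale r (Expo.scale s e) = Expo.scale (r * s) e :=
  Expo.ext' fun i => by simp [Expo.at_scale, mul_assoc]

theorem Expo.neg_one_scale (e : Expo) : Expo.scale (-1) e = -e :=
  Expo.ext' fun i => by simp [Expo.at_scale, Expo.at_neg]

theorem Expo.one_scale (e : Expo) : Expo.scale 1 e = e :=
  Expo.ext' fun i => by simp [Expo.at_scale]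

theorem Expo.zero_scale (e : Expo) : Expo.scale 0 e = 0 :=
  Expo.ext' fun i => by simp [Expo.at_scale, Expo.at_zero]

/-! ### Canonical forms -/

theorem order_leadingCoeff_of_support {G : Series} {e : Expo} {c : ℝ} (hc : c ≠ 0)
    (h : (G - HahnSeries.single e c).support ⊆ Ioi e) : G.order = e ∧ G.leadingCoeff = c := by
  have h1 : G.coeff e = c := by
    by_contra hne
    refine lt_irrefl e (mem_Ioi.1 (@h e ?_))
    simp only [HahnSeries.mem_support, HahnSeries.coeff_sub, HahnSeries.coeff_single_same]
    exact sub_ne_zero.2 hne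
  have hG : G ≠ 0 := by rintro rfl; exact hc (by simpa using h1.symm)
  have h2 : G.order = e := by
    refine le_antisymm (HahnSeries.order_le_of_coeff_ne_zero (by rwa [h1])) ?_
    by_contra hlt
    have hlt := not_le.1 hlt
    have : G.order ∈ Ioi e := h (by
      simp only [HahnSeries.mem_support, HahnSeries.coeff_sub,
        HahnSeries.coeff_single_of_ne hlt.ne, sub_zero]
      exact HahnSeries.coeff_order_eq_zero.not.2 hG)
    exact lt_asymm hlt (mem_Ioi.1 this)
  exact ⟨h2, by rw [HahnSeries.leadingCoeff_eq, h2, h1]⟩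

/-- The series `c x^{e₀} ℓ^{e₁} ⋯ exp θ`. -/
def expForm (e : Expo) (c : ℝ) (θ : Series) : Series := HahnSeries.single e c * hexp θ

theorem expForm_sub_single {θ : Series} (hθ : 0 < θ.orderTop) (e : Expo) (c : ℝ) :
    (expForm e c θ - HahnSeries.single e c).support ⊆ Ioi e := by
  have : expForm e c θ - HahnSeries.single e c = HahnSeries.single e c * (hexp θ - 1) := by
    rw [expForm]; ring
  rw [this]
  exact support_mul_subset' (support_single_subset' (mem_singleton e))
    (orderTop_pos_iff.1 (hexp_sub_one_orderTop_pos hθ))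
    (fun a ha b hb => by
      rw [mem_singleton_iff.1 ha]
      exact mem_Ioi.2 (lt_add_of_pos_right e (mem_Ioi.1 hb)))

theorem expForm_order {θ : Series} (hθ : 0 < θ.orderTop) (e : Expo) {c : ℝ} (hc : c ≠ 0) :
    (expForm e c θ).order = e :=
  (order_leadingCoeff_of_support hc (expForm_sub_single hθ e c)).1

theorem expForm_leadingCoeff {θ : Series} (hθ : 0 < θ.orderTop) (e : Expo) {c : ℝ}
    (hc : c ≠ 0) : (expForm e c θ).leadingCoeff = c :=
  (order_leadingCoeff_of_support hc (expForm_sub_single hθ e c)).2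

theorem expForm_mul {θ η : Series} (hθ : 0 < θ.orderTop) (hη : 0 < η.orderTop) (e e' : Expo)
    (c c' : ℝ) : expForm e c θ * expForm e' c' η = expForm (e + e') (c * c') (θ + η) := by
  rw [expForm, expForm, expForm, hexp_add hθ hη, ← HahnSeries.single_mul_single]; ring

theorem expForm_zero : expForm 0 1 0 = 1 := by
  rw [expForm, hexp_zero, mul_one]; rfl

theorem expForm_inv {θ : Series} (hθ : 0 < θ.orderTop) (e : Expo) {c : ℝ} (hc : c ≠ 0) :
    (expForm e c θ)⁻¹ = expForm (-e) c⁻¹ (-θ) := by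
  refine inv_eq_of_mul_eq_one_right ?_
  rw [expForm_mul hθ (neg_orderTop_pos hθ), add_neg_cancel, mul_inv_cancel₀ hc, add_neg_cancel,
    expForm_zero]

theorem smallPart_expForm {θ : Series} (hθ : 0 < θ.orderTop) (e : Expo) {c : ℝ} (hc : c ≠ 0) :
    smallPart (expForm e c θ) = hexp θ - 1 := by
  rw [smallPart, expForm_order hθ e hc, expForm_leadingCoeff hθ e hc, expForm,
    mul_right_comm, HahnSeries.single_mul_single, add_neg_cancel, mul_inv_cancel₀ hc]
  change 1 * hexp θ - 1 = _
  rw [one_mul]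

theorem smallPart_orderTop_pos {F : Series} (hF : F ≠ 0) : 0 < (smallPart F).orderTop := by
  have hl : F.leadingCoeff ≠ 0 := by simpa using hF
  rw [orderTop_pos_iff]
  intro e he
  have hcoef : (smallPart F).coeff e =
      F.coeff (e + F.order) * (F.leadingCoeff)⁻¹ - (1 : Series).coeff e := by
    rw [smallPart, HahnSeries.coeff_sub]
    congr 1
    have := HahnSeries.coeff_mul_single_add (r := (F.leadingCoeff)⁻¹) (x := F)
      (a := e + F.order) (b := -F.order)
    rwa [add_neg_cancel_right] at this
  rw [HahnSeries.mem_support, hcoef] at he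
  rw [mem_Ioi]
  by_contra hle
  rcases (not_lt.1 hle).lt_or_eq with hlt | rfl
  · refine he ?_
    have h1 : F.coeff (e + F.order) = 0 := by
      by_contra hne
      have := HahnSeries.order_le_of_coeff_ne_zero hne
      exact absurd this (not_le.2 (by simpa using hlt))
    rw [h1, HahnSeries.coeff_one, if_neg hlt.ne]; simp
  · refine he ?_
    rw [zero_add, ← HahnSeries.leadingCoeff_eq, mul_inv_cancel₀ hl, HahnSeries.coeff_one,
      if_pos rfl, sub_self]

/-- Every nonzero series is a triple (exponent, coefficient, infinitesimal logarithm). In these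
coordinates products add, real powers scale, and the logarithm is read off, which reduces the formal
calculus below to linear algebra. -/
theorem eq_expForm {F : Series} (hF : F ≠ 0) :
    F = expForm F.order F.leadingCoeff (hlog (smallPart F)) := by
  have hl : F.leadingCoeff ≠ 0 := by simpa using hF
  rw [expForm, hexp_hlog (smallPart_orderTop_pos hF), smallPart]
  have : (HahnSeries.single F.order F.leadingCoeff : Series) *
      HahnSeries.single (-F.order) (F.leadingCoeff)⁻¹ = 1 := by
    rw [HahnSeries.single_mul_single, add_neg_cancel, mul_inv_cancel₀ hl]; rfl
  linear_combination (-F) * this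

theorem fpow_expForm {θ : Series} (hθ : 0 < θ.orderTop) (e : Expo) {c : ℝ} (hc : 0 < c)
    (r : ℝ) : fpow (expForm e c θ) r = expForm (Expo.scale r e) (c ^ r) (r • θ) := by
  rw [fpow, smallPart_expForm hθ e hc.ne', expForm_order hθ e hc.ne',
    expForm_leadingCoeff hθ e hc.ne', heval_binomialSeries_hexp hθ]
  rfl

/-- The series `∑ e_j ℓ_{j+1}⁻¹`, the formal `-log` of the monomial with exponent `e`. -/
def logPart (e : Expo) : Series := (ofLex e).sum fun j r => r • ellPow (j + 1) (-1)

theorem logPart_add (e e' : Expo) : logPart (e + e') = logPart e + logPart e' :=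
  Finsupp.sum_add_index' (fun _ => zero_smul' _) (fun _ r s => add_smul' r s _)

theorem logPart_single (j : ℕ) (r : ℝ) :
    logPart (toLex (Finsupp.single j r)) = r • ellPow (j + 1) (-1) :=
  Finsupp.sum_single_index (zero_smul' _)

theorem logPart_scale (r : ℝ) (e : Expo) : logPart (Expo.scale r e) = r • logPart e := by
  rw [logPart, Expo.scale, ofLex_toLex, 
    Finsupp.sum_smul_index (h := fun j r => r • ellPow (j + 1) (-1)) (fun j => zero_smul' _),
    logPart, Finsupp.sum, Finsupp.sum]
  ext e'
  simp [HahnSeries.coeff_sum, Finset.mul_sum, mul_assoc]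

theorem flog_expForm {θ : Series} (hθ : 0 < θ.orderTop) (e : Expo) {c : ℝ} (hc : 0 < c) :
    flog (expForm e c θ) = HahnSeries.C (Real.log c) - logPart e + θ := by
  have h := hlog_hexp hθ
  rw [hlog, logSeries] at h
  rw [flog, smallPart_expForm hθ e hc.ne', expForm_order hθ e hc.ne',
    expForm_leadingCoeff hθ e hc.ne', h, logPart]

theorem neg_flog_expForm {θ : Series} (hθ : 0 < θ.orderTop) (e : Expo) {c : ℝ} (hc : 0 < c) :
    -flog (expForm e c θ) = logPart e - HahnSeries.C (Real.log c) - θ := by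
  rw [flog_expForm hθ e hc]; ring

/-- The exponents of ℓ₁⁻¹, ℓ₂⁻¹, … increase, so the first nonzero entry of `e` supplies the dominant
term of the logarithm. -/
theorem support_logPart_sub {e : Expo} {j : ℕ} (hj : ∀ i < j, e.at i = 0) :
    (logPart e - HahnSeries.single (-Expo.delta (j + 1)) (e.at j)).support ⊆
      Ioi (-Expo.delta (j + 1)) := by
  have hs : ∀ k, (ellPow (k + 1) (-1)) = HahnSeries.single (-Expo.delta (k + 1)) (1 : ℝ) := by
    intro k
    rw [ellPow]
    congr 2
    refine Expo.ext' fun i => ?_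
    rw [Expo.at_neg, Expo.at_single, Expo.at_delta]
    split_ifs <;> simp
  intro f hf
  rw [mem_Ioi]
  by_contra hle
  refine hf ?_
  rw [HahnSeries.coeff_sub, logPart, Finsupp.sum, HahnSeries.coeff_sum]
  have hterm : ∀ k, (((ofLex e) k) • ellPow (k + 1) (-1)).coeff f =
      if f = -Expo.delta (k + 1) then e.at k else 0 := by
    intro k
    rw [hs, HahnSeries.coeff_smul, HahnSeries.coeff_single]
    split_ifs <;> simp [Expo.at]
  simp only [hterm]
  rw [HahnSeries.coeff_single, sub_eq_zero]
  by_cases hfe : f = -Expo.delta (j + 1)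
  · rw [if_pos hfe]
    rw [Finset.sum_eq_single j]
    · rw [if_pos hfe]
    · intro k _ hk
      rw [if_neg]
      rw [hfe, neg_inj]
      intro h
      have := congrArg (fun e => Expo.at e (j + 1)) h
      simp [Expo.at_delta, hk] at this
    · intro hjs
      rw [if_pos hfe]
      simpa [Expo.at] using hjs
  · rw [if_neg hfe]
    refine Finset.sum_eq_zero fun k hk => ?_
    split_ifs with h
    · rcases lt_trichotomy k j with hkj | rfl | hkj
      · exact hj k hkj
      · exact absurd h hfe
      · exfalso
        apply hle
        rw [h, neg_lt_neg_iff]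
        refine Expo.lt_of_at (j + 1) (fun i hi => ?_) ?_
        · simp only [Expo.at_delta]; rw [if_neg (by omega), if_neg (by omega)]
        · rw [Expo.at_delta, Expo.at_delta, if_neg (by omega), if_pos rfl]; norm_num
    · rfl

/-- The leading exponent of `F` is positive with first nonzero entry in position `j`, and the
leading coefficient is positive. -/
structure IsLeading (j : ℕ) (F : Series) : Prop where
  pos : 0 < F.leadingCoeff
  at_lt : ∀ i < j, F.order.at i = 0
  at_pos : 0 < F.order.at j

theorem IsLeading.ne_zero {j : ℕ} {F : Series} (h : IsLeading j F) : F ≠ 0 := by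
  rintro rfl; simpa using h.pos

theorem exists_expForm {F : Series} (h : 0 < F.leadingCoeff) :
    ∃ θ : Series, 0 < θ.orderTop ∧ F = expForm F.order F.leadingCoeff θ := by
  have hF : F ≠ 0 := by rintro rfl; simp at h
  exact ⟨_, hlog_orderTop_pos (smallPart_orderTop_pos hF), eq_expForm hF⟩

theorem IsLeading.neg_flog {j : ℕ} {F : Series} (h : IsLeading j F) :
    (-flog F).order = -Expo.delta (j + 1) ∧ (-flog F).leadingCoeff = F.order.at j := by
  obtain ⟨θ, hθ, hF⟩ := exists_expForm h.pos
  refine order_leadingCoeff_of_support h.at_pos.ne' ?_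
  have h1 : -flog F = logPart F.order - HahnSeries.C (Real.log F.leadingCoeff) - θ := by
    conv_lhs => rw [hF]
    exact neg_flog_expForm hθ _ h.pos
  rw [h1]
  have h2 : logPart F.order - HahnSeries.C (Real.log F.leadingCoeff) - θ -
      HahnSeries.single (-Expo.delta (j + 1)) (F.order.at j) =
      (logPart F.order - HahnSeries.single (-Expo.delta (j + 1)) (F.order.at j)) -
      HahnSeries.C (Real.log F.leadingCoeff) - θ := by ring
  have hneg : -Expo.delta (j + 1) < 0 := neg_lt_zero.2 (Expo.delta_pos _)
  rw [h2]
  refine support_sub_subset' (support_sub_subset' (support_logPart_sub h.at_lt) ?_) ?_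
  · exact support_single_subset' (mem_Ioi.2 hneg)
  · intro e he
    exact mem_Ioi.2 (hneg.trans (mem_Ioi.1 (orderTop_pos_iff.1 hθ he)))

theorem IsLeading.exists_neg_flog {j : ℕ} {F : Series} (h : IsLeading j F) :
    ∃ θ : Series, 0 < θ.orderTop ∧
      -flog F = expForm (-Expo.delta (j + 1)) (F.order.at j) (-θ) ∧
      fell F = expForm (Expo.delta (j + 1)) (F.order.at j)⁻¹ θ := by
  obtain ⟨h1, h2⟩ := h.neg_flog
  obtain ⟨θ, hθ, hF⟩ := exists_expForm (F := -flog F) (by rw [h2]; exact h.at_pos)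
  rw [h1, h2] at hF
  refine ⟨-θ, neg_orderTop_pos hθ, by rwa [neg_neg], ?_⟩
  rw [fell, hF, expForm_inv hθ _ h.at_pos.ne', neg_neg]

theorem IsLeading.fell {j : ℕ} {F : Series} (h : IsLeading j F) : IsLeading (j + 1) (fell F) := by
  obtain ⟨θ, hθ, -, hF⟩ := h.exists_neg_flog
  have hc : (F.order.at j)⁻¹ ≠ 0 := (inv_pos.2 h.at_pos).ne'
  have h1 : (Dulac.fell F).order = Expo.delta (j + 1) := by rw [hF, expForm_order hθ _ hc]
  refine ⟨?_, ?_, ?_⟩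
  · rw [hF, expForm_leadingCoeff hθ _ hc]; exact inv_pos.2 h.at_pos
  · intro i hi
    rw [h1, Expo.at_delta, if_neg hi.ne']
  · rw [h1, Expo.at_delta, if_pos rfl]; exact one_pos

/-! ### Laws of formal real powers -/

theorem fpow_add {F : Series} (hF : 0 < F.leadingCoeff) (r s : ℝ) :
    fpow F (r + s) = fpow F r * fpow F s := by
  obtain ⟨θ, hθ, h⟩ := exists_expForm hF
  rw [h, fpow_expForm hθ _ hF, fpow_expForm hθ _ hF, fpow_expForm hθ _ hF,
    expForm_mul (smul_orderTop_pos hθ _) (smul_orderTop_pos hθ _), ← Expo.add_scale,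
    ← Real.rpow_add hF, ← add_smul']

theorem fpow_zero {F : Series} (hF : 0 < F.leadingCoeff) : fpow F 0 = 1 := by
  obtain ⟨θ, hθ, h⟩ := exists_expForm hF
  rw [h, fpow_expForm hθ _ hF, Expo.zero_scale, Real.rpow_zero, zero_smul', expForm_zero]

theorem fpow_one {F : Series} (hF : 0 < F.leadingCoeff) : fpow F 1 = F := by
  obtain ⟨θ, hθ, h⟩ := exists_expForm hF
  conv_rhs => rw [h]
  rw [h, fpow_expForm hθ _ hF, Expo.one_scale, Real.rpow_one, one_smul',
    expForm_order hθ _ hF.ne', expForm_leadingCoeff hθ _ hF.ne']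

theorem fpow_neg_one {F : Series} (hF : 0 < F.leadingCoeff) : fpow F (-1) = F⁻¹ := by
  refine (inv_eq_of_mul_eq_one_right ?_).symm
  conv_lhs => rw [← fpow_one hF]
  rw [fpow_one hF]
  nth_rewrite 1 [← fpow_one hF]
  rw [← fpow_add hF, add_neg_cancel, fpow_zero hF]

end

noncomputable section

/-! ### Formal composition -/

/-- Exponents involving only `ℓ₀, …, ℓ_k`. -/
def depthLe (k : ℕ) : AddSubmonoid Expo where
  carrier := {e | ∀ i, k < i → e.at i = 0}
  zero_mem' := fun i _ => Expo.at_zero i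
  add_mem' := by
    intro a b ha hb i hi
    rw [Expo.at_add, ha i hi, hb i hi, add_zero]

theorem depthLe_mono {k l : ℕ} (h : k ≤ l) {e : Expo} (he : e ∈ depthLe k) : e ∈ depthLe l :=
  fun i hi => he i (h.trans_lt hi)

theorem scale_mem_depthLe {k : ℕ} {e : Expo} (r : ℝ) (he : e ∈ depthLe k) :
    Expo.scale r e ∈ depthLe k := fun i hi => by rw [Expo.at_scale, he i hi, mul_zero]

theorem delta_mem_depthLe {j k : ℕ} (h : j ≤ k) : Expo.delta j ∈ depthLe k :=
  fun i hi => by rw [Expo.at_delta, if_neg (by omega)]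

theorem neg_mem_depthLe {k : ℕ} {e : Expo} (he : e ∈ depthLe k) : -e ∈ depthLe k :=
  fun i hi => by rw [Expo.at_neg, he i hi, neg_zero]

theorem depthLe_two_ext {e e' : Expo} (he : e ∈ depthLe 2) (he' : e' ∈ depthLe 2)
    (h0 : e.at 0 = e'.at 0) (h1 : e.at 1 = e'.at 1) (h2 : e.at 2 = e'.at 2) : e = e' := by
  refine Expo.ext' fun i => ?_
  match i with
  | 0 => exact h0
  | 1 => exact h1
  | 2 => exact h2
  | i + 3 => rw [he (i + 3) (by omega), he' (i + 3) (by omega)]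

theorem depthLe_two_lt {e e' : Expo} (he : e ∈ depthLe 2) (he' : e' ∈ depthLe 2) (h : e < e') :
    e.at 0 < e'.at 0 ∨ (e.at 0 = e'.at 0 ∧ e.at 1 < e'.at 1) ∨
      (e.at 0 = e'.at 0 ∧ e.at 1 = e'.at 1 ∧ e.at 2 < e'.at 2) := by
  obtain ⟨j, hj, hlt⟩ := Expo.exists_of_lt h
  match j with
  | 0 => exact Or.inl hlt
  | 1 => exact Or.inr (Or.inl ⟨hj 0 (by omega), hlt⟩)
  | 2 => exact Or.inr (Or.inr ⟨hj 0 (by omega), hj 1 (by omega), hlt⟩)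
  | j + 3 =>
    rw [he (j + 3) (by omega), he' (j + 3) (by omega)] at hlt
    exact absurd hlt (lt_irrefl _)

/-- The leading exponents form the monotone image of a well-ordered set and all remainders lie in
one such set `Q`, so the supports lie in a sum of two partially well-ordered sets. Finiteness at `g`
is finiteness of the antidiagonal, since injectivity of `ψ` recovers `e` from its leading exponent.
-/
theorem summable_of_shift {s : Expo → Series} {I Q : Set Expo} (hI : I.IsPWO) (hQ : Q.IsPWO)
    {ψ : Expo → Expo} (hψ : StrictMonoOn ψ I)
    (hs : ∀ e ∈ I, ∀ f ∈ (s e).support, ∃ q ∈ Q, ψ e + q = f) (h0 : ∀ e ∉ I, s e = 0) :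
    (⋃ e, (s e).support).IsPWO ∧ ∀ g, {e | (s e).coeff g ≠ 0}.Finite := by
  have hJ : (ψ '' I).IsPWO := hI.image_of_monotoneOn hψ.monotoneOn
  have hmem : ∀ e f, f ∈ (s e).support → e ∈ I ∧ ∃ q ∈ Q, ψ e + q = f := by
    intro e f hf
    by_cases he : e ∈ I
    · exact ⟨he, hs e he f hf⟩
    · rw [h0 e he] at hf
      simp at hf
  constructor
  · refine (hJ.add hQ).mono ?_
    rintro f hf
    obtain ⟨e, he⟩ := mem_iUnion.1 hf
    obtain ⟨heI, q, hq, rfl⟩ := hmem e f he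
    exact Set.add_mem_add (mem_image_of_mem ψ heI) hq
  · intro g
    have hfin := Set.AddAntidiagonal.finite_of_isPWO hJ hQ g
    refine Set.Finite.of_finite_image (f := fun e => (ψ e, g - ψ e)) (hfin.subset ?_) ?_
    · rintro _ ⟨e, he, rfl⟩
      obtain ⟨heI, q, hq, rfl⟩ := hmem e g he
      rw [Set.mem_antidiagonal]
      exact ⟨mem_image_of_mem ψ heI, by simpa using hq, by simp⟩
    · intro e he e' he' h
      exact hψ.injOn (hmem e g he).1 (hmem e' g he').1 (Prod.ext_iff.1 h).1

/-! ### Composition of monomials with a series, and summability -/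

theorem monomialComp_eq {X : Series} (hX : IsLeading 0 X) {e : Expo} (he : e ∈ depthLe 2) :
    monomialComp e X = fpow X (e.at 0) * fpow (fell X) (e.at 1) * fpow (fell (fell X)) (e.at 2) := by
  have hpos : ∀ j, 0 < (fell^[j] X).leadingCoeff := by
    have : ∀ j, IsLeading j (fell^[j] X) := by
      intro j
      induction j with
      | zero => exact hX
      | succ j ih => rw [Function.iterate_succ_apply']; exact ih.fell
    exact fun j => (this j).pos
  rw [monomialComp, Finsupp.prod_of_support_subset (s := Finset.range 3)]
  · simp [Finset.prod_range_succ, Expo.at]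
  · intro i hi
    rw [Finset.mem_range]
    by_contra h
    exact (Finsupp.mem_support_iff.1 hi) (he i (by omega))
  · intro i _
    exact fpow_zero (hpos i)

/-- The leading exponent of the composition of the monomial of exponent `e` with `X`. -/
def compOrder (X : Series) (e : Expo) : Expo :=
  Expo.scale (e.at 0) X.order + Expo.scale (e.at 1) (Expo.delta 1) +
    Expo.scale (e.at 2) (Expo.delta 2)

/-- The leading coefficient of the composition of the monomial of exponent `e` with `X`. -/
def compCoeff (X : Series) (e : Expo) : ℝ :=
  X.leadingCoeff ^ (e.at 0) * ((X.order.at 0)⁻¹) ^ (e.at 1)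

theorem compCoeff_pos {X : Series} (hX : IsLeading 0 X) (e : Expo) : 0 < compCoeff X e :=
  mul_pos (Real.rpow_pos_of_pos hX.pos _) (Real.rpow_pos_of_pos (inv_pos.2 hX.at_pos) _)

theorem compOrder_scale (X : Series) (r : ℝ) (e : Expo) :
    compOrder X (Expo.scale r e) = Expo.scale r (compOrder X e) := by
  simp only [compOrder, Expo.at_scale, Expo.scale_add, Expo.scale_scale]

/-- The power of x in `X` is positive, so a strict inequality of first exponents survives; if these
agree, the contributions of `X` cancel and the later exponents are compared unchanged. -/
theorem compOrder_strictMonoOn {X : Series} (hX : IsLeading 0 X) :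
    StrictMonoOn (compOrder X) (depthLe 2) := by
  intro e he e' he' h
  have hat : ∀ (e : Expo) i, (compOrder X e).at i = e.at 0 * X.order.at i +
      (if i = 1 then e.at 1 else 0) + (if i = 2 then e.at 2 else 0) := by
    intro e i
    simp only [compOrder, Expo.at_add, Expo.at_scale, Expo.at_delta, @eq_comm _ i]
    split_ifs <;> simp
  rcases depthLe_two_lt he he' h with h0 | ⟨h0, h1⟩ | ⟨h0, h1, h2⟩
  · refine Expo.lt_of_at 0 (by simp) ?_
    simp only [hat]
    simpa using mul_lt_mul_of_pos_right h0 hX.at_pos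
  · refine Expo.lt_of_at 1 (fun i hi => ?_) ?_
    · have : i = 0 := by omega
      subst this
      simp [hat, h0]
    · simpa [hat, h0] using h1
  · refine Expo.lt_of_at 2 (fun i hi => ?_) ?_
    · have : i = 0 ∨ i = 1 := by omega
      rcases this with rfl | rfl <;> simp [hat, h0, h1]
    · simpa [hat, h0, h1] using h2

/-- The logarithm of a monomial at `X` is linear in its exponents, so the three logarithms of X, ℓ∘X
and ℓ₂∘X serve all monomials at once. This uniformity underlies summability and the comparison in
`comp_injective`. -/
theorem exists_compLogs {X : Series} (hX : IsLeading 0 X) :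
    ∃ θ₀ θ₁ θ₂ : Series, 0 < θ₀.orderTop ∧ 0 < θ₁.orderTop ∧ 0 < θ₂.orderTop ∧
      X = expForm X.order X.leadingCoeff θ₀ ∧
      fell X = expForm (Expo.delta 1) (X.order.at 0)⁻¹ θ₁ ∧
      ∀ e ∈ depthLe 2, monomialComp e X =
        expForm (compOrder X e) (compCoeff X e)
          (e.at 0 • θ₀ + e.at 1 • θ₁ + e.at 2 • θ₂) := by
  obtain ⟨θ₀, h₀, hX₀⟩ := exists_expForm hX.pos
  obtain ⟨θ₁, h₁, -, hX₁⟩ := hX.exists_neg_flog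
  obtain ⟨θ₂, h₂, -, hX₂⟩ := hX.fell.exists_neg_flog
  have ha : 0 < (X.order.at 0)⁻¹ := inv_pos.2 hX.at_pos
  have h1 : (fell X).order = Expo.delta 1 := by rw [hX₁]; exact expForm_order h₁ _ ha.ne'
  -- ℓ∘X starts with ℓ to the first power, so ℓ₂∘X has leading coefficient 1; this is why
  -- `compCoeff` has only two factors.
  have h2 : ((fell X).order.at 1)⁻¹ = 1 := by rw [h1, Expo.at_delta]; simp
  refine ⟨θ₀, θ₁, θ₂, h₀, h₁, h₂, hX₀, hX₁, fun e he => ?_⟩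
  rw [zero_add, h2] at hX₂
  rw [monomialComp_eq hX he, hX₂, hX₁, fpow_expForm h₂ _ one_pos, fpow_expForm h₁ _ ha]
  conv_lhs => rw [hX₀]
  rw [fpow_expForm h₀ _ hX.pos, expForm_mul (smul_orderTop_pos h₀ _) (smul_orderTop_pos h₁ _),
    expForm_mul (add_orderTop_pos (smul_orderTop_pos h₀ _) (smul_orderTop_pos h₁ _))
      (smul_orderTop_pos h₂ _), Real.one_rpow, mul_one]
  rw [← hX₀]
  rfl

theorem support_hexp_subset {θ : Series} (hθ : 0 < θ.orderTop) {I : AddSubmonoid Expo}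
    (h : θ.support ⊆ I) : (hexp θ).support ⊆ I := support_heval_subset hθ _ h

/-- The exponents of `e` only scale the three fixed logarithms, so the supports of all the
exponentials lie in the single monoid generated by the supports of these logarithms. -/
theorem IsLeading.exists_shift {X : Series} (hX : IsLeading 0 X) :
    ∃ Q : Set Expo, Q.IsPWO ∧ (∀ q ∈ Q, 0 ≤ q) ∧ ∀ e ∈ depthLe 2,
      ∀ f ∈ (monomialComp e X).support, ∃ q ∈ Q, compOrder X e + q = f := by
  obtain ⟨θ₀, θ₁, θ₂, h₀, h₁, h₂, -, -, h⟩ := exists_compLogs hX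
  set U := θ₀.support ∪ θ₁.support ∪ θ₂.support with hU
  have hU0 : ∀ q ∈ U, 0 ≤ q := by
    rintro q ((hq | hq) | hq)
    · exact (mem_Ioi.1 (orderTop_pos_iff.1 h₀ hq)).le
    · exact (mem_Ioi.1 (orderTop_pos_iff.1 h₁ hq)).le
    · exact (mem_Ioi.1 (orderTop_pos_iff.1 h₂ hq)).le
  have hUP : U.IsPWO := (θ₀.isPWO_support.union θ₁.isPWO_support).union θ₂.isPWO_support
  refine ⟨AddSubmonoid.closure U, hUP.addSubmonoid_closure hU0, ?_, ?_⟩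
  · intro q hq
    exact (AddSubmonoid.closure_le (S := nonnegExpo)).2 hU0 hq
  · intro e he f hf
    rw [h e he, expForm] at hf
    obtain ⟨a, ha, b, hb, rfl⟩ := HahnSeries.support_mul_subset hf
    have : a = compOrder X e := mem_singleton_iff.1 (HahnSeries.support_single_subset ha)
    subst this
    refine ⟨b, support_hexp_subset ?_ ?_ hb, rfl⟩
    · exact add_orderTop_pos (add_orderTop_pos (smul_orderTop_pos h₀ _) (smul_orderTop_pos h₁ _))
        (smul_orderTop_pos h₂ _)
    · have hsub : U ⊆ AddSubmonoid.closure U := AddSubmonoid.subset_closure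
      refine support_add_subset' (support_add_subset' ?_ ?_) ?_ <;>
        refine support_smul_subset' _ (Subset.trans ?_ hsub)
      · exact fun x hx => Or.inl (Or.inl hx)
      · exact fun x hx => Or.inl (Or.inr hx)
      · exact fun x hx => Or.inr hx

theorem IsLeading.summable_comp {X : Series} (hX : IsLeading 0 X) {I : Set Expo} (hI : I.IsPWO)
    (hI2 : I ⊆ depthLe 2) (g : Expo) : {e | e ∈ I ∧ (monomialComp e X).coeff g ≠ 0}.Finite := by
  classical
  obtain ⟨Q, hQ, -, hsh⟩ := hX.exists_shift
  have := (summable_of_shift (s := fun e => if e ∈ I then monomialComp e X else 0) hI hQ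
    ((compOrder_strictMonoOn hX).mono hI2)
    (fun e he f hf => hsh e (hI2 he) f (by simpa [he] using hf)) (fun e he => by simp [he])).2 g
  refine this.subset fun e he => ?_
  simpa [he.1] using he.2

/-- The family of terms of the composition `F ∘ X`. -/
def compFamily (X F : Series) (hX : IsLeading 0 X) (hF : F.support ⊆ depthLe 2) :
    HahnSeries.SummableFamily Expo ℝ Expo where
  toFun e := F.coeff e • monomialComp e X
  isPWO_iUnion_support' := by
    obtain ⟨Q, hQ, -, hsh⟩ := hX.exists_shift
    exact (summable_of_shift (s := fun e => F.coeff e • monomialComp e X) F.isPWO_support hQ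
      ((compOrder_strictMonoOn hX).mono hF)
      (fun e he f hf => hsh e (hF he) f (support_smul_subset' _ subset_rfl hf))
      (fun e he => by simp [HahnSeries.mem_support] at he; simp [he, zero_smul'])).1
  finite_co_support' g := by
    refine (hX.summable_comp F.isPWO_support hF g).subset fun e he => ?_
    simp only [mem_ofPred_eq, HahnSeries.coeff_smul, smul_eq_mul, ne_eq, mul_eq_zero,
      not_or] at he
    exact he

open Classical in
/-- The formal composition `F ∘ X`. -/
def comp (X F : Series) : Series :=
  if h : IsLeading 0 X ∧ F.support ⊆ depthLe 2 then (compFamily X F h.1 h.2).hsum else 0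

theorem comp_eq {X F : Series} (hX : IsLeading 0 X) (hF : F.support ⊆ depthLe 2) :
    comp X F = (compFamily X F hX hF).hsum := by rw [comp, dif_pos ⟨hX, hF⟩]

theorem coeff_comp {X F : Series} (hX : IsLeading 0 X) (hF : F.support ⊆ depthLe 2) (g : Expo) :
    (comp X F).coeff g = ∑ᶠ e, F.coeff e * (monomialComp e X).coeff g := by
  rw [comp_eq hX hF, HahnSeries.SummableFamily.coeff_hsum]; rfl

theorem finite_comp {X F : Series} (hX : IsLeading 0 X) (hF : F.support ⊆ depthLe 2) (g : Expo) :
    {e | F.coeff e * (monomialComp e X).coeff g ≠ 0}.Finite :=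
  (compFamily X F hX hF).finite_co_support g

theorem IsFormalComp.eq_comp {X F K : Series} (hX : IsLeading 0 X) (hF : F.support ⊆ depthLe 2)
    (h : IsFormalComp F X K) : K = comp X F := by
  obtain ⟨-, -, S, hS, rfl⟩ := h
  rw [comp_eq hX hF]
  congr 1
  ext1 e
  exact hS e

theorem isFormalComp_comp {X F : Series} (hX : IsLeading 0 X) (hF : F.support ⊆ depthLe 2) :
    IsFormalComp F X (comp X F) :=
  ⟨hX.pos, Expo.lt_of_at 0 (by simp) hX.at_pos, compFamily X F hX hF, fun _ => rfl,
    (comp_eq hX hF).symm⟩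

/-! ### Composition as a strongly linear ring homomorphism -/

theorem comp_single {X : Series} (hX : IsLeading 0 X) {e : Expo} (he : e ∈ depthLe 2) (c : ℝ) :
    comp X (HahnSeries.single e c) = c • monomialComp e X := by
  ext g
  rw [coeff_comp hX (support_single_subset' he), finsum_eq_single _ e]
  · simp
  · intro e' h; simp [HahnSeries.coeff_single_of_ne h]

theorem comp_add {X F G : Series} (hX : IsLeading 0 X) (hF : F.support ⊆ depthLe 2)
    (hG : G.support ⊆ depthLe 2) : comp X (F + G) = comp X F + comp X G := by
  ext g
  rw [HahnSeries.coeff_add, coeff_comp hX (support_add_subset' hF hG), coeff_comp hX hF,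
    coeff_comp hX hG, ← finsum_add_distrib (finite_comp hX hF g) (finite_comp hX hG g)]
  exact finsum_congr fun e => by simp [add_mul]

theorem comp_smul {X F : Series} (hX : IsLeading 0 X) (hF : F.support ⊆ depthLe 2) (r : ℝ) :
    comp X (r • F) = r • comp X F := by
  ext g
  rw [HahnSeries.coeff_smul, coeff_comp hX (support_smul_subset' r hF), coeff_comp hX hF,
    smul_finsum]
  exact finsum_congr fun e => by simp [mul_assoc]

theorem monomialComp_zero {X : Series} : monomialComp 0 X = 1 := Finsupp.prod_zero_index

theorem comp_one {X : Series} (hX : IsLeading 0 X) : comp X 1 = 1 := by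
  have : (1 : Series) = HahnSeries.single 0 1 := rfl
  rw [this, comp_single hX (depthLe 2).zero_mem, monomialComp_zero, one_smul']
  rfl

theorem monomialComp_add {X : Series} (hX : IsLeading 0 X) {e e' : Expo} (he : e ∈ depthLe 2)
    (he' : e' ∈ depthLe 2) : monomialComp (e + e') X = monomialComp e X * monomialComp e' X := by
  rw [monomialComp_eq hX he, monomialComp_eq hX he', monomialComp_eq hX ((depthLe 2).add_mem he he'),
    Expo.at_add, Expo.at_add, Expo.at_add, fpow_add hX.pos, fpow_add hX.fell.pos,
    fpow_add hX.fell.fell.pos]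
  ring

theorem support_mul_depth {F G : Series} {k : ℕ} (hF : F.support ⊆ depthLe k)
    (hG : G.support ⊆ depthLe k) : (F * G).support ⊆ depthLe k :=
  support_mul_subset' hF hG fun _ ha _ hb => (depthLe k).add_mem ha hb

/-- The product of the two families of terms is regrouped by the sum of the exponents, and
composition turns sums of exponents into products of monomials. -/
theorem comp_mul {X F G : Series} (hX : IsLeading 0 X) (hF : F.support ⊆ depthLe 2)
    (hG : G.support ⊆ depthLe 2) : comp X (F * G) = comp X F * comp X G := by
  classical
  ext g
  rw [comp_eq hX hF, comp_eq hX hG, ← HahnSeries.SummableFamily.hsum_mul,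
    HahnSeries.SummableFamily.coeff_hsum, coeff_comp hX (support_mul_depth hF hG)]
  rw [finsum_fiberwise _ (fun p : Expo × Expo => p.1 + p.2)
    (((compFamily X F hX hF).mul (compFamily X G hX hG)).finite_co_support g)]
  refine finsum_congr fun e => ?_
  rw [HahnSeries.coeff_mul, Finset.sum_mul]
  rw [finsum_eq_sum_of_support_subset
    (s := Finset.antidiagonal F.isPWO_support G.isPWO_support e)]
  · refine Finset.sum_congr rfl fun p hp => ?_
    obtain ⟨h1, h2, h3⟩ := Finset.mem_antidiagonal.1 hp
    rw [if_pos h3, HahnSeries.SummableFamily.mul_toFun, ← h3,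
      monomialComp_add hX (hF h1) (hG h2)]
    change _ = ((F.coeff p.1 • monomialComp p.1 X) * (G.coeff p.2 • monomialComp p.2 X)).coeff g
    rw [smul_mul_smul', HahnSeries.coeff_smul, smul_eq_mul]
  · intro p hp
    simp only [Function.mem_support, ne_eq, ite_eq_right_iff, Classical.not_imp] at hp
    have hne : (F.coeff p.1 • monomialComp p.1 X) * (G.coeff p.2 • monomialComp p.2 X) ≠ 0 := by
      intro h
      refine hp.2 ?_
      rw [HahnSeries.SummableFamily.mul_toFun]
      change ((F.coeff p.1 • monomialComp p.1 X) * (G.coeff p.2 • monomialComp p.2 X)).coeff g = 0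
      rw [h]; rfl
    rw [smul_mul_smul'] at hne
    have hc : F.coeff p.1 * G.coeff p.2 ≠ 0 := fun h => hne (by rw [h, zero_smul'])
    exact Finset.mem_coe.2 (Finset.mem_antidiagonal.2
      ⟨left_ne_zero_of_mul hc, right_ne_zero_of_mul hc, hp.1⟩)

theorem comp_pow {X F : Series} (hX : IsLeading 0 X) (hF : F.support ⊆ depthLe 2) (n : ℕ) :
    comp X (F ^ n) = comp X F ^ n := by
  induction n with
  | zero => rw [pow_zero, pow_zero, comp_one hX]
  | succ n ih => rw [pow_succ, pow_succ, comp_mul hX (support_pow_subset' hF n) hF, ih]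

theorem comp_orderTop_pos {X F : Series} (hX : IsLeading 0 X) (hF : F.support ⊆ depthLe 2)
    (h : 0 < F.orderTop) : 0 < (comp X F).orderTop := by
  obtain ⟨Q, -, hQ, hsh⟩ := hX.exists_shift
  rw [orderTop_pos_iff]
  intro g hg
  rw [HahnSeries.mem_support, coeff_comp hX hF] at hg
  obtain ⟨e, he⟩ : ∃ e, F.coeff e * (monomialComp e X).coeff g ≠ 0 := by
    by_contra hne
    push Not at hne
    exact hg (finsum_eq_zero_of_forall_eq_zero hne)
  have heF : e ∈ F.support := left_ne_zero_of_mul he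
  obtain ⟨q, hq, rfl⟩ := hsh e (hF heF) g (right_ne_zero_of_mul he)
  have h0 : compOrder X 0 = 0 := Expo.ext' fun i => by
    simp [compOrder, Expo.at_zero, Expo.zero_scale]
  have := compOrder_strictMonoOn hX (depthLe 2).zero_mem (hF heF)
    (mem_Ioi.1 (orderTop_pos_iff.1 h heF))
  rw [h0] at this
  exact mem_Ioi.2 (add_pos_of_pos_of_nonneg this (hQ q hq))

/-- The interchange of sums is legitimate because finitely many monomials reach a given exponent
after composition, and each of them occurs in finitely many members of the family. -/
theorem comp_hsum {X : Series} (hX : IsLeading 0 X) {ι : Type*}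
    (s : HahnSeries.SummableFamily Expo ℝ ι) (hs : ∀ i, (s i).support ⊆ depthLe 2) (g : Expo) :
    (comp X s.hsum).coeff g = ∑ᶠ i, (comp X (s i)).coeff g := by
  have hI : (⋃ i, (s i).support) ⊆ (depthLe 2 : Set Expo) := iUnion_subset hs
  have hsum : s.hsum.support ⊆ depthLe 2 :=
    (HahnSeries.SummableFamily.support_hsum_subset).trans hI
  rw [coeff_comp hX hsum]
  have h1 : ∀ i, (comp X (s i)).coeff g =
      ∑ᶠ e, (s i).coeff e * (monomialComp e X).coeff g := fun i => coeff_comp hX (hs i) g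
  have h2 : ∀ e, s.hsum.coeff e * (monomialComp e X).coeff g =
      ∑ᶠ i, (s i).coeff e * (monomialComp e X).coeff g := by
    intro e
    rw [HahnSeries.SummableFamily.coeff_hsum, finsum_mul]
  simp_rw [h1, h2]
  refine finsum_swap _ ?_
  refine (((hX.summable_comp s.isPWO_iUnion_support hI g).biUnion
    (t := fun e => (fun i => (e, i)) '' {i | (s i).coeff e ≠ 0})
    fun e _ => (s.finite_co_support e).image _)).subset ?_
  rintro ⟨e, i⟩ h
  have hc : (s i).coeff e * (monomialComp e X).coeff g ≠ 0 := h
  simp only [mem_iUnion]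
  exact ⟨e, ⟨⟨i, left_ne_zero_of_mul hc⟩, right_ne_zero_of_mul hc⟩, i,
    left_ne_zero_of_mul hc, rfl⟩

open PowerSeries in
theorem comp_heval {X θ : Series} (hX : IsLeading 0 X) (hd : θ.support ⊆ depthLe 2)
    (hθ : 0 < θ.orderTop) (f : PowerSeries ℝ) :
    comp X (heval θ f) = heval (comp X θ) f := by
  ext g
  rw [heval_apply, comp_hsum hX, coeff_heval' (comp_orderTop_pos hX hd hθ)]
  · refine finsum_congr fun n => ?_
    rw [HahnSeries.SummableFamily.powerSeriesFamily_of_orderTop_pos hθ,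
      comp_smul hX (support_pow_subset' hd n), comp_pow hX hd, HahnSeries.coeff_smul, smul_eq_mul]
  · intro n
    rw [HahnSeries.SummableFamily.powerSeriesFamily_of_orderTop_pos hθ]
    exact support_smul_subset' _ (support_pow_subset' hd n)

/-! ### Composition with exponentials, powers, logarithms and iterated composition -/

theorem comp_hexp {X θ : Series} (hX : IsLeading 0 X) (hd : θ.support ⊆ depthLe 2)
    (hθ : 0 < θ.orderTop) : comp X (hexp θ) = hexp (comp X θ) := comp_heval hX hd hθ _

theorem support_hlog_smallPart {F : Series} (hF : F ≠ 0) {k : ℕ} (hd : F.support ⊆ depthLe k) :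
    (hlog (smallPart F)).support ⊆ depthLe k := by
  refine support_heval_subset (smallPart_orderTop_pos hF) _ ?_
  refine support_sub_subset' (support_mul_depth hd (support_single_subset' ?_))
    (support_single_subset' (depthLe k).zero_mem)
  exact neg_mem_depthLe (hd (HahnSeries.coeff_order_eq_zero.not.2 hF))

theorem exists_expForm_depth {F : Series} (h : 0 < F.leadingCoeff) {k : ℕ}
    (hd : F.support ⊆ depthLe k) :
    ∃ θ : Series, 0 < θ.orderTop ∧ θ.support ⊆ depthLe k ∧
      F = expForm F.order F.leadingCoeff θ := by
  have hF : F ≠ 0 := by rintro rfl; simp at h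
  exact ⟨_, hlog_orderTop_pos (smallPart_orderTop_pos hF), support_hlog_smallPart hF hd,
    eq_expForm hF⟩

theorem support_expForm_depth {θ : Series} (hθ : 0 < θ.orderTop) {k : ℕ}
    (hd : θ.support ⊆ depthLe k) {e : Expo} (he : e ∈ depthLe k) (c : ℝ) :
    (expForm e c θ).support ⊆ depthLe k :=
  support_mul_depth (support_single_subset' he) (support_hexp_subset hθ hd)

theorem support_inv_depth {F : Series} {k : ℕ} (hd : F.support ⊆ depthLe k) :
    (F⁻¹).support ⊆ depthLe k := by
  by_cases hF : F = 0
  · rw [hF, inv_zero]; simp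
  have hl : F.leadingCoeff ≠ 0 := by simpa using hF
  rw [eq_expForm hF, expForm_inv (hlog_orderTop_pos (smallPart_orderTop_pos hF)) _ hl]
  exact support_expForm_depth
    (neg_orderTop_pos (hlog_orderTop_pos (smallPart_orderTop_pos hF)))
    (support_neg_subset' (support_hlog_smallPart hF hd))
    (neg_mem_depthLe (hd (HahnSeries.coeff_order_eq_zero.not.2 hF))) _

theorem comp_inv {X F : Series} (hX : IsLeading 0 X) (hF : F.support ⊆ depthLe 2)
    (h0 : F ≠ 0) : comp X F⁻¹ = (comp X F)⁻¹ := by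
  refine (inv_eq_of_mul_eq_one_right ?_).symm
  rw [← comp_mul hX hF (support_inv_depth hF), mul_inv_cancel₀ h0, comp_one hX]

/-- One and the same `η` appears in the composed series and in every scaled monomial; `comp_fpow`
depends on this. -/
theorem comp_expForm {X θ : Series} (hX : IsLeading 0 X) (hθ : 0 < θ.orderTop)
    (hd : θ.support ⊆ depthLe 2) {e : Expo} (he : e ∈ depthLe 2) (c : ℝ) :
    ∃ η : Series, 0 < η.orderTop ∧
      comp X (expForm e c θ) = expForm (compOrder X e) (c * compCoeff X e) (η + comp X θ) ∧
      ∀ r : ℝ, monomialComp (Expo.scale r e) X =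
        expForm (Expo.scale r (compOrder X e)) (compCoeff X e ^ r) (r • η) := by
  obtain ⟨θ₀, θ₁, θ₂, h₀, h₁, h₂, -, -, h⟩ := exists_compLogs hX
  have hη := add_orderTop_pos (add_orderTop_pos (smul_orderTop_pos h₀ (e.at 0))
    (smul_orderTop_pos h₁ (e.at 1))) (smul_orderTop_pos h₂ (e.at 2))
  refine ⟨e.at 0 • θ₀ + e.at 1 • θ₁ + e.at 2 • θ₂, hη, ?_, ?_⟩
  · rw [expForm, comp_mul hX (support_single_subset' he) (support_hexp_subset hθ hd),
      comp_single hX he, comp_hexp hX hd hθ, h e he]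
    have : c • expForm (compOrder X e) (compCoeff X e) (e.at 0 • θ₀ + e.at 1 • θ₁ + e.at 2 • θ₂)
        = expForm (compOrder X e) (c * compCoeff X e)
          (e.at 0 • θ₀ + e.at 1 • θ₁ + e.at 2 • θ₂) := by
      rw [expForm, expForm, smul_eq_C_mul', ← mul_assoc]
      congr 1
      rw [HahnSeries.C_apply, HahnSeries.single_mul_single, zero_add]
    rw [this, expForm, expForm, hexp_add hη (comp_orderTop_pos hX hd hθ), mul_assoc]
  · intro r
    rw [h _ (scale_mem_depthLe r he), compOrder_scale]
    congr 1
    · simp only [compCoeff, Expo.at_scale]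
      rw [Real.mul_rpow (Real.rpow_nonneg hX.pos.le _)
        (Real.rpow_nonneg (inv_pos.2 hX.at_pos).le _), ← Real.rpow_mul hX.pos.le,
        ← Real.rpow_mul (inv_pos.2 hX.at_pos).le, mul_comm r, mul_comm r]
    · simp only [Expo.at_scale, smul_add', smul_smul']

theorem comp_fpow {X F : Series} (hX : IsLeading 0 X) (hF : F.support ⊆ depthLe 2)
    (hl : 0 < F.leadingCoeff) (r : ℝ) : comp X (fpow F r) = fpow (comp X F) r := by
  obtain ⟨θ, hθ, hd, h⟩ := exists_expForm_depth hl hF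
  have he : F.order ∈ depthLe 2 :=
    hF (HahnSeries.coeff_order_eq_zero.not.2 (by rintro rfl; simp at hl))
  obtain ⟨η, hη, h1, h2⟩ := comp_expForm hX hθ hd he F.leadingCoeff
  have hc := compCoeff_pos hX F.order
  have hθX := comp_orderTop_pos hX hd hθ
  rw [h, fpow_expForm hθ _ hl, h1, fpow_expForm (add_orderTop_pos hη hθX) _ (mul_pos hl hc),
    expForm, comp_mul hX (support_single_subset' (scale_mem_depthLe r he))
      (support_hexp_subset (smul_orderTop_pos hθ r) (support_smul_subset' r hd)),
    comp_single hX (scale_mem_depthLe r he), comp_hexp hX (support_smul_subset' r hd)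
      (smul_orderTop_pos hθ r), h2, comp_smul hX hd, smul_add', expForm, expForm,
    hexp_add (smul_orderTop_pos hη r) (smul_orderTop_pos hθX r), Real.mul_rpow hl.le hc.le,
    smul_eq_C_mul', ← mul_assoc, ← mul_assoc, HahnSeries.C_apply, HahnSeries.single_mul_single,
    zero_add]

theorem comp_isLeading {X F : Series} (hX : IsLeading 0 X) (hF : F.support ⊆ depthLe 2)
    (h : IsLeading 0 F) : IsLeading 0 (comp X F) := by
  obtain ⟨θ, hθ, hd, hF'⟩ := exists_expForm_depth h.pos hF
  have he : F.order ∈ depthLe 2 := hF (HahnSeries.coeff_order_eq_zero.not.2 h.ne_zero)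
  obtain ⟨η, hη, h1, -⟩ := comp_expForm hX hθ hd he F.leadingCoeff
  have hθX := comp_orderTop_pos hX hd hθ
  have hc := mul_pos h.pos (compCoeff_pos hX F.order)
  rw [← hF'] at h1
  refine ⟨?_, by simp, ?_⟩
  · rw [h1, expForm_leadingCoeff (add_orderTop_pos hη hθX) _ hc.ne']; exact hc
  · rw [h1, expForm_order (add_orderTop_pos hη hθX) _ hc.ne']
    have : (compOrder X F.order).at 0 = F.order.at 0 * X.order.at 0 := by
      simp [compOrder, Expo.at_add, Expo.at_scale, Expo.at_delta]
    rw [this]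
    exact mul_pos h.at_pos hX.at_pos

theorem single_eq_ellPow (j : ℕ) (r : ℝ) :
    ellPow j r = HahnSeries.single (Expo.scale r (Expo.delta j)) 1 := by
  rw [ellPow]
  congr 2
  refine Expo.ext' fun i => ?_
  rw [Expo.at_single, Expo.at_scale, Expo.at_delta]
  split_ifs <;> simp

theorem comp_ellPow_one {X : Series} (hX : IsLeading 0 X) : comp X (ellPow 1 (-1)) = -flog X := by
  have hd : Expo.scale (-1) (Expo.delta 1) ∈ depthLe 2 :=
    scale_mem_depthLe _ (delta_mem_depthLe (by norm_num))
  rw [single_eq_ellPow, comp_single hX hd, one_smul', monomialComp_eq hX hd]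
  simp only [Expo.at_scale, Expo.at_delta]
  norm_num
  rw [fpow_zero hX.pos, fpow_zero hX.fell.fell.pos, fpow_neg_one hX.fell.pos, fell, inv_inv]
  ring

theorem comp_ellPow_two {X : Series} (hX : IsLeading 0 X) :
    comp X (ellPow 2 (-1)) = -flog (fell X) := by
  have hd : Expo.scale (-1) (Expo.delta 2) ∈ depthLe 2 :=
    scale_mem_depthLe _ (delta_mem_depthLe (by norm_num))
  rw [single_eq_ellPow, comp_single hX hd, one_smul', monomialComp_eq hX hd]
  simp only [Expo.at_scale, Expo.at_delta]
  norm_num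
  rw [fpow_zero hX.pos, fpow_zero hX.fell.pos, fpow_neg_one hX.fell.fell.pos]
  conv_lhs => rw [fell, inv_inv]
  ring

theorem flog_mul {F G : Series} (hF : 0 < F.leadingCoeff) (hG : 0 < G.leadingCoeff) :
    flog (F * G) = flog F + flog G := by
  obtain ⟨θ, hθ, h⟩ := exists_expForm hF
  obtain ⟨η, hη, h'⟩ := exists_expForm hG
  rw [h, h', expForm_mul hθ hη, flog_expForm hθ _ hF, flog_expForm hη _ hG,
    flog_expForm (add_orderTop_pos hθ hη) _ (mul_pos hF hG), Real.log_mul hF.ne' hG.ne',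
    logPart_add, map_add]
  ring

theorem flog_fpow {F : Series} (hF : 0 < F.leadingCoeff) (r : ℝ) :
    flog (fpow F r) = r • flog F := by
  obtain ⟨θ, hθ, h⟩ := exists_expForm hF
  rw [h, fpow_expForm hθ _ hF, flog_expForm hθ _ hF,
    flog_expForm (smul_orderTop_pos hθ r) _ (Real.rpow_pos_of_pos hF r), Real.log_rpow hF,
    logPart_scale]
  simp only [smul_eq_C_mul', map_mul]
  ring

theorem fpow_leadingCoeff_pos {F : Series} (hF : 0 < F.leadingCoeff) (r : ℝ) :
    0 < (fpow F r).leadingCoeff := by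
  obtain ⟨θ, hθ, h⟩ := exists_expForm hF
  have hc := Real.rpow_pos_of_pos hF r
  rw [h, fpow_expForm hθ _ hF, expForm_leadingCoeff (smul_orderTop_pos hθ r) _ hc.ne']
  exact hc

/-- Taking logarithms raises the depth of the leading monomial by one, so its order is restricted to
depth one in order that only ℓ⁻¹ and ℓ₂⁻¹ arise and `comp` still applies. -/
theorem comp_flog {X F : Series} (hX : IsLeading 0 X) (hF : F.support ⊆ depthLe 2)
    (hl : 0 < F.leadingCoeff) (ho : F.order ∈ depthLe 1) :
    comp X (flog F) = flog (comp X F) ∧ (flog F).support ⊆ depthLe 2 := by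
  obtain ⟨θ, hθ, hd, h⟩ := exists_expForm_depth hl hF
  have he : F.order ∈ depthLe 2 := depthLe_mono (by norm_num) ho
  have hθX := comp_orderTop_pos hX hd hθ
  have hord : F.order = toLex (Finsupp.single 0 (F.order.at 0)) +
      toLex (Finsupp.single 1 (F.order.at 1)) := by
    refine Expo.ext' fun i => ?_
    rw [Expo.at_add, Expo.at_single, Expo.at_single]
    match i with
    | 0 => simp
    | 1 => simp
    | i + 2 => rw [ho (i + 2) (by omega)]; simp
  have hlp : logPart F.order =
      F.order.at 0 • ellPow 1 (-1) + F.order.at 1 • ellPow 2 (-1) := by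
    conv_lhs => rw [hord]
    rw [logPart_add, logPart_single, logPart_single]
  have he1 : (ellPow 1 (-1)).support ⊆ depthLe 2 := by
    rw [single_eq_ellPow]
    exact support_single_subset' (scale_mem_depthLe _ (delta_mem_depthLe (by norm_num)))
  have he2 : (ellPow 2 (-1)).support ⊆ depthLe 2 := by
    rw [single_eq_ellPow]
    exact support_single_subset' (scale_mem_depthLe _ (delta_mem_depthLe (by norm_num)))
  have hC : (HahnSeries.C (Real.log F.leadingCoeff) : Series).support ⊆ depthLe 2 :=
    support_single_subset' (depthLe 2).zero_mem
  have hflog : flog F = HahnSeries.C (Real.log F.leadingCoeff) +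
      ((-F.order.at 0) • ellPow 1 (-1) + (-F.order.at 1) • ellPow 2 (-1)) + θ := by
    conv_lhs => rw [h]
    rw [flog_expForm hθ _ hl, hlp]
    simp only [smul_eq_C_mul', map_neg]
    ring
  have hs1 := support_smul_subset' (-F.order.at 0) he1
  have hs2 := support_smul_subset' (-F.order.at 1) he2
  have hs12 := support_add_subset' hs1 hs2
  refine ⟨?_, by rw [hflog]; exact support_add_subset' (support_add_subset' hC hs12) hd⟩
  -- F∘X factors into a constant, powers of X and of ℓ∘X, and an exponential, on which the logarithm
  -- is additive.
  have hcompF : comp X F = (HahnSeries.C F.leadingCoeff * (fpow X (F.order.at 0) *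
      fpow (fell X) (F.order.at 1))) * hexp (comp X θ) := by
    conv_lhs => rw [h]
    rw [expForm, comp_mul hX (support_single_subset' he) (support_hexp_subset hθ hd),
      comp_single hX he, comp_hexp hX hd hθ, monomialComp_eq hX he, ho 2 (by norm_num),
      fpow_zero hX.fell.fell.pos, mul_one, smul_eq_C_mul']
  have hexp1 : hexp (comp X θ) = expForm 0 1 (comp X θ) := by
    rw [expForm]; change _ = 1 * _; rw [one_mul]
  have hC1 : (HahnSeries.C F.leadingCoeff : Series) = expForm 0 F.leadingCoeff 0 := by
    rw [expForm, hexp_zero, mul_one]; rfl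
  have hz : 0 < (0 : Series).orderTop := by simp
  have hCpos : 0 < (HahnSeries.C F.leadingCoeff : Series).leadingCoeff := by
    rw [hC1, expForm_leadingCoeff hz _ hl.ne']; exact hl
  have hEpos : 0 < (hexp (comp X θ)).leadingCoeff := by
    rw [hexp1, expForm_leadingCoeff hθX _ one_ne_zero]; exact one_pos
  have p0 := fpow_leadingCoeff_pos hX.pos (F.order.at 0)
  have p1 := fpow_leadingCoeff_pos hX.fell.pos (F.order.at 1)
  have p01 : 0 < (fpow X (F.order.at 0) * fpow (fell X) (F.order.at 1)).leadingCoeff := by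
    rw [HahnSeries.leadingCoeff_mul]; exact mul_pos p0 p1
  have l0 : logPart 0 = 0 := Finsupp.sum_zero_index
  rw [hcompF, flog_mul (by rw [HahnSeries.leadingCoeff_mul]; exact mul_pos hCpos p01) hEpos,
    flog_mul hCpos p01, flog_mul p0 p1, flog_fpow hX.pos, flog_fpow hX.fell.pos, hexp1, hC1,
    flog_expForm hθX _ one_pos, flog_expForm hz _ hl, hflog,
    comp_add hX (support_add_subset' hC hs12) hd, comp_add hX hC hs12, comp_add hX hs1 hs2,
    comp_smul hX he1, comp_smul hX he2, comp_ellPow_one hX, comp_ellPow_two hX]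
  have : comp X (HahnSeries.C (Real.log F.leadingCoeff)) =
      HahnSeries.C (Real.log F.leadingCoeff) := by
    rw [HahnSeries.C_apply, comp_single hX (depthLe 2).zero_mem, monomialComp_zero]
    rw [smul_eq_C_mul', mul_one]; rfl
  rw [this, l0, Real.log_one, map_zero]
  simp only [smul_eq_C_mul', map_neg]
  ring

theorem comp_fell {X F : Series} (hX : IsLeading 0 X) (hF : F.support ⊆ depthLe 2)
    (h : IsLeading 0 F) (ho : F.order ∈ depthLe 1) :
    comp X (fell F) = fell (comp X F) ∧ (fell F).support ⊆ depthLe 2 := by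
  obtain ⟨h1, h2⟩ := comp_flog hX hF h.pos ho
  have h3 := support_neg_subset' h2
  have hne : -flog F ≠ 0 := by
    intro h0
    have := h.neg_flog.2
    rw [h0] at this
    exact h.at_pos.ne (by simpa using this)
  refine ⟨?_, support_inv_depth h3⟩
  rw [fell, comp_inv hX h3 hne, fell, ← h1]
  congr 1
  have hneg : ∀ G : Series, -G = (-1 : ℝ) • G := fun G => by ext; simp
  rw [hneg, comp_smul hX h2, ← hneg]

theorem monomialComp_comp {X y : Series} (hX : IsLeading 0 X) (hy : y.support ⊆ depthLe 2)
    (hy0 : IsLeading 0 y) (ho : y.order ∈ depthLe 1) {e : Expo} (he : e ∈ depthLe 1) :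
    monomialComp e (comp X y) = comp X (monomialComp e y) ∧
      (monomialComp e y).support ⊆ depthLe 2 := by
  have he2 : e ∈ depthLe 2 := depthLe_mono (by norm_num) he
  obtain ⟨hf, hfd⟩ := comp_fell hX hy hy0 ho
  have key : ∀ {F : Series}, 0 < F.leadingCoeff → F.support ⊆ depthLe 2 → ∀ r : ℝ,
      (fpow F r).support ⊆ depthLe 2 := by
    intro F hl hF r
    obtain ⟨θ, hθ, hd, h⟩ := exists_expForm_depth hl hF
    rw [h, fpow_expForm hθ _ hl]
    exact support_expForm_depth (smul_orderTop_pos hθ r) (support_smul_subset' r hd)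
      (scale_mem_depthLe r
        (hF (HahnSeries.coeff_order_eq_zero.not.2 (by rintro rfl; simp at hl)))) _
  have hXy := comp_isLeading hX hy hy0
  rw [monomialComp_eq hXy he2, monomialComp_eq hy0 he2, he 2 (by norm_num),
    fpow_zero hXy.fell.fell.pos, fpow_zero hy0.fell.fell.pos, mul_one, mul_one,
    comp_mul hX (key hy0.pos hy _) (key hy0.fell.pos hfd _), comp_fpow hX hy hy0.pos,
    comp_fpow hX hfd hy0.fell.pos, hf]
  exact ⟨rfl, support_mul_depth (key hy0.pos hy _) (key hy0.fell.pos hfd _)⟩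

/-- Strong linearity reduces the claim to monomials, hence to compatibility with real powers and
with ℓ. The assumption on the order of `y` keeps ℓ₃ out of log y. -/
theorem comp_comp {X y F : Series} (hX : IsLeading 0 X) (hy : y.support ⊆ depthLe 2)
    (hy0 : IsLeading 0 y) (ho : y.order ∈ depthLe 1) (hF : F.support ⊆ depthLe 1) :
    comp (comp X y) F = comp X (comp y F) := by
  have hF2 : F.support ⊆ depthLe 2 := fun e he => depthLe_mono (by norm_num) (hF he)
  have hXy := comp_isLeading hX hy hy0
  ext g
  rw [comp_eq hy0 hF2, comp_hsum hX, coeff_comp hXy hF2]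
  · refine finsum_congr fun e => ?_
    change _ = (comp X (F.coeff e • monomialComp e y)).coeff g
    by_cases he : F.coeff e = 0
    · rw [he, zero_mul, zero_smul']
      have : comp X 0 = 0 := by
        have := comp_smul hX (F := 0) (by simp) 0
        rwa [zero_smul', zero_smul'] at this
      rw [this]; rfl
    · obtain ⟨h1, h2⟩ := monomialComp_comp hX hy hy0 ho (hF he)
      rw [comp_smul hX h2, h1]; rfl
  · intro e
    change (F.coeff e • monomialComp e y).support ⊆ _
    by_cases he : F.coeff e = 0
    · rw [he, zero_smul']; simp
    · exact support_smul_subset' _ (monomialComp_comp hX hy hy0 ho (hF he)).2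

end

noncomputable section

/-! ### Injectivity of the formal composition -/

theorem ioi_add_nonneg_mem (ρ : Expo) : ∀ a ∈ Ioi ρ, ∀ b ∈ nonnegExpo, a + b ∈ Ioi ρ :=
  fun _ ha _ hb => mem_Ioi.2 (lt_add_of_lt_of_nonneg (mem_Ioi.1 ha) (mem_nonnegExpo.1 hb))

theorem pos_add_ici_mem (ρ : Expo) : ∀ a ∈ Ioi (0 : Expo), ∀ b ∈ Ici ρ, a + b ∈ Ioi ρ :=
  fun _ ha _ hb => mem_Ioi.2 (lt_add_of_pos_of_le (mem_Ioi.1 ha) (mem_Ici.1 hb))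

open PowerSeries in
theorem support_hexp_sub_one_sub {z : Series} (hz : 0 < z.orderTop) {ρ : Expo}
    (hρ : z.support ⊆ Ici ρ) : (hexp z - 1 - z).support ⊆ Ioi ρ := by
  obtain ⟨k, hk⟩ : (X : PowerSeries ℝ) ^ 2 ∣ PowerSeries.exp ℝ - 1 - X := by
    rw [X_pow_dvd_iff]
    intro n hn
    interval_cases n
    · simp
    · simp [coeff_one_X, coeff_one]
  have : hexp z - 1 - z = z * (z * heval z k) := by
    have h := congrArg (heval z) hk
    rw [map_mul, map_pow, heval_X _ hz, map_sub, map_sub, map_one, heval_X _ hz] at h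
    rw [hexp, h]; ring
  rw [this]
  refine support_mul_subset' (orderTop_pos_iff.1 hz) (support_mul_subset' hρ
    (support_heval_subset hz k (support_subset_nonneg hz)) (ici_add_nonneg_mem ρ))
    (pos_add_ici_mem ρ)

theorem support_hexp_sub_one {z : Series} (hz : 0 < z.orderTop) {ρ : Expo}
    (hρ : z.support ⊆ Ici ρ) : (hexp z - 1).support ⊆ Ici ρ := by
  rw [hexp_sub_one]
  exact support_heval_subset_of_constantCoeff hz _ constantCoeff_exp_sub_one
    (ici_add_nonneg_mem ρ) (support_subset_nonneg hz) hρ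

/-- The leading term of F∘Y determines that of Y because the first exponent of F is nonzero. If Y ≠
Y', let ρ be the order of the difference `d` of their infinitesimal logarithms. The logarithms of
ℓ∘Y and ℓ∘Y' then agree beyond ρ as well as at ρ itself, up to terms strictly after it. So at the
leading exponent of F∘Y shifted by ρ, only the leading monomial of F contributes to the difference,
namely a nonzero multiple of the leading coefficient of `d`. -/
theorem comp_injective {F Y Y' : Series} (hY : IsLeading 0 Y) (hY' : IsLeading 0 Y')
    (hF : F.support ⊆ depthLe 1) (hF0 : F ≠ 0) (hα : F.order.at 0 ≠ 0)
    (h : comp Y F = comp Y' F) : Y = Y' := by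
  have hl : F.leadingCoeff ≠ 0 := by simpa using hF0
  have hF2 : F.support ⊆ depthLe 2 := fun e he => depthLe_mono (by norm_num) (hF he)
  have hoS : F.order ∈ F.support := HahnSeries.coeff_order_eq_zero.not.2 hF0
  have ho := hF2 hoS
  -- leading terms
  have hlead : ∀ X : Series, IsLeading 0 X → (comp X F).order = compOrder X F.order ∧
      (comp X F).leadingCoeff = F.leadingCoeff * compCoeff X F.order := by
    intro X hX
    have hθ := hlog_orderTop_pos (smallPart_orderTop_pos hF0)
    have hd := support_hlog_smallPart hF0 hF2
    obtain ⟨η, hη, h1, -⟩ := comp_expForm hX hθ hd ho F.leadingCoeff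
    rw [← eq_expForm hF0] at h1
    have hc : F.leadingCoeff * compCoeff X F.order ≠ 0 :=
      mul_ne_zero hl (compCoeff_pos hX _).ne'
    have hp := add_orderTop_pos hη (comp_orderTop_pos hX hd hθ)
    rw [h1]
    exact ⟨expForm_order hp _ hc, expForm_leadingCoeff hp _ hc⟩
  have e1 : compOrder Y F.order = compOrder Y' F.order := by
    rw [← (hlead Y hY).1, h, (hlead Y' hY').1]
  have e2 : compCoeff Y F.order = compCoeff Y' F.order := by
    have := (hlead Y hY).2
    rw [h, (hlead Y' hY').2] at this
    exact (mul_left_cancel₀ hl this).symm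
  have hord : Y.order = Y'.order := by
    refine Expo.ext' fun i => ?_
    have := congrArg (fun e => Expo.at e i) e1
    simp only [compOrder, Expo.at_add, Expo.at_scale] at this
    exact mul_left_cancel₀ hα (by linarith)
  have hlc : Y.leadingCoeff = Y'.leadingCoeff := by
    simp only [compCoeff, hord] at e2
    have h3 := mul_right_cancel₀ (Real.rpow_pos_of_pos (inv_pos.2 hY'.at_pos) _).ne' e2
    exact Real.rpow_left_injOn hα hY.pos.le hY'.pos.le h3
  obtain ⟨θ₀, θ₁, θ₂, h₀, h₁, -, hY₀, hY₁, hm⟩ := exists_compLogs hY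
  obtain ⟨η₀, η₁, η₂, k₀, k₁, -, hY₀', hY₁', hm'⟩ := exists_compLogs hY'
  by_contra hne
  have hd0 : η₀ - θ₀ ≠ 0 := by
    intro h0
    rw [sub_eq_zero] at h0
    rw [h0, ← hord, ← hlc, ← hY₀] at hY₀'
    exact hne hY₀'.symm
  set d := η₀ - θ₀ with hd
  have hdp : 0 < d.orderTop := sub_orderTop_pos k₀ h₀
  set ρ := d.order with hρ
  have hρ0 : 0 < ρ := (HahnSeries.zero_lt_orderTop_iff hd0).1 hdp
  have hdρ : d.support ⊆ Ici ρ := fun e he => mem_Ici.2 (HahnSeries.order_le_of_coeff_ne_zero he)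
  -- the second logarithm differs by less
  have ha := hY.at_pos
  set a := Y.order.at 0 with hadef
  have hT : -flog Y = expForm (-Expo.delta 1) a (-θ₁) := by
    have : -flog Y = (fell Y)⁻¹ := by rw [fell, inv_inv]
    rw [this, hY₁, expForm_inv h₁ _ (inv_pos.2 ha).ne', inv_inv]
  have hT' : -flog Y' = expForm (-Expo.delta 1) a (-η₁) := by
    have : -flog Y' = (fell Y')⁻¹ := by rw [fell, inv_inv]
    rw [this, hY₁', expForm_inv k₁ _ (inv_pos.2 hY'.at_pos).ne', inv_inv, hadef, hord]
  have hdiff : expForm (-Expo.delta 1) a (-η₁) = expForm (-Expo.delta 1) a (-θ₁) - d := by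
    rw [← hT, ← hT', hd]
    conv_lhs => rw [hY₀', neg_flog_expForm k₀ _ hY'.pos]
    conv_rhs => rw [hY₀, neg_flog_expForm h₀ _ hY.pos]
    rw [hord, hlc]; ring
  -- Dividing the relation between -log Y' and -log Y by -log Y gives exp(θ₁ - η₁) = 1 + ε. The
  -- factor ℓ produced by this division pushes ε strictly beyond ρ.
  set ε : Series := -(HahnSeries.single (Expo.delta 1) a⁻¹ * d * hexp θ₁) with hε
  have hsing : (HahnSeries.single (Expo.delta 1) a⁻¹ : Series) *
      HahnSeries.single (-Expo.delta 1) a = 1 := by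
    rw [HahnSeries.single_mul_single, add_neg_cancel, inv_mul_cancel₀ ha.ne']; rfl
  have hεeq : hexp (θ₁ - η₁) - 1 = ε := by
    rw [sub_eq_add_neg θ₁, hexp_add h₁ (neg_orderTop_pos k₁), hε]
    simp only [expForm] at hdiff
    have hx := hexp_mul_neg h₁
    linear_combination (HahnSeries.single (Expo.delta 1) a⁻¹ * hexp θ₁) * hdiff +
      hx - (hexp θ₁ * hexp (-η₁) - hexp θ₁ * hexp (-θ₁)) * hsing
  have hερ : ε.support ⊆ Ioi ρ := by
    rw [hε]
    refine support_neg_subset' (support_mul_subset' (support_mul_subset'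
      (support_single_subset' (mem_Ioi.2 (Expo.delta_pos 1))) hdρ (pos_add_ici_mem ρ))
      (support_hexp_subset h₁ (support_subset_nonneg h₁)) (ioi_add_nonneg_mem ρ))
  have hεp : 0 < ε.orderTop :=
    orderTop_pos_iff.2 fun e he => mem_Ioi.2 (hρ0.trans (mem_Ioi.1 (hερ he)))
  have hd1 : (η₁ - θ₁).support ⊆ Ioi ρ := by
    have : η₁ - θ₁ = -hlog ε := by
      rw [← hεeq, hlog_hexp (sub_orderTop_pos h₁ k₁)]; ring
    rw [this]
    exact support_neg_subset' (support_heval_subset_of_constantCoeff hεp _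
      constantCoeff_logSeries (ioi_add_nonneg_mem ρ) (support_subset_nonneg hεp) hερ)
  set d₁ := η₁ - θ₁ with hd₁
  have hd1p : 0 < d₁.orderTop := sub_orderTop_pos k₁ h₁
  have hz : ∀ e : Expo, 0 < (e.at 0 • d + e.at 1 • d₁).orderTop := fun e =>
    add_orderTop_pos (smul_orderTop_pos hdp _) (smul_orderTop_pos hd1p _)
  have hzρ : ∀ e : Expo, (e.at 0 • d + e.at 1 • d₁).support ⊆ Ici ρ := fun e =>
    support_add_subset' (support_smul_subset' _ hdρ)
      (support_smul_subset' _ (hd1.trans Ioi_subset_Ici_self))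
  have hη : ∀ e : Expo, 0 < (e.at 0 • θ₀ + e.at 1 • θ₁).orderTop := fun e =>
    add_orderTop_pos (smul_orderTop_pos h₀ _) (smul_orderTop_pos h₁ _)
  -- termwise difference
  have hterm : ∀ e ∈ F.support, monomialComp e Y' - monomialComp e Y =
      HahnSeries.single (compOrder Y e) (compCoeff Y e) *
        (hexp (e.at 0 • θ₀ + e.at 1 • θ₁) * (hexp (e.at 0 • d + e.at 1 • d₁) - 1)) := by
    intro e he
    have hC : compCoeff Y' e = compCoeff Y e := by simp only [compCoeff, hord, hlc]
    have hO : compOrder Y' e = compOrder Y e := by simp only [compOrder, hord]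
    have h2 : e.at 2 = 0 := hF he 2 (by norm_num)
    have hsum : e.at 0 • η₀ + e.at 1 • η₁ =
        (e.at 0 • θ₀ + e.at 1 • θ₁) + (e.at 0 • d + e.at 1 • d₁) := by
      rw [hd, hd₁]; simp only [smul_eq_C_mul']; ring
    rw [hm e (hF2 he), hm' e (hF2 he), h2, zero_smul', zero_smul', add_zero, add_zero, hC, hO,
      hsum, expForm, expForm, hexp_add (hη e) (hz e)]
    ring
  have hsupp : ∀ e ∈ F.support, (monomialComp e Y' - monomialComp e Y).support ⊆
      Ici (compOrder Y e + ρ) := by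
    intro e he
    rw [hterm e he]
    refine support_mul_subset' (support_single_subset' (mem_singleton _))
      (support_mul_subset' (support_hexp_subset (hη e) (support_subset_nonneg (hη e)))
        (support_hexp_sub_one (hz e) (hzρ e))
        (fun a ha b hb => by rw [add_comm]; exact ici_add_nonneg_mem ρ b hb a ha)) ?_
    intro a ha b hb
    rw [mem_singleton_iff.1 ha]
    exact mem_Ici.2 (by simpa using mem_Ici.1 hb)
  set γ := compOrder Y F.order + ρ with hγ
  have hzero : ∑ᶠ e, F.coeff e * (monomialComp e Y' - monomialComp e Y).coeff γ = 0 := by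
    have hs := congrArg (fun K : Series => K.coeff γ) h
    simp only [coeff_comp hY hF2, coeff_comp hY' hF2] at hs
    rw [← sub_eq_zero, ← finsum_sub_distrib (finite_comp hY hF2 γ) (finite_comp hY' hF2 γ)] at hs
    rw [← neg_eq_zero, ← hs, ← finsum_neg_distrib]
    exact finsum_congr fun e => by rw [HahnSeries.coeff_sub]; ring
  rw [finsum_eq_single _ F.order] at hzero
  · rw [hterm _ hoS, hγ, add_comm (compOrder Y F.order) ρ,
      HahnSeries.coeff_single_mul_add] at hzero
    set z := F.order.at 0 • d + F.order.at 1 • d₁ with hzdef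
    set η := F.order.at 0 • θ₀ + F.order.at 1 • θ₁ with hηdef
    have hcoef : (hexp η * (hexp z - 1)).coeff ρ = F.order.at 0 * d.coeff ρ := by
      have hsplit : hexp η * (hexp z - 1) =
          z + ((hexp z - 1 - z) + (hexp η - 1) * (hexp z - 1)) := by ring
      have hsm : ((hexp z - 1 - z) + (hexp η - 1) * (hexp z - 1)).coeff ρ = 0 := by
        by_contra hc
        have : ρ ∈ Ioi ρ := support_add_subset' (support_hexp_sub_one_sub (hz _) (hzρ _))
          (support_mul_subset' (orderTop_pos_iff.1 (hexp_sub_one_orderTop_pos (hη _)))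
            (support_hexp_sub_one (hz _) (hzρ _)) (pos_add_ici_mem ρ)) hc
        exact lt_irrefl _ (mem_Ioi.1 this)
      have hd1c : d₁.coeff ρ = 0 := by
        by_contra hc
        exact lt_irrefl _ (mem_Ioi.1 (hd1 hc))
      rw [hsplit, HahnSeries.coeff_add, hsm, add_zero, hzdef, HahnSeries.coeff_add,
        HahnSeries.coeff_smul, HahnSeries.coeff_smul, hd1c]
      simp
    rw [hcoef] at hzero
    refine (mul_ne_zero ?_ (mul_ne_zero (compCoeff_pos hY _).ne' (mul_ne_zero hα ?_))) hzero
    · exact hoS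
    · exact HahnSeries.coeff_order_eq_zero.not.2 hd0
  · intro e he
    by_cases heF : F.coeff e = 0
    · rw [heF, zero_mul]
    · have hlt : F.order < e :=
        lt_of_le_of_ne (HahnSeries.order_le_of_coeff_ne_zero heF) he.symm
      have hlt' := compOrder_strictMonoOn hY ho (hF2 heF) hlt
      rw [mul_eq_zero]
      right
      by_contra hc
      have := mem_Ici.1 (hsupp e heF hc)
      rw [hγ] at this
      exact absurd (le_of_add_le_add_right this) (not_le.2 hlt')

end

noncomputable section

/-! ### Summable families -/

/-- The family `s` is summable. -/
def HSummable {ι : Type*} (s : ι → Series) : Prop :=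
  (⋃ i, (s i).support).IsPWO ∧ ∀ g, {i | (s i).coeff g ≠ 0}.Finite

/-- The summable family with terms `s`. -/
def HSummable.family {ι : Type*} {s : ι → Series} (h : HSummable s) :
    HahnSeries.SummableFamily Expo ℝ ι := ⟨s, h.1, h.2⟩

open Classical in
/-- The formal sum of the family `s`, zero if the family is not summable. -/
def hsumOf {ι : Type*} (s : ι → Series) : Series := if h : HSummable s then h.family.hsum else 0

theorem coeff_hsumOf {ι : Type*} {s : ι → Series} (h : HSummable s) (g : Expo) :
    (hsumOf s).coeff g = ∑ᶠ i, (s i).coeff g := by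
  rw [hsumOf, dif_pos h, HahnSeries.SummableFamily.coeff_hsum]; rfl

theorem support_hsumOf_subset {ι : Type*} {s : ι → Series} {J : Set Expo}
    (h : ∀ i, (s i).support ⊆ J) : (hsumOf s).support ⊆ J := by
  rw [hsumOf]
  split_ifs with hs
  · exact (HahnSeries.SummableFamily.support_hsum_subset).trans (iUnion_subset h)
  · simp

theorem support_hsumOf_sub_subset {ι : Type*} {s t : ι → Series} (hs : HSummable s)
    (ht : HSummable t) {J : Set Expo} (h : ∀ i, (s i - t i).support ⊆ J) :
    (hsumOf s - hsumOf t).support ⊆ J := by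
  intro g hg
  by_contra hJ
  refine hg ?_
  rw [HahnSeries.coeff_sub, coeff_hsumOf hs, coeff_hsumOf ht, sub_eq_zero]
  refine finsum_congr fun i => ?_
  by_contra hne
  exact hJ (h i (sub_ne_zero.2 hne))

/-! ### The filtration generated by a set of exponents -/

/-- The sums of at least `n` elements of `P`. -/
def fil (P : Set Expo) (n : ℕ) : Set Expo :=
  {e | ∃ l : Multiset Expo, n ≤ l.card ∧ (∀ a ∈ l, a ∈ P) ∧ l.sum = e}

theorem mem_fil {P : Set Expo} {n : ℕ} {e : Expo} :
    e ∈ fil P n ↔ ∃ l : Multiset Expo, n ≤ l.card ∧ (∀ a ∈ l, a ∈ P) ∧ l.sum = e := Iff.rfl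

theorem fil_add {P : Set Expo} {i j : ℕ} {a b : Expo} (ha : a ∈ fil P i) (hb : b ∈ fil P j) :
    a + b ∈ fil P (i + j) := by
  obtain ⟨l, hl, hlP, rfl⟩ := mem_fil.1 ha
  obtain ⟨k, hk, hkP, rfl⟩ := mem_fil.1 hb
  refine mem_fil.2 ⟨l + k, ?_, ?_, Multiset.sum_add l k⟩
  · rw [Multiset.card_add]; omega
  · intro a ha
    rcases Multiset.mem_add.1 ha with h | h
    exacts [hlP a h, hkP a h]

theorem fil_anti {P : Set Expo} {i j : ℕ} (h : i ≤ j) : fil P j ⊆ fil P i := by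
  intro e he
  obtain ⟨l, hl, h'⟩ := mem_fil.1 he
  exact mem_fil.2 ⟨l, h.trans hl, h'⟩

theorem mem_fil_one {P : Set Expo} {a : Expo} (h : a ∈ P) : a ∈ fil P 1 :=
  mem_fil.2 ⟨{a}, by simp, by simpa using h, by simp⟩

/-- The submonoid generated by `P`. -/
def filZero (P : Set Expo) : AddSubmonoid Expo where
  carrier := fil P 0
  zero_mem' := mem_fil.2 ⟨0, by simp, by simp, by simp⟩
  add_mem' := fun ha hb => fil_add ha hb

theorem fil_subset_filZero (P : Set Expo) (n : ℕ) : fil P n ⊆ filZero P :=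
  fil_anti (Nat.zero_le n)

theorem filZero_le {P : Set Expo} {S : AddSubmonoid Expo} (h : P ⊆ S) :
    (filZero P : Set Expo) ⊆ S := by
  intro e he
  obtain ⟨l, -, hl, rfl⟩ := mem_fil.1 he
  exact AddSubmonoid.multiset_sum_mem S l fun a ha => h (hl a ha)

theorem fil_add_filZero {P : Set Expo} (n : ℕ) :
    ∀ a ∈ fil P n, ∀ b ∈ filZero P, a + b ∈ fil P n := fun _ ha _ hb => fil_add ha hb

theorem filZero_isPWO {P : Set Expo} (hP : P.IsPWO) (hpos : P ⊆ Ioi 0) :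
    (filZero P : Set Expo).IsPWO :=
  (hP.addSubmonoid_closure fun _ ha => (mem_Ioi.1 (hpos ha)).le).mono
    (filZero_le AddSubmonoid.subset_closure)

theorem fil_one_subset_pos {P : Set Expo} (hpos : P ⊆ Ioi 0) : fil P 1 ⊆ Ioi 0 := by
  intro e he
  obtain ⟨l, hl, hlP, rfl⟩ := mem_fil.1 he
  obtain ⟨a, ha⟩ := Multiset.card_pos_iff_exists_mem.1 hl
  obtain ⟨k, rfl⟩ := Multiset.exists_cons_of_mem ha
  rw [Multiset.sum_cons]
  refine mem_Ioi.2 (add_pos_of_pos_of_nonneg (mem_Ioi.1 (hpos (hlP a ha))) ?_)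
  exact Multiset.sum_nonneg fun b hb =>
    (mem_Ioi.1 (hpos (hlP b (Multiset.mem_cons_of_mem hb)))).le

/-- The filtration is separated. Let p be the indicator series of P; its powers have nonnegative
coefficients, and p^n is positive at every sum of n elements of P. As e occurs in only finitely many
powers of p, the lengths of its representations are bounded. -/
theorem exists_notMem_fil {P : Set Expo} (hP : P.IsPWO) (hpos : P ⊆ Ioi 0) (e : Expo) :
    ∃ n, e ∉ fil P n := by
  classical
  set p : Series := ⟨fun e => if e ∈ P then 1 else 0, hP.mono fun e he => by
    by_contra h; simp [h] at he⟩ with hp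
  have hp1 : ∀ a, p.coeff a = if a ∈ P then 1 else 0 := fun _ => rfl
  have hppos : 0 < p.orderTop := orderTop_pos_iff.2 fun a ha => hpos (by
    by_contra h; exact ha (by rw [hp1, if_neg h]))
  have hnn : ∀ n a, 0 ≤ (p ^ n).coeff a := by
    intro n
    induction n with
    | zero => intro a; rw [pow_zero, HahnSeries.coeff_one]; split_ifs <;> norm_num
    | succ n ih =>
      intro a
      rw [pow_succ, HahnSeries.coeff_mul]
      refine Finset.sum_nonneg fun q _ => mul_nonneg (ih _) ?_
      rw [hp1]; split_ifs <;> norm_num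
  have hkey : ∀ l : Multiset Expo, (∀ a ∈ l, a ∈ P) → 0 < (p ^ l.card).coeff l.sum := by
    intro l
    induction l using Multiset.induction_on with
    | empty => intro _; simp
    | cons a l ih =>
      intro h
      have hl := ih fun b hb => h b (Multiset.mem_cons_of_mem hb)
      have ha : p.coeff a = 1 := by rw [hp1, if_pos (h a (Multiset.mem_cons_self a l))]
      rw [Multiset.card_cons, Multiset.sum_cons, pow_succ, HahnSeries.coeff_mul]
      refine Finset.sum_pos' (fun q _ => mul_nonneg (hnn _ _) ?_) ⟨(l.sum, a), ?_, ?_⟩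
      · rw [hp1]; split_ifs <;> norm_num
      · refine Finset.mem_antidiagonal.2 ⟨hl.ne', ?_, add_comm _ _⟩
        rw [HahnSeries.mem_support, ha]; exact one_ne_zero
      · rw [ha, mul_one]; exact hl
  by_contra hall
  push Not at hall
  have hfin := finite_coeff_pow hppos e
  obtain ⟨N, hN⟩ := hfin.bddAbove
  obtain ⟨l, hl, hlP, rfl⟩ := mem_fil.1 (hall (N + 1))
  have := hN (show l.card ∈ {n | (p ^ n).coeff l.sum ≠ 0} from (hkey l hlP).ne')
  omega

/-- The contraction principle for the filtration: consecutive iterates agree up to level k after k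
steps, and since each exponent leaves the filtration at some level `n e`, each coefficient of the
iterates is eventually constant. The description of the limit by iterates is kept, because norm
bounds and comparisons are transferred through it. -/
theorem exists_fixedPoint {P : Set Expo} (hP : P.IsPWO) (hpos : P ⊆ Ioi 0)
    (N : Series → Series) (h1 : ∀ θ : Series, θ.support ⊆ fil P 1 → (N θ).support ⊆ fil P 1)
    (h2 : ∀ (θ θ' : Series) (n : ℕ), θ.support ⊆ fil P 1 → θ'.support ⊆ fil P 1 →
      (θ - θ').support ⊆ fil P n → (N θ - N θ').support ⊆ fil P (n + 1)) :
    ∃ θ : Series, θ.support ⊆ fil P 1 ∧ N θ = θ ∧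
      ∀ e, ∃ n, ∀ k ≥ n, θ.coeff e = (N^[k] 0).coeff e := by
  choose n hn using exists_notMem_fil hP hpos
  have hit : ∀ k, (N^[k] 0).support ⊆ fil P 1 := by
    intro k
    induction k with
    | zero => simp
    | succ k ih => rw [Function.iterate_succ_apply']; exact h1 _ ih
  have hstep : ∀ k, (N^[k + 1] 0 - N^[k] 0).support ⊆ fil P k := by
    intro k
    induction k with
    | zero => exact (support_sub_subset' (hit 1) (hit 0)).trans (fil_anti (by norm_num))
    | succ k ih =>
      rw [Function.iterate_succ_apply', Function.iterate_succ_apply']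
      rw [Function.iterate_succ_apply'] at ih
      have h3 := hit (k + 1)
      rw [Function.iterate_succ_apply'] at h3
      exact h2 _ _ _ h3 (hit k) ih
  have hdiff : ∀ k j, (N^[k + j] 0 - N^[k] 0).support ⊆ fil P k := by
    intro k j
    induction j with
    | zero => simp
    | succ j ih =>
      have : N^[k + (j + 1)] 0 - N^[k] 0 =
          (N^[k + j + 1] 0 - N^[k + j] 0) + (N^[k + j] 0 - N^[k] 0) := by
        rw [← add_assoc]; ring
      rw [this]
      exact support_add_subset' ((hstep _).trans (fil_anti (by omega))) ih
  have hstab : ∀ e k, n e ≤ k → (N^[k] 0).coeff e = (N^[n e] 0).coeff e := by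
    intro e k hk
    obtain ⟨j, rfl⟩ := Nat.exists_eq_add_of_le hk
    by_contra hne
    exact hn e (hdiff (n e) j (sub_ne_zero.2 hne))
  have hsub : Function.support (fun e => (N^[n e] 0).coeff e) ⊆ fil P 1 :=
    fun e he => hit (n e) he
  set θ : Series := ⟨fun e => (N^[n e] 0).coeff e,
    (filZero_isPWO hP hpos).mono (hsub.trans (fil_subset_filZero P 1))⟩ with hθ
  have hc : ∀ e, θ.coeff e = (N^[n e] 0).coeff e := fun _ => rfl
  have hθ1 : θ.support ⊆ fil P 1 := hsub
  have hlim : ∀ k, (θ - N^[k] 0).support ⊆ fil P k := by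
    intro k e he
    by_contra hne
    have hk : (N^[n e] 0).coeff e ≠ (N^[k] 0).coeff e := by
      intro h; exact he (by rw [HahnSeries.coeff_sub, hc, h, sub_self])
    rcases le_total (n e) k with h | h
    · exact hk (hstab e k h).symm
    · obtain ⟨j, hj⟩ := Nat.exists_eq_add_of_le h
      refine hne (hdiff k j ?_)
      rw [← hj]
      exact sub_ne_zero.2 hk
  refine ⟨θ, hθ1, ?_, fun e => ⟨n e, fun k hk => by rw [hc, hstab e k hk]⟩⟩
  rw [← sub_eq_zero]
  ext e
  by_contra hne
  refine hn e ?_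
  have h3 : N θ - θ = (N θ - N (N^[n e] 0)) - (θ - N^[n e + 1] 0) := by
    rw [Function.iterate_succ_apply']; ring
  have h4 : (N θ - θ).support ⊆ fil P (n e + 1) := by
    rw [h3]
    exact support_sub_subset' (h2 _ _ _ hθ1 (hit _) (hlim _)) (hlim _)
  exact fil_anti (by omega) (h4 hne)

/-! ### The equation of the formal inverse -/

theorem expo₂_at_zero (a b : ℝ) : (expo₂ a b).at 0 = a := by
  simp [expo₂, Expo.at]

theorem expo₂_at_one (a b : ℝ) : (expo₂ a b).at 1 = b := by
  simp [expo₂, Expo.at]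

theorem expo₂_mem_depthLe (a b : ℝ) : expo₂ a b ∈ depthLe 1 := by
  intro i hi
  have h0 : (0 : ℕ) ≠ i := by omega
  have h1 : (1 : ℕ) ≠ i := by omega
  simp [expo₂, Expo.at, h0, h1]

theorem depthLe_one_ext {e e' : Expo} (he : e ∈ depthLe 1) (he' : e' ∈ depthLe 1)
    (h0 : e.at 0 = e'.at 0) (h1 : e.at 1 = e'.at 1) : e = e' :=
  depthLe_two_ext (depthLe_mono (by norm_num) he) (depthLe_mono (by norm_num) he') h0 h1
    (by rw [he 2 (by norm_num), he' 2 (by norm_num)])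

/-- The exponent of `ℓ / ℓ₂`. -/
def vExp : Expo := Expo.delta 1 - Expo.delta 2

/-- The exponent of the term of the equation coming from the monomial of exponent `e`. -/
def zExp (α m : ℝ) (e : Expo) : Expo := expo₂ (e.at 0 / α - 1) (m * e.at 0 / α + e.at 1)

theorem zExp_strictMonoOn {α : ℝ} (hα : 0 < α) (m : ℝ) :
    StrictMonoOn (zExp α m) (depthLe 1) := by
  intro e he e' he' h
  rcases depthLe_two_lt (depthLe_mono (by norm_num) he) (depthLe_mono (by norm_num) he') h with
    h0 | ⟨h0, h1⟩ | ⟨-, -, h2⟩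
  · refine Expo.lt_of_at 0 (by simp) ?_
    rw [zExp, zExp, expo₂_at_zero, expo₂_at_zero]
    have := div_lt_div_of_pos_right h0 hα
    linarith
  · refine Expo.lt_of_at 1 (fun i hi => ?_) ?_
    · have : i = 0 := by omega
      subst this
      rw [zExp, zExp, expo₂_at_zero, expo₂_at_zero, h0]
    · rw [zExp, zExp, expo₂_at_one, expo₂_at_one, h0]
      linarith
  · rw [he 2 (by norm_num), he' 2 (by norm_num)] at h2
    exact absurd h2 (lt_irrefl _)

/-- The series `W` with `-log y = (1 + W) / (α ℓ)` for `y = c x^{1/α} ℓ^{m/α} exp θ`. -/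
def invW (α m c : ℝ) (θ : Series) : Series :=
  m • HahnSeries.single vExp (1 : ℝ) -
    α • (HahnSeries.single (Expo.delta 1) (1 : ℝ) * (HahnSeries.C (Real.log c) + θ))

/-- The terms of the equation. -/
def invTerm (α m c : ℝ) (G θ : Series) (e : Expo) : Series :=
  (G.coeff e * (c ^ e.at 0 * α ^ e.at 1)) •
    (HahnSeries.single (zExp α m e) (1 : ℝ) * hexp (e.at 0 • θ - e.at 1 • hlog (invW α m c θ)))

/-- The sum of the terms of the equation. -/
def invSum (α m c : ℝ) (G θ : Series) : Series := hsumOf (invTerm α m c G θ)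

/-- The operator whose fixed point gives the formal inverse. -/
def invOp (α m c : ℝ) (G θ : Series) : Series :=
  α⁻¹ • (hlog (-invSum α m c G θ) - m • hlog (invW α m c θ))

/-- The set `P` of positive exponents contains all those occurring in the equation. -/
structure IsGenerating (α m : ℝ) (G : Series) (P : Set Expo) : Prop where
  pwo : P.IsPWO
  pos : P ⊆ Ioi 0
  v_mem : vExp ∈ P
  w_mem : Expo.delta 1 ∈ P
  depth : G.support ⊆ depthLe 1
  z_mem : ∀ e ∈ G.support, zExp α m e ∈ P

/-! ### Support estimates for the operator and existence of its fixed point -/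

section Equation

variable {α m : ℝ} {G G' : Series} {P : Set Expo} {θ θ' : Series}

theorem orderTop_pos_of_fil (hP : P ⊆ Ioi 0) (hθ : θ.support ⊆ fil P 1) : 0 < θ.orderTop :=
  orderTop_pos_iff.2 (hθ.trans (fil_one_subset_pos hP))

theorem support_invW (hP : IsGenerating α m G P) (c : ℝ) (hθ : θ.support ⊆ fil P 1) :
    (invW α m c θ).support ⊆ fil P 1 := by
  refine support_sub_subset' (support_smul_subset' _ (support_single_subset'
    (mem_fil_one hP.v_mem))) (support_smul_subset' _ (support_mul_subset'
      (support_single_subset' (mem_fil_one hP.w_mem)) (J := filZero P)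
      (support_add_subset' (support_single_subset' (filZero P).zero_mem)
        (hθ.trans (fil_subset_filZero P 1))) (fil_add_filZero 1)))

theorem support_hlog_fil (hP : P ⊆ Ioi 0) (hθ : θ.support ⊆ fil P 1) :
    (hlog θ).support ⊆ fil P 1 :=
  support_heval_subset_of_constantCoeff (orderTop_pos_of_fil hP hθ) _ constantCoeff_logSeries
    (fil_add_filZero 1) (hθ.trans (fil_subset_filZero P 1)) hθ

theorem support_invExponent (hP : IsGenerating α m G P) (c : ℝ) (hθ : θ.support ⊆ fil P 1)
    (e : Expo) : (e.at 0 • θ - e.at 1 • hlog (invW α m c θ)).support ⊆ fil P 1 :=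
  support_sub_subset' (support_smul_subset' _ hθ)
    (support_smul_subset' _ (support_hlog_fil hP.pos (support_invW hP c hθ)))

theorem support_hexp_fil (hP : P ⊆ Ioi 0) (hθ : θ.support ⊆ fil P 1) :
    (hexp θ).support ⊆ filZero P :=
  support_hexp_subset (orderTop_pos_of_fil hP hθ) (hθ.trans (fil_subset_filZero P 1))

theorem support_invTerm (hP : IsGenerating α m G P) (c : ℝ) (hθ : θ.support ⊆ fil P 1)
    (e : Expo) : (invTerm α m c G θ e).support ⊆ fil P 1 := by
  by_cases he : G.coeff e = 0
  · rw [invTerm, he, zero_mul, zero_smul']; simp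
  · exact support_smul_subset' _ (support_mul_subset'
      (support_single_subset' (mem_fil_one (hP.z_mem e he)))
      (support_hexp_fil hP.pos (support_invExponent hP c hθ e)) (fil_add_filZero 1))

theorem hSummable_invTerm (hα : 0 < α) (hP : IsGenerating α m G P) (c : ℝ)
    (hθ : θ.support ⊆ fil P 1) : HSummable (invTerm α m c G θ) := by
  refine summable_of_shift G.isPWO_support (filZero_isPWO hP.pwo hP.pos)
    ((zExp_strictMonoOn hα m).mono hP.depth) ?_ ?_
  · intro e _ f hf
    obtain ⟨a, ha, b, hb, rfl⟩ := HahnSeries.support_mul_subset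
      (support_smul_subset' _ subset_rfl hf)
    rw [mem_singleton_iff.1 (HahnSeries.support_single_subset ha)]
    exact ⟨b, support_hexp_fil hP.pos (support_invExponent hP c hθ e) hb, rfl⟩
  · intro e he
    have : G.coeff e = 0 := by simpa using he
    rw [invTerm, this, zero_mul, zero_smul']

theorem support_invSum (hP : IsGenerating α m G P) (c : ℝ) (hθ : θ.support ⊆ fil P 1) :
    (invSum α m c G θ).support ⊆ fil P 1 :=
  support_hsumOf_subset fun e => support_invTerm hP c hθ e

theorem support_invOp (hP : IsGenerating α m G P) (c : ℝ) (hθ : θ.support ⊆ fil P 1) :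
    (invOp α m c G θ).support ⊆ fil P 1 :=
  support_smul_subset' _ (support_sub_subset'
    (support_hlog_fil hP.pos (support_neg_subset' (support_invSum hP c hθ)))
    (support_smul_subset' _ (support_hlog_fil hP.pos (support_invW hP c hθ))))

/-- Every occurrence of θ comes with a generator in P, which moves J into J'. With G = G' and J, J'
consecutive filtration levels this is the contraction property; with J = J' it compares the
operators of two different series. -/
theorem support_invOp_sub (hα : 0 < α) (hP : IsGenerating α m G P)
    (hP' : IsGenerating α m G' P) (c : ℝ) (hθ : θ.support ⊆ fil P 1)
    (hθ' : θ'.support ⊆ fil P 1) {J J' : Set Expo}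
    (hJ : ∀ a ∈ J, ∀ b ∈ filZero P, a + b ∈ J) (hJ' : ∀ a ∈ J', ∀ b ∈ filZero P, a + b ∈ J')
    (hJJ : J' ⊆ J) (hPJ : ∀ a ∈ P, ∀ b ∈ J, a + b ∈ J')
    (hG : ∀ e ∈ (G - G').support, zExp α m e ∈ J') (hd : (θ - θ').support ⊆ J) :
    (invOp α m c G θ - invOp α m c G' θ').support ⊆ J' := by
  have hW : (invW α m c θ - invW α m c θ').support ⊆ J' := by
    have : invW α m c θ - invW α m c θ' =
        (-α) • (HahnSeries.single (Expo.delta 1) (1 : ℝ) * (θ - θ')) := by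
      simp only [invW, smul_eq_C_mul', map_neg]; ring
    rw [this]
    exact support_smul_subset' _ (support_mul_subset'
      (support_single_subset' hP.w_mem) hd hPJ)
  have hlogd : ∀ {a b : Series}, a.support ⊆ fil P 1 → b.support ⊆ fil P 1 →
      (a - b).support ⊆ J' → (hlog a - hlog b).support ⊆ J' := fun {a b} ha hb hab =>
    support_heval_sub_subset (orderTop_pos_of_fil hP.pos ha) (orderTop_pos_of_fil hP.pos hb) _ hJ'
      (ha.trans (fil_subset_filZero P 1)) (hb.trans (fil_subset_filZero P 1)) hab
  have hlW := hlogd (support_invW hP c hθ) (support_invW hP c hθ') hW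
  have hterm : ∀ e, (invTerm α m c G θ e - invTerm α m c G' θ' e).support ⊆ J' := by
    intro e
    set A := HahnSeries.single (zExp α m e) (1 : ℝ) *
      hexp (e.at 0 • θ - e.at 1 • hlog (invW α m c θ)) with hA
    set A' := HahnSeries.single (zExp α m e) (1 : ℝ) *
      hexp (e.at 0 • θ' - e.at 1 • hlog (invW α m c θ')) with hA'
    have hsplit : invTerm α m c G θ e - invTerm α m c G' θ' e =
        (G.coeff e * (c ^ e.at 0 * α ^ e.at 1)) • (A - A') +
        ((G - G').coeff e * (c ^ e.at 0 * α ^ e.at 1)) • A' := by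
      rw [invTerm, invTerm, ← hA, ← hA', HahnSeries.coeff_sub]
      simp only [smul_eq_C_mul', map_mul, map_sub]; ring
    rw [hsplit]
    refine support_add_subset' ?_ ?_
    · by_cases he : G.coeff e = 0
      · rw [he, zero_mul, zero_smul']; simp
      · refine support_smul_subset' _ ?_
        rw [hA, hA', ← mul_sub]
        refine support_mul_subset' (support_single_subset' (hP.z_mem e he)) ?_ hPJ
        have i1 := support_invExponent hP c hθ e
        have i2 := support_invExponent hP c hθ' e
        refine support_heval_sub_subset (orderTop_pos_of_fil hP.pos i1)
          (orderTop_pos_of_fil hP.pos i2) _ hJ (i1.trans (fil_subset_filZero P 1))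
          (i2.trans (fil_subset_filZero P 1)) ?_
        have : e.at 0 • θ - e.at 1 • hlog (invW α m c θ) -
            (e.at 0 • θ' - e.at 1 • hlog (invW α m c θ')) =
            e.at 0 • (θ - θ') - e.at 1 • (hlog (invW α m c θ) - hlog (invW α m c θ')) := by
          simp only [smul_eq_C_mul']; ring
        rw [this]
        exact support_sub_subset' (support_smul_subset' _ hd)
          (support_smul_subset' _ (hlW.trans hJJ))
    · by_cases he : (G - G').coeff e = 0
      · rw [he, zero_mul, zero_smul']; simp
      · exact support_smul_subset' _ (support_mul_subset' (support_single_subset' (hG e he))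
          (support_hexp_fil hP.pos (support_invExponent hP c hθ' e)) hJ')
  have hS : (invSum α m c G θ - invSum α m c G' θ').support ⊆ J' :=
    support_hsumOf_sub_subset (hSummable_invTerm hα hP c hθ) (hSummable_invTerm hα hP' c hθ') hterm
  have hS' := hlogd (support_neg_subset' (support_invSum hP c hθ))
    (support_neg_subset' (support_invSum hP' c hθ')) (by
      have : -invSum α m c G θ - -invSum α m c G' θ' =
        -(invSum α m c G θ - invSum α m c G' θ') := by ring
      rw [this]; exact support_neg_subset' hS)
  have : invOp α m c G θ - invOp α m c G' θ' =
      α⁻¹ • ((hlog (-invSum α m c G θ) - hlog (-invSum α m c G' θ')) -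
        m • (hlog (invW α m c θ) - hlog (invW α m c θ'))) := by
    simp only [invOp, smul_eq_C_mul']; ring
  rw [this]
  exact support_smul_subset' _ (support_sub_subset' hS' (support_smul_subset' _ hlW))

theorem exists_invOp_fixedPoint (hα : 0 < α) (hP : IsGenerating α m G P) (c : ℝ) :
    ∃ θ : Series, θ.support ⊆ fil P 1 ∧ invOp α m c G θ = θ ∧
      ∀ e, ∃ n, ∀ k ≥ n, θ.coeff e = ((invOp α m c G)^[k] 0).coeff e := by
  refine exists_fixedPoint hP.pwo hP.pos _ (fun θ hθ => support_invOp hP c hθ) ?_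
  intro θ θ' n hθ hθ' hd
  refine support_invOp_sub hα hP hP c hθ hθ' (fil_add_filZero n) (fil_add_filZero (n + 1))
    (fil_anti (by omega)) (fun a ha b hb => ?_) (by simp) hd
  rw [add_comm n 1]
  exact fil_add (mem_fil_one ha) hb

theorem support_invOp_iterate (hP : IsGenerating α m G P) (c : ℝ) (k : ℕ) :
    ((invOp α m c G)^[k] 0).support ⊆ fil P 1 := by
  induction k with
  | zero => simp
  | succ k ih => rw [Function.iterate_succ_apply']; exact support_invOp hP c ih

/-- Taking for J the exponents with a large power of x shows that dropping far terms of G changes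
the iterates only far out. -/
theorem support_invOp_iterate_sub (hα : 0 < α) (hP : IsGenerating α m G P)
    (hP' : IsGenerating α m G' P) (c : ℝ) {J : Set Expo}
    (hJ : ∀ a ∈ J, ∀ b ∈ filZero P, a + b ∈ J) (hG : ∀ e ∈ (G - G').support, zExp α m e ∈ J)
    (k : ℕ) : ((invOp α m c G)^[k] 0 - (invOp α m c G')^[k] 0).support ⊆ J := by
  induction k with
  | zero => simp
  | succ k ih =>
    rw [Function.iterate_succ_apply', Function.iterate_succ_apply']
    exact support_invOp_sub hα hP hP' c (support_invOp_iterate hP c k)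
      (support_invOp_iterate hP' c k) hJ hJ subset_rfl
      (fun a ha b hb => by
        rw [add_comm]; exact hJ b hb a (fil_subset_filZero P 1 (mem_fil_one ha))) hG ih

end Equation

end

noncomputable section

/-! ### The formal inverse -/

theorem expo₂_eq (a b : ℝ) :
    expo₂ a b = Expo.scale a (Expo.delta 0) + Expo.scale b (Expo.delta 1) := by
  refine Expo.ext' fun i => ?_
  rw [Expo.at_add, Expo.at_scale, Expo.at_scale, Expo.at_delta, Expo.at_delta]
  simp only [expo₂, Expo.at, ofLex_toLex, Finsupp.add_apply, Finsupp.single_apply]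
  split_ifs <;> simp

theorem logPart_delta (j : ℕ) :
    logPart (Expo.delta j) = HahnSeries.single (-Expo.delta (j + 1)) (1 : ℝ) := by
  rw [Expo.delta, logPart_single, one_smul', single_eq_ellPow, Expo.neg_one_scale]

theorem logPart_expo₂ (a b : ℝ) : logPart (expo₂ a b) =
    a • HahnSeries.single (-Expo.delta 1) (1 : ℝ) + b • HahnSeries.single (-Expo.delta 2) (1 : ℝ) := by
  rw [expo₂_eq, logPart_add, logPart_scale, logPart_scale, logPart_delta, logPart_delta]

/-- The series `c x^{1/α} ℓ^{m/α} exp θ`. -/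
def invSeries (α m c : ℝ) (θ : Series) : Series := expForm (expo₂ (1 / α) (m / α)) c θ

section Inverse

variable {α m c a : ℝ} {G : Series} {P : Set Expo} {θ : Series}

theorem isLeading_invSeries (hα : 0 < α) (hc : 0 < c) (hθ : 0 < θ.orderTop) :
    IsLeading 0 (invSeries α m c θ) := by
  refine ⟨?_, by simp, ?_⟩
  · rw [invSeries, expForm_leadingCoeff hθ _ hc.ne']; exact hc
  · rw [invSeries, expForm_order hθ _ hc.ne', expo₂_at_zero]; positivity

theorem neg_flog_invSeries (hα : 0 < α) (hc : 0 < c) (hθ : 0 < θ.orderTop)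
    (hW : 0 < (invW α m c θ).orderTop) :
    -flog (invSeries α m c θ) = expForm (-Expo.delta 1) α⁻¹ (hlog (invW α m c θ)) := by
  rw [invSeries, neg_flog_expForm hθ _ hc, logPart_expo₂, expForm, hexp_hlog hW, invW]
  have h1 : (HahnSeries.single (-Expo.delta 1) α⁻¹ : Series) =
      HahnSeries.C α⁻¹ * HahnSeries.single (-Expo.delta 1) (1 : ℝ) := by
    rw [HahnSeries.C_apply, HahnSeries.single_mul_single]; simp
  have h2 : (HahnSeries.single (-Expo.delta 1) (1 : ℝ) : Series) *
      HahnSeries.single (Expo.delta 1) (1 : ℝ) = 1 := by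
    rw [HahnSeries.single_mul_single]; simp
  have h3 : (HahnSeries.single (-Expo.delta 1) (1 : ℝ) : Series) *
      HahnSeries.single vExp (1 : ℝ) = HahnSeries.single (-Expo.delta 2) (1 : ℝ) := by
    rw [HahnSeries.single_mul_single, vExp, mul_one]
    congr 2
    abel
  have h4 : (HahnSeries.C α⁻¹ : Series) * HahnSeries.C α = 1 := by
    rw [← map_mul, inv_mul_cancel₀ hα.ne', map_one]
  simp only [smul_eq_C_mul', div_eq_mul_inv, map_mul, one_mul]
  rw [h1, mul_add, mul_sub, mul_one]
  linear_combination (HahnSeries.C m * HahnSeries.C α⁻¹) * (-h3) +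
    (HahnSeries.C (Real.log c) + θ) * h2 +
    HahnSeries.single (-Expo.delta 1) (1 : ℝ) * HahnSeries.single (Expo.delta 1) (1 : ℝ) *
      (HahnSeries.C (Real.log c) + θ) * h4

theorem fell_invSeries (hα : 0 < α) (hc : 0 < c) (hθ : 0 < θ.orderTop)
    (hW : 0 < (invW α m c θ).orderTop) :
    fell (invSeries α m c θ) = expForm (Expo.delta 1) α (-hlog (invW α m c θ)) := by
  rw [fell, neg_flog_invSeries hα hc hθ hW,
    expForm_inv (hlog_orderTop_pos hW) _ (inv_pos.2 hα).ne', neg_neg, inv_inv]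

theorem monomialComp_invSeries (hα : 0 < α) (hc : 0 < c) (hθ : 0 < θ.orderTop)
    (hW : 0 < (invW α m c θ).orderTop) {e : Expo} (he : e ∈ depthLe 1) :
    monomialComp e (invSeries α m c θ) = expForm (Expo.delta 0 + zExp α m e)
      (c ^ e.at 0 * α ^ e.at 1) (e.at 0 • θ - e.at 1 • hlog (invW α m c θ)) := by
  have hl := isLeading_invSeries (m := m) hα hc hθ
  have hω := hlog_orderTop_pos hW
  rw [monomialComp_eq hl (depthLe_mono (by norm_num) he), he 2 (by norm_num),
    fpow_zero hl.fell.fell.pos, mul_one, fell_invSeries hα hc hθ hW,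
    fpow_expForm (neg_orderTop_pos hω) _ hα, invSeries, fpow_expForm hθ _ hc,
    expForm_mul (smul_orderTop_pos hθ _) (smul_orderTop_pos (neg_orderTop_pos hω) _)]
  congr 1
  · rw [zExp, expo₂_eq, expo₂_eq]
    refine Expo.ext' fun i => ?_
    simp only [Expo.at_add, Expo.at_scale]
    field_simp
    ring
  · simp only [smul_eq_C_mul']; ring

theorem zExp_leading {α : ℝ} (hα : 0 < α) (m : ℝ) : zExp α m (expo₂ α (-m)) = 0 := by
  refine Expo.ext' fun i => ?_
  rw [zExp, expo₂_at_zero, expo₂_at_one, expo₂_eq]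
  simp only [Expo.at_add, Expo.at_scale, Expo.at_zero]
  field_simp
  ring

theorem idSeries_eq : idSeries = HahnSeries.single (Expo.delta 0) (1 : ℝ) := by
  rw [idSeries, single_eq_ellPow, Expo.one_scale]

theorem comp_invSeries_tail (hα : 0 < α) (hc : 0 < c) (hP : IsGenerating α m G P)
    (hθ : θ.support ⊆ fil P 1) :
    comp (invSeries α m c θ) G = idSeries * invSum α m c G θ := by
  have hθ0 := orderTop_pos_of_fil hP.pos hθ
  have hW0 := orderTop_pos_of_fil hP.pos (support_invW hP c hθ)
  have hG2 : G.support ⊆ depthLe 2 := fun e he => depthLe_mono (by norm_num) (hP.depth he)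
  ext g
  obtain ⟨g', rfl⟩ : ∃ g', g = g' + Expo.delta 0 := ⟨g - Expo.delta 0, by abel⟩
  rw [coeff_comp (isLeading_invSeries hα hc hθ0) hG2, idSeries_eq,
    HahnSeries.coeff_single_mul_add, one_mul, invSum,
    coeff_hsumOf (hSummable_invTerm hα hP c hθ)]
  refine finsum_congr fun e => ?_
  by_cases he : G.coeff e = 0
  · rw [he, zero_mul, invTerm, he, zero_mul, zero_smul']; rfl
  · rw [monomialComp_invSeries hα hc hθ0 hW0 (hP.depth he), invTerm, expForm,
      HahnSeries.coeff_smul]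
    have : (HahnSeries.single (Expo.delta 0 + zExp α m e) (c ^ e.at 0 * α ^ e.at 1) : Series) =
        HahnSeries.single (Expo.delta 0) (1 : ℝ) * (HahnSeries.C (c ^ e.at 0 * α ^ e.at 1) *
          HahnSeries.single (zExp α m e) (1 : ℝ)) := by
      rw [HahnSeries.C_apply, HahnSeries.single_mul_single, HahnSeries.single_mul_single]; simp
    rw [this, mul_assoc, HahnSeries.coeff_single_mul_add, one_mul, mul_assoc, ← smul_eq_C_mul',
      HahnSeries.coeff_smul, smul_eq_mul, smul_eq_mul]
    ring

/-- By the fixed point equation the leading monomial contributes x(1 - B), while the remaining ones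
contribute xB. -/
theorem comp_invSeries (hα : 0 < α) (hc : 0 < c) (hP : IsGenerating α m G P)
    (hθ : θ.support ⊆ fil P 1) (hfix : invOp α m c G θ = θ)
    (ha : a * (c ^ α * α ^ (-m)) = 1) :
    comp (invSeries α m c θ) (HahnSeries.single (expo₂ α (-m)) a + G) = idSeries := by
  have hθ0 := orderTop_pos_of_fil hP.pos hθ
  have hW0 := orderTop_pos_of_fil hP.pos (support_invW hP c hθ)
  have hG2 : G.support ⊆ depthLe 2 := fun e he => depthLe_mono (by norm_num) (hP.depth he)
  have he1 : expo₂ α (-m) ∈ depthLe 1 := expo₂_mem_depthLe _ _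
  have he2 : expo₂ α (-m) ∈ depthLe 2 := depthLe_mono (by norm_num) he1
  have hl := isLeading_invSeries (m := m) hα hc hθ0
  rw [comp_add hl (support_single_subset' he2) hG2, comp_single hl he2,
    comp_invSeries_tail hα hc hP hθ, monomialComp_invSeries hα hc hθ0 hW0 he1]
  have hexpo : α • θ - (-m) • hlog (invW α m c θ) = hlog (-invSum α m c G θ) := by
    have h1 : (HahnSeries.C α : Series) * HahnSeries.C α⁻¹ = 1 := by
      rw [← map_mul, mul_inv_cancel₀ hα.ne', map_one]
    nth_rewrite 1 [← hfix]
    simp only [invOp, smul_eq_C_mul', map_neg]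
    linear_combination (hlog (-invSum α m c G θ) - HahnSeries.C m * hlog (invW α m c θ)) * h1
  have hB := orderTop_pos_of_fil hP.pos (support_neg_subset' (support_invSum hP c hθ))
  rw [zExp_leading hα, add_zero, expo₂_at_zero, expo₂_at_one, hexpo, expForm, hexp_hlog hB, idSeries_eq,
    smul_eq_C_mul']
  have h2 : (HahnSeries.C a : Series) * HahnSeries.single (Expo.delta 0) (c ^ α * α ^ (-m)) =
      HahnSeries.single (Expo.delta 0) 1 := by
    rw [HahnSeries.C_apply, HahnSeries.single_mul_single, ha, zero_add]
  linear_combination (1 + -invSum α m c G θ) * h2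

end Inverse

/-! ### The identity series; two-sidedness and uniqueness of the formal inverse -/

theorem fell_delta (j : ℕ) :
    fell (HahnSeries.single (Expo.delta j) (1 : ℝ)) = HahnSeries.single (Expo.delta (j + 1)) 1 := by
  have h : ∀ e : Expo, (HahnSeries.single e (1 : ℝ) : Series) = expForm e 1 0 := fun e => by
    rw [expForm, hexp_zero, mul_one]
  have h0 : (0 : WithTop Expo) < (0 : Series).orderTop := by simp
  rw [h, fell, neg_flog_expForm h0 _ one_pos, logPart_delta, Real.log_one, map_zero, sub_zero,
    sub_zero, h, expForm_inv h0 _ one_ne_zero, neg_neg, inv_one, neg_zero, ← h]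

theorem isLeading_idSeries : IsLeading 0 idSeries := by
  have h1 : idSeries.order = Expo.delta 0 := by
    rw [idSeries_eq, HahnSeries.order_single one_ne_zero]
  refine ⟨?_, by simp, ?_⟩
  · rw [idSeries_eq, HahnSeries.leadingCoeff_of_single]; exact one_pos
  · rw [h1, Expo.at_delta, if_pos rfl]; exact one_pos

theorem monomialComp_idSeries {e : Expo} (he : e ∈ depthLe 2) :
    monomialComp e idSeries = HahnSeries.single e 1 := by
  have h0 : (0 : WithTop Expo) < (0 : Series).orderTop := by simp
  have h : ∀ e : Expo, (HahnSeries.single e (1 : ℝ) : Series) = expForm e 1 0 := fun e => by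
    rw [expForm, hexp_zero, mul_one]
  have hp : ∀ j r, fpow (HahnSeries.single (Expo.delta j) (1 : ℝ)) r =
      HahnSeries.single (Expo.scale r (Expo.delta j)) 1 := by
    intro j r
    rw [h, fpow_expForm h0 _ one_pos, Real.one_rpow, h]
    congr 1
    ext; simp
  rw [monomialComp_eq isLeading_idSeries he, idSeries_eq, fell_delta, fell_delta, hp, hp, hp,
    HahnSeries.single_mul_single, HahnSeries.single_mul_single, mul_one, mul_one]
  congr 2
  refine Expo.ext' fun i => ?_
  simp only [Expo.at_add, Expo.at_scale, Expo.at_delta]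
  match i with
  | 0 => simp
  | 1 => simp
  | 2 => simp
  | i + 3 => rw [he (i + 3) (by omega)]; simp

theorem comp_idSeries {F : Series} (hF : F.support ⊆ depthLe 2) : comp idSeries F = F := by
  ext g
  rw [coeff_comp isLeading_idSeries hF, finsum_eq_single _ g]
  · by_cases hg : F.coeff g = 0
    · simp [hg]
    · rw [monomialComp_idSeries (hF hg), HahnSeries.coeff_single_same, mul_one]
  · intro e he
    by_cases h : F.coeff e = 0
    · simp [h]
    · rw [monomialComp_idSeries (hF h), HahnSeries.coeff_single_of_ne (Ne.symm he), mul_zero]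

theorem comp_X_idSeries {X : Series} (hX : IsLeading 0 X) : comp X idSeries = X := by
  have hd : Expo.delta 0 ∈ depthLe 2 := delta_mem_depthLe (by norm_num)
  rw [idSeries_eq, comp_single hX hd, one_smul', monomialComp_eq hX hd, Expo.at_delta,
    Expo.at_delta, Expo.at_delta, if_pos rfl, if_neg (by norm_num), if_neg (by norm_num),
    fpow_zero hX.fell.pos, fpow_zero hX.fell.fell.pos, fpow_one hX.pos, mul_one, mul_one]

/-- From F∘y = id one gets F∘(y∘F) = (F∘y)∘F = F = F∘id, and injectivity cancels the outer F. -/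
theorem isFormalInverse_of_comp {F y : Series} (hF : F.support ⊆ depthLe 1)
    (hF0 : IsLeading 0 F) (hy : y.support ⊆ depthLe 2) (hy0 : IsLeading 0 y)
    (ho : y.order ∈ depthLe 1) (h : comp y F = idSeries) : IsFormalInverse F y := by
  have hF2 : F.support ⊆ depthLe 2 := fun e he => depthLe_mono (by norm_num) (hF he)
  have h1 : comp F y = idSeries := by
    refine comp_injective (comp_isLeading hF0 hy hy0) isLeading_idSeries hF hF0.ne_zero
      hF0.at_pos.ne' ?_
    rw [comp_comp hF0 hy hy0 ho hF, h, comp_X_idSeries hF0, comp_idSeries hF2]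
  refine ⟨?_, ?_⟩
  · rw [← h]; exact isFormalComp_comp hy0 hF2
  · rw [← h1]; exact isFormalComp_comp hF0 hy

theorem formalInverse_unique {F y H : Series} (hF : F.support ⊆ depthLe 1)
    (hF0 : IsLeading 0 F) (hy0 : IsLeading 0 y) (h : comp y F = idSeries)
    (hH : IsInfTransseries 2 H) (hFH : IsFormalInverse F H) : H = y := by
  have hF2 : F.support ⊆ depthLe 2 := fun e he => depthLe_mono (by norm_num) (hF he)
  have hH0 : IsLeading 0 H := by
    refine ⟨hFH.1.1, by simp, hH.2 _ (HahnSeries.coeff_order_eq_zero.not.2 ?_)⟩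
    rintro rfl
    simpa using hFH.1.1
  refine comp_injective hH0 hy0 hF hF0.ne_zero hF0.at_pos.ne' ?_
  rw [h, ← hFH.1.eq_comp hH0 hF2]

/-- The exponents that generate those of the formal inverse. -/
def genSet (α m : ℝ) (G : Series) : Set Expo := {vExp, Expo.delta 1} ∪ zExp α m '' G.support

theorem vExp_pos : 0 < vExp := by
  refine Expo.lt_of_at 1 (fun i hi => ?_) ?_
  · have : i = 0 := by omega
    subst this
    simp [vExp, Expo.at_sub, Expo.at_delta, Expo.at_zero]
  · simp [vExp, Expo.at_sub, Expo.at_delta, Expo.at_zero]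

/-- The series `G'` may be any part of `G`, so that all truncations share one generating set and
their solutions can be compared. Positivity holds because `zExp` is increasing and sends the leading
exponent to 0. -/
theorem isGenerating_genSet {α m : ℝ} {G G' : Series} (hα : 0 < α) (hG : G.support ⊆ depthLe 1)
    (hlt : G.support ⊆ Ioi (expo₂ α (-m))) (hG' : G'.support ⊆ G.support) :
    IsGenerating α m G' (genSet α m G) where
  pwo := by
    refine IsPWO.union (Set.Finite.isPWO (by simp)) ?_
    exact G.isPWO_support.image_of_monotoneOn (((zExp_strictMonoOn hα m).mono hG).monotoneOn)
  pos := by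
    rintro e ((rfl | rfl) | ⟨e, he, rfl⟩)
    · exact vExp_pos
    · exact Expo.delta_pos 1
    · rw [mem_Ioi, ← zExp_leading hα m]
      exact zExp_strictMonoOn hα m (expo₂_mem_depthLe _ _) (hG he) (mem_Ioi.1 (hlt he))
  v_mem := Or.inl (Or.inl rfl)
  w_mem := Or.inl (Or.inr rfl)
  depth := hG'.trans hG
  z_mem := fun e he => Or.inr ⟨e, hG' he, rfl⟩

end

noncomputable section

/-! ### Weighted norms and evaluation of series -/

/-- A positive multiplicative weight on exponents. -/
structure IsWeight (τ : Expo → ℝ) : Prop where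
  pos : ∀ e, 0 < τ e
  add : ∀ e e', τ (e + e') = τ e * τ e'

theorem IsWeight.zero {τ : Expo → ℝ} (hτ : IsWeight τ) : τ 0 = 1 := by
  have h := hτ.add 0 0
  rw [add_zero] at h
  exact (mul_eq_left₀ (hτ.pos 0).ne').1 h.symm

/-- The weighted `ℓ¹` norm of `F` is at most `C`. -/
def NormLe (τ : Expo → ℝ) (F : Series) (C : ℝ) : Prop :=
  ∀ s : Finset Expo, ∑ e ∈ s, |F.coeff e| * τ e ≤ C

/-- The sum of `F` with respect to a weight. -/
def evalSum (τ : Expo → ℝ) (F : Series) : ℝ := ∑' e, F.coeff e * τ e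

section Norm

variable {τ : Expo → ℝ} {F G : Series} {C D : ℝ}

theorem NormLe.nonneg (h : NormLe τ F C) : 0 ≤ C := by simpa using h ∅

theorem NormLe.mono (h : NormLe τ F C) (hCD : C ≤ D) : NormLe τ F D := fun s => (h s).trans hCD

theorem NormLe.add (hτ : IsWeight τ) (hF : NormLe τ F C) (hG : NormLe τ G D) :
    NormLe τ (F + G) (C + D) := by
  intro s
  calc ∑ e ∈ s, |(F + G).coeff e| * τ e
      ≤ ∑ e ∈ s, (|F.coeff e| * τ e + |G.coeff e| * τ e) := by
        refine Finset.sum_le_sum fun e _ => ?_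
        rw [HahnSeries.coeff_add, ← add_mul]
        exact mul_le_mul_of_nonneg_right (abs_add_le _ _) (hτ.pos e).le
    _ ≤ C + D := by rw [Finset.sum_add_distrib]; exact add_le_add (hF s) (hG s)

theorem NormLe.smul (hF : NormLe τ F C) (r : ℝ) : NormLe τ (r • F) (|r| * C) := by
  intro s
  have : ∑ e ∈ s, |(r • F).coeff e| * τ e = |r| * ∑ e ∈ s, |F.coeff e| * τ e := by
    rw [Finset.mul_sum]
    exact Finset.sum_congr rfl fun e _ => by
      rw [HahnSeries.coeff_smul, smul_eq_mul, abs_mul, mul_assoc]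
  rw [this]
  exact mul_le_mul_of_nonneg_left (hF s) (abs_nonneg r)

theorem NormLe.neg (hF : NormLe τ F C) : NormLe τ (-F) C := by
  intro s
  simpa using hF s

theorem NormLe.sub (hτ : IsWeight τ) (hF : NormLe τ F C) (hG : NormLe τ G D) :
    NormLe τ (F - G) (C + D) := by
  rw [sub_eq_add_neg]; exact hF.add hτ hG.neg

theorem normLe_single (hτ : IsWeight τ) (e : Expo) (c : ℝ) :
    NormLe τ (HahnSeries.single e c) (|c| * τ e) := by
  classical
  intro s
  calc ∑ f ∈ s, |(HahnSeries.single e c : Series).coeff f| * τ f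
      ≤ ∑ f ∈ s, if f = e then |c| * τ e else 0 := by
        refine Finset.sum_le_sum fun f _ => ?_
        split_ifs with h
        · rw [h, HahnSeries.coeff_single_same]
        · rw [HahnSeries.coeff_single_of_ne h]; simp
    _ ≤ |c| * τ e := by
        rw [Finset.sum_ite_eq']
        split_ifs
        · exact le_rfl
        · exact mul_nonneg (abs_nonneg c) (hτ.pos e).le

theorem normLe_zero (τ : Expo → ℝ) : NormLe τ 0 0 := fun s => by simp

theorem NormLe.sum (hτ : IsWeight τ) {ι : Type*} (s : Finset ι) {f : ι → Series} {c : ι → ℝ}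
    (h : ∀ i ∈ s, NormLe τ (f i) (c i)) : NormLe τ (∑ i ∈ s, f i) (∑ i ∈ s, c i) := by
  classical
  induction s using Finset.induction_on with
  | empty => simpa using normLe_zero τ
  | insert i s hi ih =>
    rw [Finset.sum_insert hi, Finset.sum_insert hi]
    exact (h i (Finset.mem_insert_self i s)).add hτ
      (ih fun j hj => h j (Finset.mem_insert_of_mem hj))

/-- Finitely many exponents of the product involve finitely many pairs, which lie in a finite
rectangle, and multiplicativity of the weight factors the sum over it. -/
theorem NormLe.mul (hτ : IsWeight τ) (hF : NormLe τ F C) (hG : NormLe τ G D) :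
    NormLe τ (F * G) (C * D) := by
  classical
  intro s
  set A : Expo → Finset (Expo × Expo) := fun g =>
    Finset.antidiagonal F.isPWO_support G.isPWO_support g with hA
  set φ : Expo × Expo → ℝ := fun p => |F.coeff p.1| * τ p.1 * (|G.coeff p.2| * τ p.2) with hφ
  have hφ0 : ∀ p, 0 ≤ φ p := fun p => mul_nonneg
    (mul_nonneg (abs_nonneg _) (hτ.pos _).le) (mul_nonneg (abs_nonneg _) (hτ.pos _).le)
  set T := s.biUnion A with hT
  calc ∑ g ∈ s, |(F * G).coeff g| * τ g ≤ ∑ g ∈ s, ∑ p ∈ A g, φ p := by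
        refine Finset.sum_le_sum fun g _ => ?_
        rw [HahnSeries.coeff_mul]
        refine (mul_le_mul_of_nonneg_right (Finset.abs_sum_le_sum_abs _ _) (hτ.pos g).le).trans ?_
        rw [Finset.sum_mul]
        refine Finset.sum_le_sum fun p hp => le_of_eq ?_
        rw [hφ, ← (Finset.mem_antidiagonal.1 hp).2.2, hτ.add, abs_mul]
        ring
    _ = ∑ p ∈ T, φ p := by
        rw [hT, Finset.sum_biUnion]
        intro g _ g' _ hne
        rw [Function.onFun, Finset.disjoint_left]
        intro p hp hp'
        exact hne ((Finset.mem_antidiagonal.1 hp).2.2.symm.trans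
          (Finset.mem_antidiagonal.1 hp').2.2)
    _ ≤ ∑ p ∈ T.image Prod.fst ×ˢ T.image Prod.snd, φ p := by
        refine Finset.sum_le_sum_of_subset_of_nonneg (fun p hp => ?_) fun p _ _ => hφ0 p
        exact Finset.mem_product.2 ⟨Finset.mem_image_of_mem _ hp, Finset.mem_image_of_mem _ hp⟩
    _ = (∑ e ∈ T.image Prod.fst, |F.coeff e| * τ e) * ∑ e ∈ T.image Prod.snd, |G.coeff e| * τ e := by
        rw [Finset.sum_product, Finset.sum_mul_sum]
    _ ≤ C * D := mul_le_mul (hF _) (hG _)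
        (Finset.sum_nonneg fun e _ => mul_nonneg (abs_nonneg _) (hτ.pos e).le) hF.nonneg

theorem NormLe.pow (hτ : IsWeight τ) (hF : NormLe τ F C) (n : ℕ) : NormLe τ (F ^ n) (C ^ n) := by
  induction n with
  | zero =>
    have := normLe_single hτ 0 1
    rw [hτ.zero] at this
    simpa using this
  | succ n ih => rw [pow_succ, pow_succ]; exact ih.mul hτ hF

theorem NormLe.summable (hτ : IsWeight τ) (hF : NormLe τ F C) :
    Summable fun e => |F.coeff e| * τ e :=
  summable_of_sum_le (fun e => mul_nonneg (abs_nonneg _) (hτ.pos e).le) hF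

theorem NormLe.summable' (hτ : IsWeight τ) (hF : NormLe τ F C) :
    Summable fun e => F.coeff e * τ e := by
  refine Summable.of_norm ((hF.summable hτ).congr fun e => ?_)
  rw [Real.norm_eq_abs, abs_mul, abs_of_pos (hτ.pos e)]

theorem NormLe.abs_evalSum_le (hτ : IsWeight τ) (hF : NormLe τ F C) : |evalSum τ F| ≤ C := by
  have h1 : ∀ e, ‖F.coeff e * τ e‖ = |F.coeff e| * τ e := fun e => by
    rw [Real.norm_eq_abs, abs_mul, abs_of_pos (hτ.pos e)]
  have := norm_tsum_le_tsum_norm (f := fun e => F.coeff e * τ e) (by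
    simpa only [h1] using hF.summable hτ)
  rw [Real.norm_eq_abs] at this
  refine this.trans ?_
  simp only [h1]
  exact Real.tsum_le_of_sum_le (fun e => mul_nonneg (abs_nonneg _) (hτ.pos e).le) hF

theorem evalSum_add (hτ : IsWeight τ) (hF : NormLe τ F C) (hG : NormLe τ G D) :
    evalSum τ (F + G) = evalSum τ F + evalSum τ G := by
  rw [evalSum, evalSum, evalSum, ← (hF.summable' hτ).tsum_add (hG.summable' hτ)]
  exact tsum_congr fun e => by rw [HahnSeries.coeff_add, add_mul]

theorem evalSum_smul (τ : Expo → ℝ) (F : Series) (r : ℝ) : evalSum τ (r • F) = r * evalSum τ F := by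
  rw [evalSum, evalSum, ← tsum_mul_left]
  exact tsum_congr fun e => by rw [HahnSeries.coeff_smul, smul_eq_mul, mul_assoc]

theorem evalSum_neg (τ : Expo → ℝ) (F : Series) : evalSum τ (-F) = -evalSum τ F := by
  rw [evalSum, evalSum, ← tsum_neg]
  exact tsum_congr fun e => by rw [HahnSeries.coeff_neg, neg_mul]

theorem evalSum_sub (hτ : IsWeight τ) (hF : NormLe τ F C) (hG : NormLe τ G D) :
    evalSum τ (F - G) = evalSum τ F - evalSum τ G := by
  rw [sub_eq_add_neg, evalSum_add hτ hF hG.neg, evalSum_neg, sub_eq_add_neg]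

theorem evalSum_single (τ : Expo → ℝ) (e : Expo) (c : ℝ) :
    evalSum τ (HahnSeries.single e c) = c * τ e := by
  rw [evalSum, tsum_eq_single e, HahnSeries.coeff_single_same]
  intro f hf
  rw [HahnSeries.coeff_single_of_ne hf, zero_mul]

theorem evalSum_zero (τ : Expo → ℝ) : evalSum τ 0 = 0 := by simp [evalSum]

theorem evalSum_sum (hτ : IsWeight τ) {ι : Type*} (s : Finset ι) {f : ι → Series} {c : ι → ℝ}
    (h : ∀ i ∈ s, NormLe τ (f i) (c i)) :
    evalSum τ (∑ i ∈ s, f i) = ∑ i ∈ s, evalSum τ (f i) := by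
  classical
  induction s using Finset.induction_on with
  | empty => simpa using evalSum_zero τ
  | insert i s hi ih =>
    have h' : ∀ j ∈ s, NormLe τ (f j) (c j) := fun j hj => h j (Finset.mem_insert_of_mem hj)
    rw [Finset.sum_insert hi, Finset.sum_insert hi,
      evalSum_add hτ (h i (Finset.mem_insert_self i s)) (NormLe.sum hτ s h'), ih h']

theorem evalSum_mul (hτ : IsWeight τ) (hF : NormLe τ F C) (hG : NormLe τ G D) :
    evalSum τ (F * G) = evalSum τ F * evalSum τ G := by
  classical
  have hF' : Summable fun e => ‖F.coeff e * τ e‖ := (hF.summable' hτ).norm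
  have hG' : Summable fun e => ‖G.coeff e * τ e‖ := (hG.summable' hτ).norm
  have hs := summable_mul_of_summable_norm hF' hG'
  have h1 : HasSum (fun p : Expo × Expo => (F.coeff p.1 * τ p.1) * (G.coeff p.2 * τ p.2))
      (evalSum τ F * evalSum τ G) := by
    have := hs.hasSum
    rwa [← tsum_mul_tsum_of_summable_norm hF' hG'] at this
  have h2 := h1.tsum_fiberwise (fun p : Expo × Expo => p.1 + p.2)
  rw [← h2.tsum_eq, evalSum]
  refine tsum_congr fun g => ?_
  rw [tsum_subtype ((fun p : Expo × Expo => p.1 + p.2) ⁻¹' {g})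
    (fun p : Expo × Expo => (F.coeff p.1 * τ p.1) * (G.coeff p.2 * τ p.2)),
    tsum_eq_sum (s := Finset.antidiagonal F.isPWO_support G.isPWO_support g),
    HahnSeries.coeff_mul, Finset.sum_mul]
  · refine Finset.sum_congr rfl fun p hp => ?_
    have hp3 := (Finset.mem_antidiagonal.1 hp).2.2
    rw [indicator_of_mem (show p ∈ (fun p : Expo × Expo => p.1 + p.2) ⁻¹' {g} from hp3), ← hp3,
      hτ.add]
    ring
  · intro p hp
    by_contra hne
    have hmem : p.1 + p.2 = g := by
      by_contra h
      exact hne (indicator_of_notMem (s := (fun p : Expo × Expo => p.1 + p.2) ⁻¹' {g}) h _)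
    refine hp (Finset.mem_antidiagonal.2 ⟨?_, ?_, hmem⟩)
    · rw [HahnSeries.mem_support]
      intro h0; exact hne (by simp [indicator, h0])
    · rw [HahnSeries.mem_support]
      intro h0; exact hne (by simp [indicator, h0])

theorem evalSum_one (hτ : IsWeight τ) : evalSum τ 1 = 1 := by
  have := evalSum_single τ 0 1
  rw [hτ.zero, mul_one] at this
  exact this

theorem evalSum_pow (hτ : IsWeight τ) (hF : NormLe τ F C) (n : ℕ) :
    evalSum τ (F ^ n) = evalSum τ F ^ n := by
  induction n with
  | zero => rw [pow_zero, pow_zero, evalSum_one hτ]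
  | succ n ih => rw [pow_succ, pow_succ, evalSum_mul hτ (hF.pow hτ n) hF, ih]

open PowerSeries in
theorem NormLe.sum_heval (hτ : IsWeight τ) (hF : NormLe τ F C)
    {f : PowerSeries ℝ} (hf : ∀ t : Finset ℕ, ∑ n ∈ t, |coeff n f| * C ^ n ≤ D)
    (s : Finset (ℕ × Expo)) : ∑ p ∈ s, |coeff p.1 f * (F ^ p.1).coeff p.2| * τ p.2 ≤ D := by
  classical
  calc ∑ p ∈ s, |coeff p.1 f * (F ^ p.1).coeff p.2| * τ p.2
      ≤ ∑ p ∈ s.image Prod.fst ×ˢ s.image Prod.snd,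
          |coeff p.1 f * (F ^ p.1).coeff p.2| * τ p.2 := by
        refine Finset.sum_le_sum_of_subset_of_nonneg (fun p hp => ?_) fun p _ _ =>
          mul_nonneg (abs_nonneg _) (hτ.pos _).le
        exact Finset.mem_product.2 ⟨Finset.mem_image_of_mem _ hp, Finset.mem_image_of_mem _ hp⟩
    _ ≤ ∑ n ∈ s.image Prod.fst, |coeff n f| * C ^ n := by
        rw [Finset.sum_product]
        refine Finset.sum_le_sum fun n _ => ?_
        have : ∀ e, |coeff n f * (F ^ n).coeff e| * τ e =
            |coeff n f| * (|(F ^ n).coeff e| * τ e) := fun e => by rw [abs_mul, mul_assoc]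
        simp only [this, ← Finset.mul_sum]
        exact mul_le_mul_of_nonneg_left (hF.pow hτ n _) (abs_nonneg _)
    _ ≤ D := hf _

open PowerSeries in
theorem NormLe.heval (hτ : IsWeight τ) (h0 : 0 < F.orderTop) (hF : NormLe τ F C)
    {f : PowerSeries ℝ} (hf : ∀ t : Finset ℕ, ∑ n ∈ t, |coeff n f| * C ^ n ≤ D) :
    NormLe τ (heval F f) D := by
  classical
  intro s
  set T : Expo → Finset ℕ := fun e => (finite_coeff_pow h0 e).toFinset with hT
  have hc : ∀ e, (PowerSeries.heval F f).coeff e = ∑ n ∈ T e, coeff n f * (F ^ n).coeff e := by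
    intro e
    rw [coeff_heval' h0]
    refine finsum_eq_sum_of_support_subset _ fun n hn => ?_
    simp only [hT, Finite.coe_toFinset]
    intro h
    exact hn (by simp only [h, mul_zero])
  calc ∑ e ∈ s, |(PowerSeries.heval F f).coeff e| * τ e
      ≤ ∑ e ∈ s, ∑ n ∈ s.biUnion T, |coeff n f * (F ^ n).coeff e| * τ e := by
        refine Finset.sum_le_sum fun e he => ?_
        rw [hc, ← Finset.sum_mul]
        refine mul_le_mul_of_nonneg_right ((Finset.abs_sum_le_sum_abs _ _).trans ?_) (hτ.pos e).le
        exact Finset.sum_le_sum_of_subset_of_nonneg (Finset.subset_biUnion_of_mem T he)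
          fun _ _ _ => abs_nonneg _
    _ = ∑ p ∈ s.biUnion T ×ˢ s, |coeff p.1 f * (F ^ p.1).coeff p.2| * τ p.2 := by
        rw [Finset.sum_product_right]
    _ ≤ D := hF.sum_heval hτ hf _

open PowerSeries in
theorem evalSum_heval (hτ : IsWeight τ) (h0 : 0 < F.orderTop) (hF : NormLe τ F C)
    {f : PowerSeries ℝ} (hf : ∀ t : Finset ℕ, ∑ n ∈ t, |coeff n f| * C ^ n ≤ D) :
    evalSum τ (heval F f) = ∑' n, coeff n f * evalSum τ F ^ n := by
  have hs : Summable fun p : ℕ × Expo => coeff p.1 f * (F ^ p.1).coeff p.2 * τ p.2 := by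
    refine Summable.of_norm (summable_of_sum_le (fun _ => norm_nonneg _) (c := D) fun s => ?_)
    refine le_trans (le_of_eq ?_) (hF.sum_heval hτ hf s)
    exact Finset.sum_congr rfl fun p _ => by
      rw [Real.norm_eq_abs, abs_mul, abs_of_pos (hτ.pos _)]
  have h1 : ∀ e, (PowerSeries.heval F f).coeff e * τ e =
      ∑' n, coeff n f * (F ^ n).coeff e * τ e := by
    intro e
    rw [coeff_heval' h0, tsum_mul_right, tsum_eq_finsum]
    exact (finite_coeff_pow h0 e).subset fun n hn h => hn (by simp only [h, mul_zero])
  rw [evalSum]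
  simp only [h1]
  rw [Summable.tsum_comm (f := fun n e => coeff n f * (F ^ n).coeff e * τ e) hs]
  refine tsum_congr fun n => ?_
  rw [← evalSum_pow hτ hF, evalSum, ← tsum_mul_left]
  exact tsum_congr fun e => by rw [mul_assoc]

theorem hasSum_coeff_exp (C : ℝ) :
    HasSum (fun n => PowerSeries.coeff n (PowerSeries.exp ℝ) * C ^ n) (Real.exp C) := by
  have h := NormedSpace.expSeries_div_hasSum_exp C
  rw [← Real.exp_eq_exp_ℝ] at h
  refine h.congr_fun fun n => ?_
  rw [PowerSeries.coeff_exp]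
  simp [div_eq_inv_mul]

theorem sum_coeff_exp_le {C : ℝ} (hC : 0 ≤ C) (t : Finset ℕ) :
    ∑ n ∈ t, |PowerSeries.coeff n (PowerSeries.exp ℝ)| * C ^ n ≤ Real.exp C := by
  have h : ∀ n, |PowerSeries.coeff n (PowerSeries.exp ℝ)| = PowerSeries.coeff n (PowerSeries.exp ℝ) :=
    fun n => abs_of_nonneg (by rw [PowerSeries.coeff_exp]; simp)
  simp only [h]
  exact sum_le_hasSum t (fun n _ => by rw [← h]; positivity) (hasSum_coeff_exp C)

theorem NormLe.hexp (hτ : IsWeight τ) (h0 : 0 < F.orderTop) (hF : NormLe τ F C) :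
    NormLe τ (hexp F) (Real.exp C) := hF.heval hτ h0 (sum_coeff_exp_le hF.nonneg)

theorem evalSum_hexp (hτ : IsWeight τ) (h0 : 0 < F.orderTop) (hF : NormLe τ F C) :
    evalSum τ (hexp F) = Real.exp (evalSum τ F) := by
  rw [Dulac.hexp, evalSum_heval hτ h0 hF (sum_coeff_exp_le hF.nonneg)]
  exact (hasSum_coeff_exp _).tsum_eq

/-- The coefficients are at most 1 in absolute value and the constant one vanishes, so the sum is at
most C/(1-C) ≤ 2C for C ≤ 1/2. -/
theorem sum_coeff_log_le {C : ℝ} (hC : 0 ≤ C) (hC2 : C ≤ 1 / 2) (t : Finset ℕ) :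
    ∑ n ∈ t, |PowerSeries.coeff n logSeries| * C ^ n ≤ 2 * C := by
  have h1 : ∑ n ∈ t, |PowerSeries.coeff n logSeries| * C ^ n ≤ ∑ n ∈ t.erase 0, C ^ n := by
    rw [← Finset.sum_erase t (a := 0) (by simp [logSeries])]
    refine Finset.sum_le_sum fun n hn => ?_
    have hn0 : n ≠ 0 := (Finset.mem_erase.1 hn).1
    refine mul_le_of_le_one_left (pow_nonneg hC n) ?_
    rw [logSeries, PowerSeries.coeff_mk, abs_div, abs_pow, abs_neg, abs_one, one_pow, Nat.abs_cast]
    exact div_le_one_of_le₀ (by exact_mod_cast Nat.one_le_iff_ne_zero.2 hn0) (Nat.cast_nonneg n)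
  have h2 : 1 + ∑ n ∈ t.erase 0, C ^ n ≤ (1 - C)⁻¹ := by
    have := sum_le_hasSum (insert 0 (t.erase 0)) (fun n _ => pow_nonneg hC n)
      (hasSum_geometric_of_lt_one hC (by linarith))
    rwa [Finset.sum_insert (Finset.notMem_erase 0 t), pow_zero] at this
  have h3 : (1 - C)⁻¹ ≤ 1 + 2 * C := by
    rw [inv_le_iff_one_le_mul₀ (by linarith)]
    nlinarith
  linarith

theorem NormLe.hlog (hτ : IsWeight τ) (h0 : 0 < F.orderTop) (hF : NormLe τ F C)
    (hC : C ≤ 1 / 2) : NormLe τ (hlog F) (2 * C) := hF.heval hτ h0 (sum_coeff_log_le hF.nonneg hC)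

theorem exp_evalSum_hlog (hτ : IsWeight τ) (h0 : 0 < F.orderTop) (hF : NormLe τ F C)
    (hC : C ≤ 1 / 2) : Real.exp (evalSum τ (hlog F)) = 1 + evalSum τ F := by
  rw [← evalSum_hexp hτ (hlog_orderTop_pos h0) (hF.hlog hτ h0 hC), hexp_hlog h0,
    evalSum_add hτ (C := 1) ?_ hF, evalSum_one hτ]
  have := normLe_single hτ 0 1
  rw [hτ.zero] at this
  simpa using this

/-- A finite partial sum sees finitely many coefficients, which are all attained by a common
iterate. -/
theorem NormLe.of_eventually {f : ℕ → Series} (h : ∀ k, NormLe τ (f k) C)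
    (hF : ∀ e, ∃ n, ∀ k ≥ n, F.coeff e = (f k).coeff e) : NormLe τ F C := by
  intro s
  choose n hn using hF
  refine le_trans (le_of_eq ?_) (h (s.sup n) s)
  exact Finset.sum_congr rfl fun e he => by rw [hn e (s.sup n) (Finset.le_sup he)]

end Norm

end

noncomputable section

/-! ### The weights given by the values of monomials -/

theorem monomialFun_eq {e : Expo} (he : e ∈ depthLe 2) (x : ℝ) :
    monomialFun e x = x ^ e.at 0 * ell x ^ e.at 1 * ell (ell x) ^ e.at 2 := by
  rw [monomialFun, Finsupp.prod_of_support_subset _ (s := Finset.range 3)]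
  · rw [Finset.prod_range_succ, Finset.prod_range_succ, Finset.prod_range_one]; rfl
  · intro i hi
    rw [Finset.mem_range]
    by_contra h
    exact (Finsupp.mem_support_iff.1 hi) (he i (by omega))
  · intro i _
    rw [Real.rpow_zero]

theorem ell_pos {x : ℝ} (h0 : 0 < x) (h1 : x < 1) : 0 < ell x :=
  inv_pos.2 (neg_pos.2 (Real.log_neg h0 h1))

theorem log_eq_neg_inv_ell (x : ℝ) : Real.log x = -(ell x)⁻¹ := by
  rw [ell, inv_inv, neg_neg]

theorem tendsto_neg_log : Tendsto (fun x => -Real.log x) (𝓝[>] 0) atTop :=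
  tendsto_neg_atBot_atTop.comp Real.tendsto_log_nhdsGT_zero

theorem tendsto_ell : Tendsto ell (𝓝[>] 0) (𝓝[>] 0) := by
  refine tendsto_nhdsWithin_iff.2 ⟨tendsto_inv_atTop_zero.comp tendsto_neg_log, ?_⟩
  filter_upwards [Ioo_mem_nhdsGT one_pos] with x hx
  exact ell_pos hx.1 hx.2

/-- The value at `x` of the monomial of exponent `e`, with `x` replaced by `x^η` in its first
factor. -/
def weight (η x : ℝ) (e : Expo) : ℝ := x ^ (η * e.at 0) * ell x ^ e.at 1 * ell (ell x) ^ e.at 2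

theorem monomialFun_eq_weight {e : Expo} (he : e ∈ depthLe 2) (x : ℝ) :
    monomialFun e x = weight 1 x e := by rw [monomialFun_eq he, weight, one_mul]

/-- The range of `x` for which all monomials are positive. -/
def Admissible (x : ℝ) : Prop := 0 < x ∧ 0 < ell x ∧ 0 < ell (ell x)

theorem eventually_admissible : ∀ᶠ x in 𝓝[>] 0, Admissible x := by
  have h : ∀ᶠ x in 𝓝[>] (0 : ℝ), 0 < x := self_mem_nhdsWithin
  filter_upwards [h, tendsto_ell.eventually h, (tendsto_ell.comp tendsto_ell).eventually h] with
    x h0 h1 h2 using ⟨h0, h1, h2⟩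

theorem isWeight_weight (η : ℝ) {x : ℝ} (hx : Admissible x) : IsWeight (weight η x) where
  pos e := by
    have := hx.1; have := hx.2.1; have := hx.2.2
    unfold weight
    positivity
  add e e' := by
    simp only [weight, Expo.at_add, mul_add, Real.rpow_add hx.1, Real.rpow_add hx.2.1,
      Real.rpow_add hx.2.2]
    ring

theorem tendsto_atTop_of_dominant {l : Filter ℝ} {A f : ℝ → ℝ} {k : ℝ} (hk : 0 < k)
    (hA : Tendsto A l atTop) (hf : f =o[l] A) : Tendsto (fun x => k * A x + f x) l atTop := by
  refine tendsto_atTop_mono' l ?_ (hA.const_mul_atTop (half_pos hk))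
  filter_upwards [hf.bound (half_pos hk), hA.eventually_ge_atTop 0] with x h1 h2
  rw [Real.norm_eq_abs, Real.norm_eq_abs, abs_of_nonneg h2] at h1
  have := neg_le_of_abs_le h1
  linarith

/-- With A = -log x, B = log A, D = log B, minus the logarithm of the weight is η e₀ A + e₁ B + e₂
D. Each scale dominates the next, and lexicographic positivity says that the first nonzero
coefficient is positive. -/
theorem tendsto_weight {η : ℝ} (hη : 0 < η) {e : Expo} (he : e ∈ depthLe 2) (hpos : 0 < e) :
    Tendsto (fun x => weight η x e) (𝓝[>] 0) (𝓝 0) := by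
  set A : ℝ → ℝ := fun x => -Real.log x with hA
  set B : ℝ → ℝ := fun x => Real.log (A x) with hB
  set D : ℝ → ℝ := fun x => Real.log (B x) with hD
  have hAt : Tendsto A (𝓝[>] 0) atTop := tendsto_neg_log
  have hBt : Tendsto B (𝓝[>] 0) atTop := Real.tendsto_log_atTop.comp hAt
  have hDt : Tendsto D (𝓝[>] 0) atTop := Real.tendsto_log_atTop.comp hBt
  have hBA : B =o[𝓝[>] 0] A := Real.isLittleO_log_id_atTop.comp_tendsto hAt
  have hDB : D =o[𝓝[>] 0] B := Real.isLittleO_log_id_atTop.comp_tendsto hBt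
  have hEq : (fun x => Real.exp (-(η * e.at 0 * A x + e.at 1 * B x + e.at 2 * D x)))
      =ᶠ[𝓝[>] 0] fun x => weight η x e := by
    filter_upwards [eventually_admissible] with x hx
    have h1 : Real.log (ell x) = -B x := by rw [hB, ell, Real.log_inv]
    have h2 : Real.log (ell (ell x)) = -D x := by
      have : ell (ell x) = (B x)⁻¹ := by rw [ell, h1, neg_neg]
      rw [this, Real.log_inv]
    rw [weight, Real.rpow_def_of_pos hx.1, Real.rpow_def_of_pos hx.2.1,
      Real.rpow_def_of_pos hx.2.2, h1, h2, ← Real.exp_add, ← Real.exp_add]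
    congr 1
    rw [hA]
    ring
  refine Tendsto.congr' hEq (Real.tendsto_exp_neg_atTop_nhds_zero.comp ?_)
  rcases depthLe_two_lt (depthLe 2).zero_mem he hpos with h | ⟨h0, h⟩ | ⟨h0, h1, h⟩
  · rw [Expo.at_zero] at h
    have := tendsto_atTop_of_dominant (mul_pos hη h) hAt
      ((hBA.const_mul_left (e.at 1)).add ((hDB.trans hBA).const_mul_left (e.at 2)))
    refine this.congr fun x => ?_
    ring
  · rw [Expo.at_zero] at h h0
    refine (tendsto_atTop_of_dominant h hBt (hDB.const_mul_left (e.at 2))).congr fun x => ?_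
    rw [← h0]; ring
  · rw [Expo.at_zero] at h h0 h1
    refine (hDt.const_mul_atTop h).congr fun x => ?_
    rw [← h0, ← h1]; ring

/-! ### Convergence of the solution of the equation -/

/-- The bound of the norm of `invW`. -/
def boundW (α m c : ℝ) (τ : Expo → ℝ) : ℝ :=
  |m| * τ vExp + |α| * (τ (Expo.delta 1) * (|Real.log c| + 1))

/-- The bound of the norm of `invTerm`. -/
def boundTerm (α m c : ℝ) (G : Series) (τ : Expo → ℝ) (e : Expo) : ℝ :=
  |G.coeff e * (c ^ e.at 0 * α ^ e.at 1)| * (τ (zExp α m e) * Real.exp (|e.at 0| + |e.at 1|))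

/-- The weight is small enough for the equation to have a convergent solution. -/
structure IsSmall (α m c : ℝ) (G : Series) (S : Finset Expo) (τ : Expo → ℝ) : Prop where
  weight : IsWeight τ
  supp : ∀ e, e ∈ S ↔ e ∈ G.support
  boundW_le : boundW α m c τ ≤ 1 / 2
  boundSum_le : ∑ e ∈ S, boundTerm α m c G τ e ≤ 1 / 2
  bound_le : |α⁻¹| * (2 * ∑ e ∈ S, boundTerm α m c G τ e + |m| * (2 * boundW α m c τ)) ≤ 1

section Small

variable {α m c : ℝ} {G : Series} {P : Set Expo} {θ : Series} {τ : Expo → ℝ} {S : Finset Expo}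

theorem normLe_invW (hτ : IsWeight τ) (hθ : NormLe τ θ 1) :
    NormLe τ (invW α m c θ) (boundW α m c τ) := by
  have h1 : NormLe τ (HahnSeries.C (Real.log c) + θ) (|Real.log c| + 1) := by
    refine NormLe.add hτ ?_ hθ
    have := normLe_single hτ 0 (Real.log c)
    rwa [hτ.zero, mul_one] at this
  have h2 := normLe_single hτ (Expo.delta 1) 1
  have h3 := normLe_single hτ vExp 1
  rw [abs_one, one_mul] at h2 h3
  exact NormLe.sub hτ (h3.smul m) ((h2.mul hτ h1).smul α)

theorem normLe_invExponent (hS : IsSmall α m c G S τ) (hP : IsGenerating α m G P)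
    (hθf : θ.support ⊆ fil P 1) (hθ : NormLe τ θ 1) (e : Expo) :
    NormLe τ (e.at 0 • θ - e.at 1 • hlog (invW α m c θ)) (|e.at 0| + |e.at 1|) := by
  have hW := (normLe_invW (m := m) (α := α) (c := c) hS.weight hθ).hlog hS.weight
    (orderTop_pos_of_fil hP.pos (support_invW hP c hθf)) hS.boundW_le
  refine ((hθ.smul (e.at 0)).sub hS.weight (hW.smul (e.at 1))).mono ?_
  have h1 := mul_le_of_le_one_right (abs_nonneg (e.at 1))
    (show 2 * boundW α m c τ ≤ 1 by linarith [hS.boundW_le])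
  linarith

theorem normLe_invTerm (hS : IsSmall α m c G S τ) (hP : IsGenerating α m G P)
    (hθf : θ.support ⊆ fil P 1) (hθ : NormLe τ θ 1) (e : Expo) :
    NormLe τ (invTerm α m c G θ e) (boundTerm α m c G τ e) := by
  have h1 := normLe_single hS.weight (zExp α m e) 1
  rw [abs_one, one_mul] at h1
  exact (h1.mul hS.weight ((normLe_invExponent hS hP hθf hθ e).hexp hS.weight
    (orderTop_pos_of_fil hP.pos (support_invExponent hP c hθf e)))).smul _

theorem invSum_eq_sum (hα : 0 < α) (hS : ∀ e, e ∈ S ↔ e ∈ G.support) (hP : IsGenerating α m G P)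
    (hθf : θ.support ⊆ fil P 1) : invSum α m c G θ = ∑ e ∈ S, invTerm α m c G θ e := by
  ext g
  rw [invSum, coeff_hsumOf (hSummable_invTerm hα hP c hθf), HahnSeries.coeff_sum]
  refine finsum_eq_sum_of_support_subset _ fun e he => ?_
  rw [Finset.mem_coe, hS e]
  intro h0
  refine he ?_
  simp only [invTerm, h0, zero_mul, zero_smul']
  rfl

theorem normLe_invSum (hα : 0 < α) (hS : IsSmall α m c G S τ) (hP : IsGenerating α m G P)
    (hθf : θ.support ⊆ fil P 1) (hθ : NormLe τ θ 1) :
    NormLe τ (invSum α m c G θ) (∑ e ∈ S, boundTerm α m c G τ e) := by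
  rw [invSum_eq_sum hα hS.supp hP hθf]
  exact NormLe.sum hS.weight S fun e _ => normLe_invTerm hS hP hθf hθ e

theorem normLe_invOp (hα : 0 < α) (hS : IsSmall α m c G S τ) (hP : IsGenerating α m G P)
    (hθf : θ.support ⊆ fil P 1) (hθ : NormLe τ θ 1) : NormLe τ (invOp α m c G θ) 1 := by
  have hW := (normLe_invW (m := m) (α := α) (c := c) hS.weight hθ).hlog hS.weight
    (orderTop_pos_of_fil hP.pos (support_invW hP c hθf)) hS.boundW_le
  have hB := (normLe_invSum hα hS hP hθf hθ).neg.hlog hS.weight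
    (orderTop_pos_of_fil hP.pos (support_neg_subset' (support_invSum hP c hθf))) hS.boundSum_le
  exact ((hB.sub hS.weight (hW.smul m)).smul α⁻¹).mono hS.bound_le

/-- The operator preserves the unit ball for a small weight, so all iterates from 0 stay in it and
so does their coefficientwise limit. -/
theorem normLe_fixedPoint (hα : 0 < α) (hS : IsSmall α m c G S τ) (hP : IsGenerating α m G P)
    (h : ∀ e, ∃ n, ∀ k ≥ n, θ.coeff e = ((invOp α m c G)^[k] 0).coeff e) : NormLe τ θ 1 := by
  refine NormLe.of_eventually (fun k => ?_) h
  induction k with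
  | zero => exact (normLe_zero τ).mono zero_le_one
  | succ k ih =>
    rw [Function.iterate_succ_apply']
    exact normLe_invOp hα hS hP (support_invOp_iterate hP c k) ih

theorem evalSum_invW (hτ : IsWeight τ) (hθ : NormLe τ θ 1) :
    evalSum τ (invW α m c θ) =
      m * τ vExp - α * (τ (Expo.delta 1) * (Real.log c + evalSum τ θ)) := by
  have h0 : NormLe τ (HahnSeries.C (Real.log c) : Series) (|Real.log c|) := by
    have := normLe_single hτ 0 (Real.log c)
    rwa [hτ.zero, mul_one] at this
  have h2 := normLe_single hτ (Expo.delta 1) 1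
  have h3 := normLe_single hτ vExp 1
  have h4 := evalSum_single τ 0 (Real.log c)
  rw [hτ.zero, mul_one] at h4
  rw [invW, evalSum_sub hτ (h3.smul m) ((h2.mul hτ (h0.add hτ hθ)).smul α), evalSum_smul,
    evalSum_smul, evalSum_mul hτ h2 (h0.add hτ hθ), evalSum_add hτ h0 hθ, evalSum_single,
    evalSum_single, one_mul, one_mul, HahnSeries.C_apply, h4]

theorem evalSum_invTerm (hS : IsSmall α m c G S τ) (hP : IsGenerating α m G P)
    (hθf : θ.support ⊆ fil P 1) (hθ : NormLe τ θ 1) (e : Expo) :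
    evalSum τ (invTerm α m c G θ e) = G.coeff e * (c ^ e.at 0 * α ^ e.at 1) *
      (τ (zExp α m e) *
        Real.exp (e.at 0 * evalSum τ θ - e.at 1 * evalSum τ (hlog (invW α m c θ)))) := by
  have hW := (normLe_invW (m := m) (α := α) (c := c) hS.weight hθ).hlog hS.weight
    (orderTop_pos_of_fil hP.pos (support_invW hP c hθf)) hS.boundW_le
  have h1 := normLe_single hS.weight (zExp α m e) 1
  have h2 := normLe_invExponent hS hP hθf hθ e
  have h3 := orderTop_pos_of_fil hP.pos (support_invExponent hP c hθf e)
  rw [invTerm, evalSum_smul, evalSum_mul hS.weight h1 (h2.hexp hS.weight h3), evalSum_single,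
    one_mul, evalSum_hexp hS.weight h3 h2, evalSum_sub hS.weight (hθ.smul _) (hW.smul _),
    evalSum_smul, evalSum_smul]

theorem exp_evalSum_fixedPoint (hα : 0 < α) (hS : IsSmall α m c G S τ) (hP : IsGenerating α m G P)
    (hθf : θ.support ⊆ fil P 1) (hθ : NormLe τ θ 1) (hfix : invOp α m c G θ = θ) :
    Real.exp (α * evalSum τ θ + m * evalSum τ (hlog (invW α m c θ))) =
      1 - ∑ e ∈ S, evalSum τ (invTerm α m c G θ e) := by
  have hW := (normLe_invW (m := m) (α := α) (c := c) hS.weight hθ).hlog hS.weight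
    (orderTop_pos_of_fil hP.pos (support_invW hP c hθf)) hS.boundW_le
  have hB0 := orderTop_pos_of_fil hP.pos (support_neg_subset' (support_invSum hP c hθf))
  have hB1 := (normLe_invSum hα hS hP hθf hθ).neg
  have hB := hB1.hlog hS.weight hB0 hS.boundSum_le
  have h1 : evalSum τ θ = α⁻¹ * (evalSum τ (hlog (-invSum α m c G θ)) -
      m * evalSum τ (hlog (invW α m c θ))) := by
    conv_lhs => rw [← hfix]
    rw [invOp, evalSum_smul, evalSum_sub hS.weight hB (hW.smul m), evalSum_smul]
  have h2 : α * evalSum τ θ + m * evalSum τ (hlog (invW α m c θ)) =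
      evalSum τ (hlog (-invSum α m c G θ)) := by
    rw [h1, mul_inv_cancel_left₀ hα.ne']; ring
  rw [h2, exp_evalSum_hlog hS.weight hB0 hB1 hS.boundSum_le, evalSum_neg,
    invSum_eq_sum hα hS.supp hP hθf,
    evalSum_sum hS.weight S fun e _ => normLe_invTerm hS hP hθf hθ e]
  ring

theorem normLe_invSeries (hc : 0 < c) (hτ : IsWeight τ) (hθ0 : 0 < θ.orderTop)
    (hθ : NormLe τ θ 1) :
    NormLe τ (invSeries α m c θ) (c * τ (expo₂ (1 / α) (m / α)) * Real.exp 1) := by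
  have h := normLe_single hτ (expo₂ (1 / α) (m / α)) c
  rw [abs_of_pos hc] at h
  exact h.mul hτ (hθ.hexp hτ hθ0)

theorem evalSum_invSeries (hτ : IsWeight τ) (hθ0 : 0 < θ.orderTop)
    (hθ : NormLe τ θ 1) : evalSum τ (invSeries α m c θ) =
      c * τ (expo₂ (1 / α) (m / α)) * Real.exp (evalSum τ θ) := by
  rw [invSeries, expForm, evalSum_mul hτ (normLe_single hτ _ c) (hθ.hexp hτ hθ0), evalSum_single,
    evalSum_hexp hτ hθ0 hθ]

/-- The value of the formal inverse of a finite sum is its inverse. -/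
theorem sum_monomialFun_evalSum {a x : ℝ} (hα : 0 < α) (hc : 0 < c) (hx : Admissible x)
    (hS : IsSmall α m c G S (weight 1 x)) (hP : IsGenerating α m G P)
    (hθf : θ.support ⊆ fil P 1) (hfix : invOp α m c G θ = θ)
    (h : ∀ e, ∃ n, ∀ k ≥ n, θ.coeff e = ((invOp α m c G)^[k] 0).coeff e)
    (ha : a * (c ^ α * α ^ (-m)) = 1) :
    a * monomialFun (expo₂ α (-m)) (evalSum (weight 1 x) (invSeries α m c θ)) +
      ∑ e ∈ S, G.coeff e * monomialFun e (evalSum (weight 1 x) (invSeries α m c θ)) = x := by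
  have hτ := hS.weight
  have hθ := normLe_fixedPoint hα hS hP h
  have hθ0 := orderTop_pos_of_fil hP.pos hθf
  have hW0 := orderTop_pos_of_fil hP.pos (support_invW hP c hθf)
  set T := evalSum (weight 1 x) θ with hT
  set Ω := evalSum (weight 1 x) (hlog (invW α m c θ)) with hΩ
  set Y := evalSum (weight 1 x) (invSeries α m c θ) with hYdef
  have hY : Y = x ^ (1 / α) * ell x ^ (m / α) * c * Real.exp T := by
    rw [hYdef, evalSum_invSeries hτ hθ0 hθ, weight, expo₂_at_zero, expo₂_at_one,
      expo₂_mem_depthLe _ _ 2 (by norm_num), Real.rpow_zero, one_mul]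
    ring
  have hx0 := hx.1
  have hℓ := hx.2.1
  have hℓ2 := hx.2.2
  have hY0 : 0 < Y := by rw [hY]; positivity
  have hv : weight 1 x vExp = ell x * (ell (ell x))⁻¹ := by
    simp [weight, vExp, Expo.at_sub, Expo.at_delta, Real.rpow_neg_one]
  have hw : weight 1 x (Expo.delta 1) = ell x := by
    simp [weight, Expo.at_delta]
  have hexpΩ : Real.exp Ω = 1 + (m * (ell x * (ell (ell x))⁻¹) - α * (ell x * (Real.log c + T))) := by
    rw [hΩ, exp_evalSum_hlog hτ hW0 (normLe_invW hτ hθ) hS.boundW_le, evalSum_invW hτ hθ, hv, hw]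
  -- The numerical counterpart of -log y = (1+W)/(αℓ). With it ℓ(Y) is explicit, and the values of
  -- the monomials at Y match the sums of the corresponding formal terms.
  have hlog : -Real.log Y = (α * ell x)⁻¹ * Real.exp Ω := by
    rw [hY, Real.log_mul (by positivity) (by positivity), Real.log_mul (by positivity) hc.ne',
      Real.log_mul (by positivity) (by positivity), Real.log_rpow hx0, Real.log_rpow hℓ,
      Real.log_exp, log_eq_neg_inv_ell x, log_eq_neg_inv_ell (ell x), hexpΩ]
    field_simp
    ring
  have hell : ell Y = α * ell x * Real.exp (-Ω) := by
    rw [ell, hlog, mul_inv, inv_inv, Real.exp_neg]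
  have hmon : ∀ e ∈ depthLe 1, monomialFun e Y = x * ((c ^ e.at 0 * α ^ e.at 1) *
      (weight 1 x (zExp α m e) * Real.exp (e.at 0 * T - e.at 1 * Ω))) := by
    intro e he
    rw [monomialFun_eq (depthLe_mono (by norm_num) he), he 2 (by norm_num), Real.rpow_zero,
      mul_one, hell, hY, Real.mul_rpow (by positivity) (Real.exp_pos _).le,
      Real.mul_rpow (by positivity) hc.le, Real.mul_rpow (by positivity) (by positivity),
      ← Real.rpow_mul hx0.le, ← Real.rpow_mul hℓ.le, Real.mul_rpow (by positivity)
      (Real.exp_pos _).le, Real.mul_rpow hα.le hℓ.le, ← Real.exp_mul, ← Real.exp_mul, weight, zExp,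
      expo₂_at_zero, expo₂_at_one, expo₂_mem_depthLe _ _ 2 (by norm_num), Real.rpow_zero, mul_one,
      one_mul, Real.rpow_sub_one hx0.ne', Real.rpow_add hℓ, sub_eq_add_neg (e.at 0 * T),
      Real.exp_add]
    have h1 : 1 / α * e.at 0 = e.at 0 / α := by ring
    have h2 : m / α * e.at 0 = m * e.at 0 / α := by ring
    have h3 : -Ω * e.at 1 = -(e.at 1 * Ω) := by ring
    rw [h1, h2, h3, mul_comm T]
    field_simp
  have hsum : ∑ e ∈ S, G.coeff e * monomialFun e Y =
      x * ∑ e ∈ S, evalSum (weight 1 x) (invTerm α m c G θ e) := by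
    rw [Finset.mul_sum]
    refine Finset.sum_congr rfl fun e he => ?_
    rw [hmon e (hP.depth ((hS.supp e).1 he)), evalSum_invTerm hS hP hθf hθ]
    ring
  have hz : weight 1 x 0 = 1 := hτ.zero
  rw [hsum, hmon _ (expo₂_mem_depthLe _ _), zExp_leading hα, hz, expo₂_at_zero, expo₂_at_one]
  have := exp_evalSum_fixedPoint hα hS hP hθf hθ hfix
  rw [← hT, ← hΩ] at this
  rw [one_mul, neg_mul, sub_neg_eq_add, this]
  linear_combination x * (1 - ∑ e ∈ S, evalSum (weight 1 x) (invTerm α m c G θ e)) * ha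

/-- All generators have weights tending to 0, and the bounds are finite sums of such weights.
Finiteness of the support of `G` is essential here, which is why convergence is first obtained for
truncations. -/
theorem eventually_isSmall {η : ℝ} (hη : 0 < η) (hP : IsGenerating α m G P)
    (hS : ∀ e, e ∈ S ↔ e ∈ G.support) :
    ∀ᶠ x in 𝓝[>] 0, IsSmall α m c G S (weight η x) := by
  have hd : ∀ e, zExp α m e ∈ depthLe 2 := fun e => depthLe_mono (by norm_num) (expo₂_mem_depthLe _ _)
  have hv : vExp ∈ depthLe 2 := by
    rw [vExp, sub_eq_add_neg]
    exact (depthLe 2).add_mem (delta_mem_depthLe (by norm_num))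
      (neg_mem_depthLe (delta_mem_depthLe (by norm_num)))
  have tW : Tendsto (fun x => boundW α m c (weight η x)) (𝓝[>] 0) (𝓝 0) := by
    have h1 := (tendsto_weight hη hv vExp_pos).const_mul |m|
    have h2 := (((tendsto_weight hη (delta_mem_depthLe (by norm_num))
      (Expo.delta_pos 1)).mul_const (|Real.log c| + 1)).const_mul |α|)
    have := h1.add h2
    simpa only [mul_zero, zero_mul, add_zero, boundW] using this
  have tB : Tendsto (fun x => ∑ e ∈ S, boundTerm α m c G (weight η x) e) (𝓝[>] 0) (𝓝 0) := by
    have : Tendsto (fun x => ∑ e ∈ S, boundTerm α m c G (weight η x) e) (𝓝[>] 0)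
        (𝓝 (∑ e ∈ S, (0 : ℝ))) := by
      refine tendsto_finsetSum S fun e he => ?_
      have h := ((tendsto_weight hη (hd e)
        (mem_Ioi.1 (hP.pos (hP.z_mem e ((hS e).1 he))))).mul_const
        (Real.exp (|e.at 0| + |e.at 1|))).const_mul |G.coeff e * (c ^ e.at 0 * α ^ e.at 1)|
      simpa only [mul_zero, zero_mul, boundTerm] using h
    simpa using this
  have tO : Tendsto (fun x => |α⁻¹| * (2 * ∑ e ∈ S, boundTerm α m c G (weight η x) e +
      |m| * (2 * boundW α m c (weight η x)))) (𝓝[>] 0) (𝓝 0) := by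
    have := ((tB.const_mul 2).add ((tW.const_mul 2).const_mul |m|)).const_mul |α⁻¹|
    simpa only [mul_zero, add_zero] using this
  filter_upwards [eventually_admissible, tW.eventually (eventually_le_nhds (show (0 : ℝ) < 1 / 2 by norm_num)),
    tB.eventually (eventually_le_nhds (show (0 : ℝ) < 1 / 2 by norm_num)),
    tO.eventually (eventually_le_nhds one_pos)] with x h1 h2 h3 h4
  exact ⟨isWeight_weight η h1, hS, h2, h3, h4⟩

end Small

end

noncomputable section

/-! ### The support of the formal inverse of a Dulac series -/

/-- `F` is a Dulac series with leading exponent `(α, -m)` and positive leading coefficient. -/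
structure DulacLead (F : Series) (α : ℝ) (m : ℕ) : Prop where
  series : IsDulacSeries F
  order : F.order = expo₂ α (-(m : ℝ))
  lead_pos : 0 < F.leadingCoeff

/-- The series without its leading term. -/
def tail (F : Series) : Series := F - HahnSeries.single F.order F.leadingCoeff

/-- The part of the series with powers of `x` at most `N`. -/
def truncX (N : ℝ) (F : Series) : Series where
  coeff e := open Classical in if e.at 0 ≤ N then F.coeff e else 0
  isPWO_support' := F.isPWO_support.mono fun e he => by
    by_contra h
    have : F.coeff e = 0 := by simpa using h
    exact he (by simp [this])

theorem coeff_truncX_of_le {N : ℝ} {e : Expo} (F : Series) (h : e.at 0 ≤ N) :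
    (truncX N F).coeff e = F.coeff e := if_pos h

theorem coeff_truncX_of_lt {N : ℝ} {e : Expo} (F : Series) (h : N < e.at 0) :
    (truncX N F).coeff e = 0 := if_neg (not_le.2 h)

theorem support_truncX_subset (N : ℝ) (F : Series) : (truncX N F).support ⊆ F.support := by
  intro e he
  rcases le_or_gt (e.at 0) N with h | h
  · rwa [HahnSeries.mem_support, coeff_truncX_of_le F h] at he
  · exact absurd (coeff_truncX_of_lt F h) he

theorem support_sub_truncX {N : ℝ} {F : Series} {e : Expo} (he : e ∈ (F - truncX N F).support) :
    N < e.at 0 := by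
  by_contra h
  exact he (by rw [HahnSeries.coeff_sub, coeff_truncX_of_le F (not_lt.1 h), sub_self])

theorem le_of_mem_support_truncX {N : ℝ} {F : Series} {e : Expo} (he : e ∈ (truncX N F).support) :
    e.at 0 ≤ N := by
  by_contra h
  exact he (coeff_truncX_of_lt F (not_le.1 h))

theorem coeff_tail_of_ne {F : Series} {e : Expo} (h : e ≠ F.order) :
    (tail F).coeff e = F.coeff e := by
  rw [tail, HahnSeries.coeff_sub, HahnSeries.coeff_single_of_ne h, sub_zero]

theorem coeff_tail_order (F : Series) : (tail F).coeff F.order = 0 := by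
  rw [tail, HahnSeries.coeff_sub, HahnSeries.coeff_single_same, HahnSeries.leadingCoeff_eq, sub_self]

theorem support_tail_subset (F : Series) : (tail F).support ⊆ F.support := by
  intro e he
  by_cases h : e = F.order
  · exact absurd (h ▸ coeff_tail_order F) he
  · rwa [HahnSeries.mem_support, coeff_tail_of_ne h] at he

theorem support_tail_gt {F : Series} : (tail F).support ⊆ Ioi F.order := by
  intro e he
  have h1 : e ≠ F.order := by rintro rfl; exact he (coeff_tail_order F)
  exact mem_Ioi.2 (lt_of_le_of_ne (HahnSeries.order_le_of_coeff_ne_zero (support_tail_subset F he))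
    h1.symm)

namespace DulacLead

variable {F : Series} {α : ℝ} {m : ℕ} (h : DulacLead F α m)
include h

theorem ne_zero : F ≠ 0 := by rintro rfl; simpa using h.lead_pos

theorem order_mem : expo₂ α (-(m : ℝ)) ∈ F.support := by
  rw [← h.order]; exact HahnSeries.coeff_order_eq_zero.not.2 h.ne_zero

theorem α_pos : 0 < α := by
  have := h.series.1.1.2 _ h.order_mem
  rwa [expo₂_at_zero] at this

theorem isLeading : IsLeading 0 F :=
  ⟨h.lead_pos, by simp, by rw [h.order, expo₂_at_zero]; exact h.α_pos⟩

theorem depth : F.support ⊆ depthLe 1 := fun e he => h.series.1.1.1.1 e he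

theorem le_at_zero {e : Expo} (he : e ∈ F.support) : α ≤ e.at 0 := by
  have := Expo.at_zero_mono (HahnSeries.order_le_of_coeff_ne_zero he)
  rwa [h.order, expo₂_at_zero] at this

theorem le_at_one {e : Expo} (he : e ∈ F.support) (h0 : e.at 0 = α) : -(m : ℝ) ≤ e.at 1 := by
  by_contra hlt
  refine absurd (HahnSeries.order_le_of_coeff_ne_zero he) (not_le.2 ?_)
  rw [h.order]
  refine Expo.lt_of_at 1 (fun i hi => ?_) ?_
  · have : i = 0 := by omega
    subst this
    rw [h0, expo₂_at_zero]
  · rw [expo₂_at_one]; exact not_le.1 hlt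

theorem finite_xSupport (N : ℝ) : {r ∈ xSupport F | r ≤ N}.Finite := by
  refine (h.series.1.1.1.2 0 (by norm_num) (fun _ => 0) N).subset ?_
  rintro r ⟨⟨e, he, rfl⟩, hr⟩
  exact ⟨hr, e, he, by simp, rfl⟩

theorem finite_le (N : ℝ) : {e ∈ F.support | e.at 0 ≤ N}.Finite := by
  refine ((h.finite_xSupport N).biUnion fun a _ => h.series.2.2.1 a).subset ?_
  intro e he
  exact mem_biUnion (x := e.at 0) ⟨⟨e, he.1, rfl⟩, he.2⟩ ⟨he.1, rfl⟩

theorem isGenerating (N : ℝ) :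
    IsGenerating α m (truncX N (tail F)) (genSet α m (tail F)) :=
  isGenerating_genSet h.α_pos ((support_tail_subset F).trans h.depth)
    (by rw [← h.order]; exact support_tail_gt) (support_truncX_subset N _)

theorem isGenerating' : IsGenerating α m (tail F) (genSet α m (tail F)) :=
  isGenerating_genSet h.α_pos ((support_tail_subset F).trans h.depth)
    (by rw [← h.order]; exact support_tail_gt) subset_rfl

/-- The powers of the logarithms are controlled by those of `x`. -/
theorem exists_slope (r : ℝ) : ∃ C : ℝ, ∀ e ∈ F.support, e.at 0 - α ≤ r →
    -(m + e.at 1) ≤ C * (e.at 0 - α) := by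
  classical
  set A := (h.finite_le (r + α)).toFinset with hA
  -- Summing the absolute ratios over the finitely many relevant exponents dominates each of them.
  -- At the power α itself the ratio has zero denominator, but there the leading term already gives
  -- the sign.
  refine ⟨∑ e ∈ A, |-(m + e.at 1) / (e.at 0 - α)|, ?_⟩
  intro e he her
  rcases (h.le_at_zero he).eq_or_lt with h0 | h0
  · have := h.le_at_one he h0.symm
    rw [← h0, sub_self, mul_zero]
    linarith
  · have hpos : 0 < e.at 0 - α := sub_pos.2 h0
    have hmem : e ∈ A := by
      rw [hA, Set.Finite.mem_toFinset]; exact ⟨he, by linarith⟩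
    have h1 := Finset.single_le_sum (f := fun e : Expo => |-(m + e.at 1) / (e.at 0 - α)|)
      (fun _ _ => abs_nonneg _) hmem
    calc -(m + e.at 1) = -(m + e.at 1) / (e.at 0 - α) * (e.at 0 - α) := by field_simp
      _ ≤ _ := mul_le_mul_of_nonneg_right ((le_abs_self _).trans h1) hpos.le

end DulacLead

/-- The semigroup generated by the differences `β - α`. -/
def shiftSet (F : Series) (α : ℝ) : AddSubmonoid ℝ :=
  AddSubmonoid.closure ((fun β => β - α) '' xSupport F)

theorem mem_exponentSet {F : Series} {α β : ℝ} : β ∈ exponentSet F α ↔ β - 1 ∈ shiftSet F α := by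
  constructor
  · rintro ⟨r, hr, rfl⟩
    rw [add_sub_cancel_right]
    exact hr
  · intro h
    exact ⟨β - 1, h, by simp⟩

-- The positive generators up to M have a least element δ, so an element up to M is a sum of at most
-- M/δ of them; zero generators do not matter. The sets `T n` contain the sums of at most n such
-- generators.
open scoped Pointwise in
theorem finite_closure_le {S : Set ℝ} (h0 : ∀ s ∈ S, 0 ≤ s) (hS : ∀ M : ℝ, {s ∈ S | s ≤ M}.Finite)
    (M : ℝ) : {x ∈ (AddSubmonoid.closure S : Set ℝ) | x ≤ M}.Finite := by
  set S₁ := {s ∈ S | s ≤ M} ∩ Ioi 0 with hS₁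
  have hfin : S₁.Finite := (hS M).subset inter_subset_left
  obtain ⟨δ, hδ, hmin⟩ : ∃ δ > 0, ∀ s ∈ S₁, δ ≤ s := by
    rcases S₁.eq_empty_or_nonempty with h | h
    · exact ⟨1, one_pos, by simp [h]⟩
    · obtain ⟨s, hs, hle⟩ := Set.exists_min_image S₁ id hfin h
      exact ⟨s, hs.2, hle⟩
  set T : ℕ → Set ℝ := fun n => Nat.rec {0} (fun _ t => t ∪ (S₁ + t)) n with hT
  have hTs : ∀ n, T (n + 1) = T n ∪ (S₁ + T n) := fun n => rfl
  have hTfin : ∀ n, (T n).Finite := by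
    intro n
    induction n with
    | zero => exact finite_singleton 0
    | succ n ih => rw [hTs]; exact ih.union (hfin.add ih)
  have hTmono : ∀ n k, n ≤ k → T n ⊆ T k := by
    intro n k hnk
    induction k, hnk using Nat.le_induction with
    | base => exact subset_rfl
    | succ k _ ih => rw [hTs]; exact ih.trans subset_union_left
  have hnn : ∀ x ∈ AddSubmonoid.closure S, 0 ≤ x := by
    intro x hx
    induction hx using AddSubmonoid.closure_induction with
    | mem x hx => exact h0 x hx
    | zero => exact le_rfl
    | add x y _ _ hx hy => exact add_nonneg hx hy
  have key : ∀ x ∈ AddSubmonoid.closure S, x ≤ M → ∃ n : ℕ, x ∈ T n ∧ n * δ ≤ x := by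
    intro x hx
    induction hx using AddSubmonoid.closure_induction_left with
    | zero => exact fun _ => ⟨0, rfl, by simp⟩
    | add_left s hs x hx ih =>
      intro hle
      have hs0 := h0 s hs
      have hx0 := hnn x hx
      obtain ⟨n, hn, hnx⟩ := ih (by linarith)
      rcases hs0.eq_or_lt with h | h
      · exact ⟨n, by rwa [← h, zero_add], by linarith⟩
      · have hs1 : s ∈ S₁ := ⟨⟨hs, by linarith⟩, h⟩
        refine ⟨n + 1, Or.inr (Set.add_mem_add hs1 hn), ?_⟩
        have := hmin s hs1
        push_cast
        linarith
  refine (hTfin ⌊M / δ⌋₊).subset ?_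
  rintro x ⟨hx, hxM⟩
  obtain ⟨n, hn, hnx⟩ := key x hx hxM
  refine hTmono n _ (Nat.le_floor ?_) hn
  rw [le_div_iff₀ hδ]
  linarith

/-! ### The exponents generated by the equation and the support of the formal inverse -/

namespace DulacLead

variable {F : Series} {α : ℝ} {m : ℕ} (h : DulacLead F α m)
include h

theorem shiftSet_nonneg {s : ℝ} (hs : s ∈ shiftSet F α) : 0 ≤ s := by
  induction hs using AddSubmonoid.closure_induction with
  | mem x hx =>
    obtain ⟨_, ⟨e, he, rfl⟩, rfl⟩ := hx
    exact sub_nonneg.2 (h.le_at_zero he)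
  | zero => exact le_rfl
  | add x y _ _ hx hy => exact add_nonneg hx hy

theorem finite_shiftSet (M : ℝ) : {s ∈ (shiftSet F α : Set ℝ) | s ≤ M}.Finite := by
  refine finite_closure_le ?_ (fun M => ?_) M
  · rintro _ ⟨_, ⟨e, he, rfl⟩, rfl⟩
    exact sub_nonneg.2 (h.le_at_zero he)
  · refine ((h.finite_xSupport (M + α)).image fun β => β - α).subset ?_
    rintro _ ⟨⟨β, hβ, rfl⟩, hM⟩
    exact ⟨β, ⟨hβ, by simpa [sub_le_iff_le_add] using hM⟩, rfl⟩

theorem finite_exponentSet (M : ℝ) : {β ∈ exponentSet F α | β ≤ M}.Finite := by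
  refine ((h.finite_shiftSet (M - 1)).image fun r => r + 1).subset ?_
  rintro β ⟨hβ, hM⟩
  exact ⟨β - 1, ⟨mem_exponentSet.1 hβ, by linarith⟩, by simp⟩

theorem one_le_of_mem {β : ℝ} (hβ : β ∈ exponentSet F α) : 1 ≤ β := by
  have := h.shiftSet_nonneg (mem_exponentSet.1 hβ)
  linarith

/-- The form of the exponents generated by the equation. -/
theorem form_filZero {r C : ℝ} (hC : ∀ e ∈ F.support, e.at 0 - α ≤ r →
    -(m + e.at 1) ≤ C * (e.at 0 - α)) {e : Expo} (he : e ∈ filZero (genSet α m (tail F))) :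
    e ∈ depthLe 2 ∧ ∃ s ∈ shiftSet F α, ∃ (k : ℤ) (a : ℕ), e.at 0 = s / α ∧
      e.at 1 = m * s / α + k ∧ e.at 2 = -a ∧ (s ≤ r → a - C * s ≤ k) := by
  have hα := h.α_pos
  obtain ⟨l, -, hl, rfl⟩ := mem_fil.1 he
  clear he
  induction l using Multiset.induction_on with
  | empty =>
    refine ⟨(depthLe 2).zero_mem, 0, AddSubmonoid.zero_mem _, 0, 0, ?_⟩
    simp [Expo.at_zero]
  | cons g l ih =>
    obtain ⟨hd, s, hs, k, a, h0, h1, h2, hle⟩ := ih fun b hb => hl b (Multiset.mem_cons_of_mem hb)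
    have hg := hl g (Multiset.mem_cons_self g l)
    have hs0 := h.shiftSet_nonneg hs
    rw [Multiset.sum_cons]
    simp only [Expo.at_add, h0, h1, h2]
    -- A factor ℓ/ℓ₂ raises both k and a by one, a factor ℓ raises only k, and a tail monomial
    -- raises s by e₀ - α and k by m + e₁, which is at least -C(e₀ - α). Hence a - C s ≤ k is
    -- preserved.
    rcases hg with (rfl | rfl) | ⟨e, he, rfl⟩
    · refine ⟨(depthLe 2).add_mem ?_ hd, s, hs, k + 1, a + 1, ?_, ?_, ?_, fun hr => ?_⟩
      · rw [vExp, sub_eq_add_neg]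
        exact (depthLe 2).add_mem (delta_mem_depthLe (by norm_num))
          (neg_mem_depthLe (delta_mem_depthLe (by norm_num)))
      · simp [vExp, Expo.at_sub, Expo.at_delta]
      · simp [vExp, Expo.at_sub, Expo.at_delta]; ring
      · simp [vExp, Expo.at_sub, Expo.at_delta]
      · push_cast; linarith [hle hr]
    · refine ⟨(depthLe 2).add_mem (delta_mem_depthLe (by norm_num)) hd, s, hs, k + 1, a, ?_, ?_, ?_,
        fun hr => ?_⟩
      · simp [Expo.at_delta]
      · simp [Expo.at_delta]; ring
      · simp [Expo.at_delta]
      · push_cast; linarith [hle hr]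
    · have heF := support_tail_subset F he
      obtain ⟨n, hn⟩ := h.series.1.2 e heF
      have hes : e.at 0 - α ∈ shiftSet F α :=
        AddSubmonoid.subset_closure ⟨e.at 0, ⟨e, heF, rfl⟩, rfl⟩
      have hd1 := expo₂_mem_depthLe (e.at 0 / α - 1) (m * e.at 0 / α + e.at 1)
      refine ⟨(depthLe 2).add_mem (depthLe_mono (by norm_num) hd1) hd, e.at 0 - α + s,
        AddSubmonoid.add_mem _ hes hs, m + n + k, a, ?_, ?_, ?_, fun hr => ?_⟩
      · rw [zExp, expo₂_at_zero]; field_simp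
      · rw [zExp, expo₂_at_one, hn]
        push_cast
        field_simp
        ring
      · rw [zExp, hd1 2 (by norm_num), zero_add]
      · have := h.shiftSet_nonneg hes
        have h3 := hC e heF (by linarith)
        have h4 := hle (by linarith)
        push_cast
        rw [hn] at h3
        linarith

/-- The exponents of the formal inverse are of this form. -/
def invExpoSet (F : Series) (α m : ℝ) : Set Expo :=
  {e | ∃ q ∈ filZero (genSet α m (tail F)), expo₂ (1 / α) (m / α) + q = e}

/-- For s = β - 1 the power of ℓ may drop by at most C s, with C depending on s. Rounding this up
gives `M β`, and K = k + M β is then a natural number not smaller than the power a of 1/ℓ₂. -/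
theorem exists_form : ∃ M : ℝ → ℕ, ∀ e ∈ invExpoSet F α m, e ∈ depthLe 2 ∧
    ∃ β ∈ exponentSet F α, e.at 0 = β / α ∧ ∃ K a : ℕ, a ≤ K ∧
      e.at 1 = -(M β : ℝ) + m * β / α + K ∧ e.at 2 = -a := by
  have hα := h.α_pos
  choose C hC using h.exists_slope
  refine ⟨fun β => ⌈C (β - 1) * (β - 1)⌉₊, ?_⟩
  rintro _ ⟨q, hq, rfl⟩
  -- The first application serves only to learn s; the second uses the slope valid up to r = s,
  -- which is needed for the inequality.
  obtain ⟨hd, s, hs, k, a, h0, h1, h2, -⟩ := h.form_filZero (hC 0) hq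
  obtain ⟨-, s', hs', k', a', h0', h1', h2', hle⟩ := h.form_filZero (hC s) hq
  have hss : s' = s := by
    have := h0'.symm.trans h0
    field_simp at this
    exact this
  subst hss
  have hle' := hle le_rfl
  have hed := expo₂_mem_depthLe (1 / α) (m / α)
  refine ⟨(depthLe 2).add_mem (depthLe_mono (by norm_num) hed) hd, s' + 1, ⟨s', hs', rfl⟩, ?_, ?_⟩
  · rw [Expo.at_add, expo₂_at_zero, h0]; ring
  · simp only [add_sub_cancel_right]
    have hM := Nat.le_ceil (C s' * s')
    set M := ⌈C s' * s'⌉₊ with hMdef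
    have hK : (a' : ℤ) ≤ k' + M := by
      have : (a' : ℝ) ≤ k' + M := by linarith
      exact_mod_cast this
    obtain ⟨K, hK'⟩ := Int.eq_ofNat_of_zero_le (show 0 ≤ k' + (M : ℤ) by omega)
    refine ⟨K, a', by omega, ?_, ?_⟩
    · have : (K : ℝ) = k' + M := by exact_mod_cast hK'.symm
      rw [Expo.at_add, expo₂_at_one, h1', this]
      field_simp
      ring
    · rw [Expo.at_add, hed 2 (by norm_num), h2', zero_add]

/-- Finiteness at each level comes from the form of the exponents: finitely many β below a bound,
then natural numbers K below a bound, then a ≤ K. -/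
theorem isInfTransseries_of_support {y : Series} (hy : y.support ⊆ invExpoSet F α m) :
    IsInfTransseries 2 y := by
  have hα := h.α_pos
  obtain ⟨M, hM⟩ := h.exists_form
  refine ⟨⟨fun e he => (hM e (hy he)).1, ?_⟩, ?_⟩
  · intro k hk p B
    interval_cases k
    · refine ((h.finite_exponentSet (B * α)).image fun β => β / α).subset ?_
      rintro r ⟨hr, e, he, -, rfl⟩
      obtain ⟨-, β, hβ, h0, -⟩ := hM e (hy he)
      refine ⟨β, ⟨hβ, ?_⟩, h0.symm⟩
      rw [h0, div_le_iff₀ hα] at hr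
      exact hr
    · set γ := -(M (p 0 * α) : ℝ) + m * (p 0 * α) / α with hγ
      refine ((Set.finite_Iic ⌊B - γ⌋₊).image fun K : ℕ => γ + (K : ℝ)).subset ?_
      rintro r ⟨hr, e, he, hp, rfl⟩
      obtain ⟨-, β, hβ, h0, K, a, -, h1, -⟩ := hM e (hy he)
      have hβp : β = p 0 * α := by
        rw [← hp 0 (by norm_num), h0]; field_simp
      rw [hβp, ← hγ] at h1
      refine ⟨K, mem_Iic.2 (Nat.le_floor ?_), h1.symm⟩
      rw [h1] at hr
      linarith
    · set γ := -(M (p 0 * α) : ℝ) + m * (p 0 * α) / α with hγ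
      refine ((Set.finite_Iic ⌊p 1 - γ⌋₊).image fun a : ℕ => -(a : ℝ)).subset ?_
      rintro r ⟨hr, e, he, hp, rfl⟩
      obtain ⟨-, β, hβ, h0, K, a, haK, h1, h2⟩ := hM e (hy he)
      have hβp : β = p 0 * α := by
        rw [← hp 0 (by norm_num), h0]; field_simp
      rw [hβp, ← hγ, hp 1 (by norm_num)] at h1
      refine ⟨a, mem_Iic.2 (haK.trans (Nat.le_floor ?_)), h2.symm⟩
      linarith
  · intro e he
    obtain ⟨-, β, hβ, h0, -⟩ := hM e (hy he)
    rw [h0]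
    exact div_pos (by linarith [h.one_le_of_mem hβ]) hα

theorem xSupport_of_support {y : Series} (hy : y.support ⊆ invExpoSet F α m) :
    xSupport y ⊆ (fun β => β / α) '' exponentSet F α := by
  obtain ⟨M, hM⟩ := h.exists_form
  rintro _ ⟨e, he, rfl⟩
  obtain ⟨-, β, hβ, h0, -⟩ := hM e (hy he)
  exact ⟨β, hβ, h0.symm⟩

theorem support_invSeries {θ : Series} (c : ℝ) (hθ : θ.support ⊆ fil (genSet α m (tail F)) 1) :
    (invSeries α m c θ).support ⊆ invExpoSet F α m := by
  intro e he
  obtain ⟨a, ha, b, hb, rfl⟩ := HahnSeries.support_mul_subset he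
  rw [mem_singleton_iff.1 (HahnSeries.support_single_subset ha)]
  exact ⟨b, support_hexp_fil h.isGenerating'.pos hθ hb, rfl⟩

theorem filZero_at_zero_nonneg {q : Expo} (hq : q ∈ filZero (genSet α m (tail F))) :
    0 ≤ q.at 0 := by
  obtain ⟨C, hC⟩ := h.exists_slope 0
  obtain ⟨-, s, hs, k, a, h0, -⟩ := h.form_filZero hC hq
  rw [h0]
  exact div_nonneg (h.shiftSet_nonneg hs) h.α_pos.le

/-- The formal inverses of the truncations approximate the formal inverse. -/
theorem support_invSeries_sub {θ θ' : Series} {c N : ℝ}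
    (hθf : θ.support ⊆ fil (genSet α m (tail F)) 1)
    (hθf' : θ'.support ⊆ fil (genSet α m (tail F)) 1)
    (hθ : ∀ e, ∃ n, ∀ k ≥ n, θ.coeff e = ((invOp α m c (tail F))^[k] 0).coeff e)
    (hθ' : ∀ e, ∃ n, ∀ k ≥ n, θ'.coeff e = ((invOp α m c (truncX N (tail F)))^[k] 0).coeff e) 
    {e : Expo} (he : e ∈ (invSeries α m c θ - invSeries α m c θ').support) :
    N / α - 1 < e.at 0 := by
  have hα := h.α_pos
  -- `zExp` sends x^{e₀} to the power e₀/α - 1, so terms removed beyond N land in J. The set absorbs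
  -- the generated monoid because all its elements have nonnegative powers of x.
  set J : Set Expo := {e | N / α - 1 < e.at 0} with hJdef
  have hJ : ∀ a ∈ J, ∀ b ∈ filZero (genSet α m (tail F)), a + b ∈ J := by
    intro a ha b hb
    have h1 := h.filZero_at_zero_nonneg hb
    have h2 : N / α - 1 < a.at 0 := ha
    change N / α - 1 < (a + b).at 0
    rw [Expo.at_add]
    linarith
  have hd : (θ - θ').support ⊆ J := by
    intro e he
    by_contra hne
    obtain ⟨n, hn⟩ := hθ e
    obtain ⟨n', hn'⟩ := hθ' e
    refine hne (support_invOp_iterate_sub hα h.isGenerating' (h.isGenerating N) c hJ ?_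
      (max n n') ?_)
    · intro e he
      change N / α - 1 < (zExp α m e).at 0
      rw [zExp, expo₂_at_zero]
      have := div_lt_div_of_pos_right (support_sub_truncX he) hα
      linarith
    · rw [HahnSeries.mem_support, HahnSeries.coeff_sub, ← hn _ (le_max_left _ _),
        ← hn' _ (le_max_right _ _), ← HahnSeries.coeff_sub]
      exact he
  have h1 : (hexp θ - hexp θ').support ⊆ J :=
    support_heval_sub_subset (orderTop_pos_of_fil h.isGenerating'.pos hθf)
      (orderTop_pos_of_fil h.isGenerating'.pos hθf') _ hJ
      (hθf.trans (fil_subset_filZero _ 1)) (hθf'.trans (fil_subset_filZero _ 1)) hd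
  have h2 : invSeries α m c θ - invSeries α m c θ' =
      HahnSeries.single (expo₂ (1 / α) (m / α)) c * (hexp θ - hexp θ') := by
    rw [invSeries, invSeries, expForm, expForm]; ring
  rw [h2] at he
  obtain ⟨a, ha, b, hb, rfl⟩ := HahnSeries.support_mul_subset he
  have h3 : N / α - 1 < b.at 0 := h1 hb
  rw [mem_singleton_iff.1 (HahnSeries.support_single_subset ha), Expo.at_add, expo₂_at_zero]
  have : 0 < 1 / α := by positivity
  linarith

end DulacLead

end

noncomputable section

/-! ### Sums over blocks -/

theorem isLittleO_rpow_rpow {a b : ℝ} (h : a < b) :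
    (fun x : ℝ => x ^ b) =o[𝓝[>] 0] fun x => x ^ a := by
  have h0 : Tendsto (fun x : ℝ => x ^ (b - a)) (𝓝[>] 0) (𝓝 0) := by
    have := (Real.continuousAt_rpow_const 0 (b - a) (Or.inr (sub_pos.2 h).le)).tendsto
    rw [Real.zero_rpow (sub_pos.2 h).ne'] at this
    exact this.mono_left nhdsWithin_le_nhds
  refine IsLittleO.congr' (((isLittleO_one_iff ℝ).2 h0).mul_isBigO
    (isBigO_refl (fun x : ℝ => x ^ a) _)) ?_ (by simp)
  filter_upwards [self_mem_nhdsWithin] with x hx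
  rw [← Real.rpow_add hx, sub_add_cancel]

theorem analyticAt_rpow {x : ℝ} (hx : 0 < x) (r : ℝ) : AnalyticAt ℝ (fun y : ℝ => y ^ r) x := by
  have h : AnalyticAt ℝ (fun y : ℝ => Real.exp (Real.log y * r)) x :=
    ((analyticAt_log hx).mul analyticAt_const).rexp
  refine h.congr ?_
  filter_upwards [lt_mem_nhds hx] with y hy
  rw [Real.rpow_def_of_pos hy]

theorem consExpo_at_zero (a : ℝ) (e : Expo) : (consExpo a e).at 0 = a := consExpo_zero a e

theorem consExpo_at_succ (a : ℝ) (e : Expo) (i : ℕ) : (consExpo a e).at (i + 1) = e.at i :=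
  consExpo_succ a e i

theorem coeff_block (a : ℝ) (F : Series) (e : Expo) :
    (block a F).coeff e = F.coeff (consExpo a e) := rfl

theorem consExpo_mem_depthLe {a : ℝ} {e : Expo} {k : ℕ} (h : consExpo a e ∈ depthLe (k + 1)) :
    e ∈ depthLe k := fun i hi => by
  rw [← consExpo_at_succ a e i]
  exact h (i + 1) (by omega)

theorem support_block_depth {a : ℝ} {F : Series} {k : ℕ} (hF : F.support ⊆ depthLe (k + 1)) :
    (block a F).support ⊆ depthLe k := fun _ he => consExpo_mem_depthLe (hF he)

theorem exists_consExpo (e : Expo) : ∃ e', e = consExpo (e.at 0) e' := by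
  refine ⟨toLex ((ofLex e).comapDomain Nat.succ Nat.succ_injective.injOn), Expo.ext' fun i => ?_⟩
  cases i with
  | zero => rw [consExpo_at_zero]
  | succ i => rw [consExpo_at_succ]; rfl

theorem block_eq_zero_of_notMem {a : ℝ} {F : Series} (h : a ∉ xSupport F) : block a F = 0 := by
  ext e
  by_contra hne
  exact h ⟨consExpo a e, hne, consExpo_at_zero a e⟩

theorem weight_consExpo {a x : ℝ} {e : Expo} (h : consExpo a e ∈ depthLe 2) (η : ℝ) :
    weight η x (consExpo a e) = x ^ (η * a) * monomialFun e (ell x) := by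
  rw [monomialFun_eq (depthLe_mono (by norm_num) (consExpo_mem_depthLe h)),
    consExpo_mem_depthLe h 2 (by norm_num), Real.rpow_zero, weight, consExpo_at_zero,
    consExpo_at_succ a e 0, consExpo_at_succ a e 1]
  ring

section Split

variable {F : Series}

open Classical in
theorem tsum_block (hF : F.support ⊆ depthLe 2) (x a : ℝ) :
    ∑' e : Expo, (if e.at 0 = a then F.coeff e * weight 1 x e else 0) =
      sumFun (block a F) (ell x) * x ^ a := by
  have hinj : Function.Injective (consExpo a) := (consExpo_strictMono a).injective
  rw [sumFun, ← tsum_mul_right, ← hinj.tsum_eq]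
  · refine tsum_congr fun e => ?_
    rw [if_pos (consExpo_at_zero a e), coeff_block]
    by_cases h : F.coeff (consExpo a e) = 0
    · rw [h]; ring
    · rw [weight_consExpo (hF h), one_mul]; ring
  · intro e he
    have h0 : e.at 0 = a := by
      by_contra h; exact he (if_neg h)
    obtain ⟨e', he'⟩ := exists_consExpo e
    exact ⟨e', by rw [he', h0]⟩

theorem summable_block (hF : F.support ⊆ depthLe 2) {x : ℝ} (hx : 0 < x)
    (hs : Summable fun e => |F.coeff e| * weight 1 x e) (a : ℝ) :
    Summable fun e => |(block a F).coeff e| * monomialFun e (ell x) := by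
  have hinj : Function.Injective (consExpo a) := (consExpo_strictMono a).injective
  have h1 := (hs.comp_injective hinj).mul_right (x ^ (-a))
  refine h1.congr fun e => ?_
  rw [coeff_block, Function.comp_apply]
  by_cases h : F.coeff (consExpo a e) = 0
  · rw [h]; simp
  · rw [weight_consExpo (hF h), one_mul, Real.rpow_neg hx.le]
    have := (Real.rpow_pos_of_pos hx a).ne'
    field_simp

open Classical in
/-- Splitting off finitely many blocks of a convergent series. -/
theorem evalSum_sub_blocks (hF : F.support ⊆ depthLe 2) {x : ℝ}
    (hs : Summable fun e => F.coeff e * weight 1 x e) {M : ℝ}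
    (hfin : {a ∈ xSupport F | a ≤ M}.Finite) :
    evalSum (weight 1 x) F - ∑ a ∈ hfin.toFinset, sumFun (block a F) (ell x) * x ^ a =
      ∑' e : Expo, if M < e.at 0 then F.coeff e * weight 1 x e else 0 := by
  have hind : ∀ p : Expo → Prop, Summable fun e => if p e then F.coeff e * weight 1 x e else 0 := by
    intro p
    refine Summable.of_norm_bounded hs.norm fun e => ?_
    split_ifs
    · exact le_rfl
    · rw [norm_zero]; exact norm_nonneg _
  have h1 : ∑ a ∈ hfin.toFinset, sumFun (block a F) (ell x) * x ^ a =
      ∑' e : Expo, ∑ a ∈ hfin.toFinset, if e.at 0 = a then F.coeff e * weight 1 x e else 0 := by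
    rw [Summable.tsum_finsetSum fun a _ => hind fun e => e.at 0 = a]
    exact Finset.sum_congr rfl fun a _ => (tsum_block hF x a).symm
  rw [h1, evalSum, ← hs.tsum_sub (summable_sum fun a _ => hind fun e => e.at 0 = a)]
  refine tsum_congr fun e => ?_
  rw [Finset.sum_ite_eq]
  by_cases he : F.coeff e = 0
  · simp [he]
  · rcases lt_or_ge M (e.at 0) with h | h
    · rw [if_pos h, if_neg, sub_zero]
      rw [Finite.mem_toFinset]
      exact fun h' => absurd h'.2 (not_le.2 h)
    · rw [if_neg (not_lt.2 h), if_pos, sub_self]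
      rw [Finite.mem_toFinset]
      exact ⟨⟨e, he, rfl⟩, h⟩

-- Absolute convergence alone does not make the tail o(x^M), because infinitely many powers occur in
-- it. Writing x^{e₀} = x^{η e₀} x^{(1-η)e₀}, the second factor is at most x^{(1-η)(M+δ)} beyond the
-- gap, and the first is summed by the norm bound. The tail is therefore O(x^{(1-η)(M+δ)+ηκ}), and
-- this exponent exceeds M for small η.
open Classical in
theorem isLittleO_tail {κ M δ : ℝ} (hδ : 0 < δ)
    (hgap : ∀ a ∈ xSupport F, M < a → M + δ ≤ a)
    (hκ : ∀ η : ℝ, 0 < η → η < 1 → ∃ B : ℝ, ∀ᶠ x in 𝓝[>] 0, NormLe (weight η x) F (B * x ^ (η * κ))) :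
    (fun x => ∑' e : Expo, if M < e.at 0 then F.coeff e * weight 1 x e else 0)
      =o[𝓝[>] 0] fun x => x ^ M := by
  set L := |M + δ - κ| + 1 with hL
  have hL0 : 0 < L := by positivity
  -- This choice gives η(M + δ - κ) ≤ δ/2, so half of the gap remains; adding 1 in L avoids division
  -- by zero.
  set η := min (1 / 2) (δ / (2 * L)) with hηdef
  have hη0 : 0 < η := lt_min (by norm_num) (by positivity)
  have hη1 : η < 1 := (min_le_left _ _).trans_lt (by norm_num)
  have hηL : η * (M + δ - κ) ≤ δ / 2 := by
    calc η * (M + δ - κ) ≤ η * L := mul_le_mul_of_nonneg_left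
          ((le_abs_self _).trans (by rw [hL]; linarith)) hη0.le
      _ ≤ δ / (2 * L) * L := mul_le_mul_of_nonneg_right (min_le_right _ _) hL0.le
      _ = δ / 2 := by field_simp
  obtain ⟨B, hB⟩ := hκ η hη0 hη1
  have hexp : M < (1 - η) * (M + δ) + η * κ := by nlinarith
  refine IsBigO.trans_isLittleO (IsBigO.of_bound |B| ?_) (isLittleO_rpow_rpow hexp)
  filter_upwards [hB, eventually_admissible, Ioo_mem_nhdsGT one_pos] with x hBx hx hx1
  have hw := isWeight_weight η hx
  have hx0 := hx.1
  have hterm : ∀ e : Expo, ‖if M < e.at 0 then F.coeff e * weight 1 x e else 0‖ ≤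
      |F.coeff e| * weight η x e * x ^ ((1 - η) * (M + δ)) := by
    intro e
    have hpos := (hw.pos e).le
    by_cases he : F.coeff e = 0
    · simp [he]
    split_ifs with h
    · have h1 : weight 1 x e = weight η x e * x ^ ((1 - η) * e.at 0) := by
        have h2 : x ^ (1 * e.at 0) = x ^ (η * e.at 0) * x ^ ((1 - η) * e.at 0) := by
          rw [← Real.rpow_add hx0]; congr 1; ring
        rw [weight, h2, weight]; ring
      rw [h1, norm_mul, Real.norm_eq_abs, Real.norm_eq_abs, abs_of_nonneg
        (mul_nonneg hpos (Real.rpow_nonneg hx0.le _)), mul_assoc]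
      refine mul_le_mul_of_nonneg_left (mul_le_mul_of_nonneg_left ?_ hpos) (abs_nonneg _)
      refine Real.rpow_le_rpow_of_exponent_ge hx0 hx1.2.le ?_
      exact mul_le_mul_of_nonneg_left (hgap _ ⟨e, he, rfl⟩ h) (by linarith)
    · rw [norm_zero]
      positivity
  have hsum := hBx.summable hw
  have h1 := tsum_of_norm_bounded (hsum.mul_right (x ^ ((1 - η) * (M + δ)))).hasSum hterm
  refine h1.trans ?_
  rw [tsum_mul_right, Real.norm_eq_abs, abs_of_pos (Real.rpow_pos_of_pos hx0 _),
    Real.rpow_add hx0, mul_left_comm, mul_comm]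
  refine mul_le_mul_of_nonneg_left ?_ (Real.rpow_nonneg hx0.le _)
  refine (Real.tsum_le_of_sum_le (fun e => mul_nonneg (abs_nonneg _) (hw.pos e).le) hBx).trans ?_
  exact mul_le_mul_of_nonneg_right (le_abs_self B) (Real.rpow_nonneg hx0.le _)

end Split

/-! ### Laurent blocks -/

theorem tendsto_div_ell_of_pos {η : ℝ} (hη : 0 < η) :
    Tendsto (fun y : ℝ => y ^ η / ell y) (𝓝[>] 0) (𝓝 0) := by
  have hd : Expo.delta 0 - Expo.delta 1 ∈ depthLe 2 := by
    rw [sub_eq_add_neg]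
    exact (depthLe 2).add_mem (delta_mem_depthLe (by norm_num))
      (neg_mem_depthLe (delta_mem_depthLe (by norm_num)))
  have hp : 0 < Expo.delta 0 - Expo.delta 1 := by
    refine Expo.lt_of_at 0 (by simp) ?_
    simp [Expo.at_zero, Expo.at_sub, Expo.at_delta]
  refine (tendsto_weight hη hd hp).congr fun y => ?_
  simp [weight, Expo.at_sub, Expo.at_delta, Real.rpow_neg_one, div_eq_mul_inv]

/-- The sum of a power series in two variables. -/
def taylorSum (c : ℕ → ℕ → ℝ) (u v : ℝ) : ℝ := ∑' p : ℕ × ℕ, c p.1 p.2 * u ^ p.1 * v ^ p.2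

/-- The exponent of `y^{γ+k} ℓ^{i-k}`. -/
def laurentExpo (γ : ℝ) (p : ℕ × ℕ) : Expo := expo₂ (γ + p.2) ((p.1 : ℝ) - p.2)

theorem laurentExpo_injective (γ : ℝ) : Function.Injective (laurentExpo γ) := by
  rintro ⟨i, k⟩ ⟨i', k'⟩ h
  have h0 : γ + (k : ℝ) = γ + k' := by
    have := congrArg (fun e : Expo => e.at 0) h
    simpa only [laurentExpo, expo₂_at_zero] using this
  have h1 : (i : ℝ) - k = i' - k' := by
    have := congrArg (fun e : Expo => e.at 1) h
    simpa only [laurentExpo, expo₂_at_one] using this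
  have hk : (k : ℝ) = k' := by linarith
  have hi : (i : ℝ) = i' := by linarith
  rw [Nat.cast_inj] at hk hi
  rw [hk, hi]

theorem weight_laurentExpo {η γ y : ℝ} (h0 : 0 < y) (h1 : 0 < ell y) (p : ℕ × ℕ) :
    weight η y (laurentExpo γ p) = y ^ (η * γ) * (ell y ^ p.1 * (y ^ η / ell y) ^ p.2) := by
  rw [weight, laurentExpo, expo₂_at_zero, expo₂_at_one, expo₂_mem_depthLe _ _ 2 (by norm_num),
    Real.rpow_zero, mul_one, mul_add, Real.rpow_add h0, Real.rpow_sub h1, Real.rpow_natCast,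
    Real.rpow_natCast, Real.rpow_mul h0.le η p.2, Real.rpow_natCast, div_pow]
  ring

theorem monomialFun_laurentExpo {γ y : ℝ} (h0 : 0 < y) (h1 : 0 < ell y) (p : ℕ × ℕ) :
    monomialFun (laurentExpo γ p) y = y ^ γ * (ell y ^ p.1 * (y / ell y) ^ p.2) := by
  rw [monomialFun_eq_weight (e := laurentExpo γ p)
    (depthLe_mono (by norm_num) (expo₂_mem_depthLe _ _)), weight_laurentExpo h0 h1, one_mul, Real.rpow_one]

section LaurentBlock

variable {F : Series} {γ : ℝ} {c : ℕ → ℕ → ℝ}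

theorem IsLaurentBlock.depth (hF : IsLaurentBlock F γ c) : F.support ⊆ depthLe 1 := by
  intro e he
  obtain ⟨i, k, rfl⟩ := hF.2 e he
  exact expo₂_mem_depthLe _ _

theorem IsLaurentBlock.coeff (hF : IsLaurentBlock F γ c) (p : ℕ × ℕ) :
    F.coeff (laurentExpo γ p) = c p.1 p.2 := hF.1 p.1 p.2

theorem IsLaurentBlock.support_subset_range (hF : IsLaurentBlock F γ c) :
    F.support ⊆ range (laurentExpo γ) := by
  intro e he
  obtain ⟨i, k, rfl⟩ := hF.2 e he
  exact ⟨(i, k), rfl⟩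

/-- Absolute convergence at a single y is absolute convergence of the double series at the positive
point (ℓ(y), y/ℓ(y)), hence on the bidisc whose radius is the smaller coordinate. -/
theorem IsLaurentBlock.exists_summable (hF : IsLaurentBlock F γ c) (hc : IsConvergent F) :
    ∃ r : ℝ, 0 < r ∧ Summable fun p : ℕ × ℕ => |c p.1 p.2| * (r ^ p.1 * r ^ p.2) := by
  obtain ⟨d, hd, hconv⟩ := hc
  set y := min d 1 / 2 with hy
  have hy0 : 0 < y := by rw [hy]; positivity
  have hyd : y < d := (half_lt_self (by positivity)).trans_le (min_le_left _ _)
  have hy1 : y < 1 := (half_lt_self (by positivity)).trans_le (min_le_right _ _)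
  have hℓ := ell_pos hy0 hy1
  have hv : 0 < y / ell y := div_pos hy0 hℓ
  have h1 := ((hconv y ⟨hy0, hyd⟩).comp_injective (laurentExpo_injective γ)).mul_left (y ^ (-γ))
  refine ⟨min (ell y) (y / ell y), lt_min hℓ hv, Summable.of_nonneg_of_le
    (fun p => by positivity) (fun p => ?_) h1⟩
  rw [Function.comp_apply, hF.coeff, monomialFun_laurentExpo hy0 hℓ, abs_mul, abs_of_pos
    (show 0 < y ^ γ * (ell y ^ p.1 * (y / ell y) ^ p.2) by positivity), Real.rpow_neg hy0.le]
  have : (y ^ γ)⁻¹ * (|c p.1 p.2| * (y ^ γ * (ell y ^ p.1 * (y / ell y) ^ p.2))) =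
      |c p.1 p.2| * (ell y ^ p.1 * (y / ell y) ^ p.2) := by
    have := (Real.rpow_pos_of_pos hy0 γ).ne'
    field_simp
  rw [this]
  gcongr
  · exact min_le_left _ _
  · exact min_le_right _ _

variable {r : ℝ}

theorem summable_taylor (hr : Summable fun p : ℕ × ℕ => |c p.1 p.2| * (r ^ p.1 * r ^ p.2))
    {u v : ℝ} (hu : |u| ≤ r) (hv : |v| ≤ r) :
    Summable fun p : ℕ × ℕ => c p.1 p.2 * u ^ p.1 * v ^ p.2 := by
  refine Summable.of_norm_bounded hr fun p => ?_
  rw [norm_mul, norm_mul, norm_pow, norm_pow, Real.norm_eq_abs, Real.norm_eq_abs, Real.norm_eq_abs,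
    mul_assoc]
  have := (abs_nonneg u).trans hu
  gcongr

theorem hasTaylor₂_taylorSum (h0 : 0 < r)
    (hr : Summable fun p : ℕ × ℕ => |c p.1 p.2| * (r ^ p.1 * r ^ p.2)) :
    HasTaylor₂ (taylorSum c) c :=
  ⟨r, h0, fun _ _ hu hv => (summable_taylor hr hu.le hv.le).hasSum⟩

theorem tendsto_abs_le {f : ℝ → ℝ} (h : Tendsto f (𝓝[>] 0) (𝓝 0)) (h0 : 0 < r) :
    ∀ᶠ y in 𝓝[>] 0, |f y| ≤ r := by
  have := h.abs
  rw [abs_zero] at this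
  exact this.eventually (eventually_le_nhds h0)

theorem tendsto_ell' : Tendsto ell (𝓝[>] 0) (𝓝 0) := tendsto_ell.mono_right nhdsWithin_le_nhds

theorem tendsto_div_ell : Tendsto (fun y : ℝ => y / ell y) (𝓝[>] 0) (𝓝 0) := by
  simpa using tendsto_div_ell_of_pos one_pos

theorem IsLaurentBlock.sumFun_eq (hF : IsLaurentBlock F γ c) {y : ℝ} (h0 : 0 < y)
    (h1 : 0 < ell y) : sumFun F y = y ^ γ * taylorSum c (ell y) (y / ell y) := by
  rw [sumFun, taylorSum, ← tsum_mul_left, ← (laurentExpo_injective γ).tsum_eq]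
  · refine tsum_congr fun p => ?_
    rw [hF.coeff, monomialFun_laurentExpo h0 h1]
    ring
  · intro e he
    exact hF.support_subset_range (fun h => he (by simp [h]))

theorem IsLaurentBlock.isSum (hF : IsLaurentBlock F γ c) (hc : IsConvergent F) {f : ℝ → ℝ}
    (hf : ∀ y, f y = y ^ γ * taylorSum c (ell y) (y / ell y)) : IsSum F f := by
  refine ⟨hc, ?_⟩
  filter_upwards [eventually_admissible] with y hy
  rw [hf, hF.sumFun_eq hy.1 hy.2.1]

/-- Weighted bounds for convergent Laurent blocks. -/
theorem IsLaurentBlock.normLe (hF : IsLaurentBlock F γ c) (hc : IsConvergent F) {η : ℝ}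
    (hη : 0 < η) : ∃ B : ℝ, ∀ᶠ y in 𝓝[>] 0, NormLe (weight η y) F (B * y ^ (η * γ)) := by
  classical
  obtain ⟨r, h0, hr⟩ := hF.exists_summable hc
  refine ⟨∑' p : ℕ × ℕ, |c p.1 p.2| * (r ^ p.1 * r ^ p.2), ?_⟩
  filter_upwards [eventually_admissible, tendsto_abs_le tendsto_ell' h0,
    tendsto_abs_le (tendsto_div_ell_of_pos hη) h0] with y hy hu hv s
  have hy0 := hy.1
  have hℓ := hy.2.1
  have hw := isWeight_weight η hy
  rw [abs_of_pos hℓ] at hu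
  rw [abs_of_pos (by positivity)] at hv
  calc ∑ e ∈ s, |F.coeff e| * weight η y e
      ≤ ∑ p ∈ s.preimage (laurentExpo γ) (laurentExpo_injective γ).injOn,
          |F.coeff (laurentExpo γ p)| * weight η y (laurentExpo γ p) := by
        refine (Finset.sum_preimage (laurentExpo γ) s _ (fun e => |F.coeff e| * weight η y e)
          fun e _ he => ?_).ge
        have : F.coeff e = 0 := by
          by_contra h
          exact he (hF.support_subset_range h)
        rw [this, abs_zero, zero_mul]
    _ ≤ ∑ p ∈ s.preimage (laurentExpo γ) (laurentExpo_injective γ).injOn,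
          (|c p.1 p.2| * (r ^ p.1 * r ^ p.2)) * y ^ (η * γ) := by
        refine Finset.sum_le_sum fun p _ => ?_
        rw [hF.coeff, weight_laurentExpo hy0 hℓ, mul_comm (y ^ (η * γ)), ← mul_assoc]
        gcongr
    _ ≤ _ := by
        rw [← Finset.sum_mul]
        exact mul_le_mul_of_nonneg_right (hr.sum_le_tsum _ fun p _ => by positivity)
          (Real.rpow_nonneg hy0.le _)

/-- The sum of a Laurent block is analytic. -/
theorem isAnalyticGerm_taylorSum (h0 : 0 < r)
    (hr : Summable fun p : ℕ × ℕ => |c p.1 p.2| * (r ^ p.1 * r ^ p.2)) {f : ℝ → ℝ}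
    (hf : ∀ y, f y = y ^ γ * taylorSum c (ell y) (y / ell y)) : IsAnalyticGerm f := by
  set U : ℂ → ℂ := fun z => (-Complex.log z)⁻¹ with hU
  set V : ℂ → ℂ := fun z => z * -Complex.log z with hV
  -- Analyticity is proved in the complex domain, where complex differentiability suffices. On the
  -- slit plane without 1 the logarithm has no zero, and the series converges normally where both
  -- arguments have modulus below r.
  set Ω₀ : Set ℂ := Complex.slitPlane ∩ {1}ᶜ with hΩ₀
  have hΩ₀o : IsOpen Ω₀ := Complex.isOpen_slitPlane.inter isOpen_compl_singleton
  have hlog0 : ∀ z ∈ Ω₀, -Complex.log z ≠ 0 := by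
    intro z hz h
    have h1 := Complex.exp_log (Complex.slitPlane_ne_zero hz.1)
    rw [neg_eq_zero.1 h, Complex.exp_zero] at h1
    exact hz.2 h1.symm
  have hlogd : DifferentiableOn ℂ (fun z => -Complex.log z) Ω₀ := fun z hz =>
    (Complex.differentiableAt_log hz.1).neg.differentiableWithinAt
  have hUd : DifferentiableOn ℂ U Ω₀ := hlogd.inv hlog0
  have hVd : DifferentiableOn ℂ V Ω₀ := differentiableOn_id.mul hlogd
  set Ω : Set ℂ := Ω₀ ∩ (fun z => (‖U z‖, ‖V z‖)) ⁻¹' (Iio r ×ˢ Iio r) with hΩ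
  have hΩo : IsOpen Ω :=
    (hUd.continuousOn.norm.prodMk hVd.continuousOn.norm).isOpen_inter_preimage hΩ₀o
      (isOpen_Iio.prod isOpen_Iio)
  have hΦ : DifferentiableOn ℂ
      (fun z => ∑' p : ℕ × ℕ, (c p.1 p.2 : ℂ) * U z ^ p.1 * V z ^ p.2) Ω := by
    refine Complex.differentiableOn_tsum_of_summable_norm hr (fun p => ?_) hΩo ?_
    · exact ((differentiableOn_const _).mul ((hUd.mono inter_subset_left).pow p.1)).mul
        ((hVd.mono inter_subset_left).pow p.2)
    · intro p z hz
      have h1 : ‖U z‖ < r := hz.2.1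
      have h2 : ‖V z‖ < r := hz.2.2
      rw [norm_mul, norm_mul, norm_pow, norm_pow, Complex.norm_real, Real.norm_eq_abs, mul_assoc]
      gcongr
  have hA : AnalyticOnNhd ℂ _ Ω := hΦ.analyticOnNhd hΩo
  have hev : ∀ᶠ y in 𝓝[>] (0 : ℝ), y < 1 ∧ |ell y| ≤ r / 2 ∧ |y / ell y| ≤ r / 2 := by
    filter_upwards [Ioo_mem_nhdsGT one_pos, tendsto_abs_le tendsto_ell' (half_pos h0),
      tendsto_abs_le tendsto_div_ell (half_pos h0)] with y h1 h2 h3 using ⟨h1.2, h2, h3⟩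
  obtain ⟨d, hd, hsub⟩ := mem_nhdsGT_iff_exists_Ioo_subset.1 hev
  have hre : ∀ y : ℝ, 0 < y → -Complex.log (y : ℂ) = ((-Real.log y : ℝ) : ℂ) := fun y hy => by
    rw [Complex.ofReal_neg, Complex.ofReal_log hy.le]
  have hUr : ∀ y : ℝ, 0 < y → U y = ((ell y : ℝ) : ℂ) := fun y hy => by
    simp only [hU]; rw [hre y hy, ell, Complex.ofReal_inv]
  have hVr : ∀ y : ℝ, 0 < y → V y = ((y / ell y : ℝ) : ℂ) := fun y hy => by
    simp only [hV]; rw [hre y hy, ell, div_inv_eq_mul, Complex.ofReal_mul]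
  refine ⟨d, hd, fun y hy => ?_⟩
  have hmem : (y : ℂ) ∈ Ω := by
    obtain ⟨h1, h2, h3⟩ := hsub hy
    refine ⟨⟨Complex.ofReal_mem_slitPlane.2 hy.1, ?_⟩, ?_, ?_⟩
    · intro h
      rw [mem_singleton_iff, Complex.ofReal_eq_one] at h
      exact h1.ne h
    · change ‖U y‖ < r
      rw [hUr y hy.1, Complex.norm_real, Real.norm_eq_abs]
      linarith
    · change ‖V y‖ < r
      rw [hVr y hy.1, Complex.norm_real, Real.norm_eq_abs]
      linarith
  have h3 := (analyticAt_rpow hy.1 γ).mul ((hA y hmem).re_ofReal)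
  refine h3.congr ?_
  filter_upwards [lt_mem_nhds hy.1] with t ht
  rw [Pi.mul_apply, hf, hUr t ht, hVr t ht, taylorSum]
  congr 1
  have h4 : ∀ p : ℕ × ℕ, (c p.1 p.2 : ℂ) * ((ell t : ℝ) : ℂ) ^ p.1 * ((t / ell t : ℝ) : ℂ) ^ p.2 =
      ((c p.1 p.2 * ell t ^ p.1 * (t / ell t) ^ p.2 : ℝ) : ℂ) := fun p => by push_cast; ring
  simp only [h4]
  rw [← Complex.ofReal_tsum, Complex.ofReal_re]

end LaurentBlock

end

noncomputable section

/-! ### Convergence of the blocks of the formal inverse -/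

theorem exists_gap {S : Set ℝ} (hS : ∀ M : ℝ, {a ∈ S | a ≤ M}.Finite) (M : ℝ) :
    ∃ δ > 0, ∀ a ∈ S, M < a → M + δ ≤ a := by
  set T := {a ∈ S | a ≤ M + 1} ∩ Ioi M with hT
  have hfin : T.Finite := (hS (M + 1)).subset inter_subset_left
  rcases T.eq_empty_or_nonempty with h | h
  · refine ⟨1, one_pos, fun a ha hM => ?_⟩
    by_contra hlt
    have : a ∈ T := ⟨⟨ha, (not_le.1 hlt).le⟩, hM⟩
    rw [h] at this
    exact this
  · obtain ⟨b, hb, hmin⟩ := Set.exists_min_image T id hfin h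
    have hbM : M < b := hb.2
    refine ⟨b - M, sub_pos.2 hbM, fun a ha hM => ?_⟩
    rcases le_or_gt a (M + 1) with h1 | h1
    · have := hmin a ⟨⟨ha, h1⟩, hM⟩
      simp only [id] at this
      linarith
    · have : b ≤ M + 1 := hb.1.2
      linarith

theorem IsTransseries.finite_xSupport {j : ℕ} {F : Series} (h : IsTransseries j F) (M : ℝ) :
    {a ∈ xSupport F | a ≤ M}.Finite := by
  refine (h.2 0 (Nat.zero_le j) (fun _ => 0) M).subset ?_
  rintro a ⟨⟨e, he, rfl⟩, ha⟩
  exact ⟨ha, e, he, by simp, rfl⟩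

/-- `θ` is the solution of the equation of the formal inverse. -/
structure IsSolution (α m c : ℝ) (G : Series) (P : Set Expo) (θ : Series) : Prop where
  supp : θ.support ⊆ fil P 1
  fix : invOp α m c G θ = θ
  iter : ∀ e, ∃ n, ∀ k ≥ n, θ.coeff e = ((invOp α m c G)^[k] 0).coeff e

theorem tendsto_exp_neg_inv : Tendsto (fun y : ℝ => Real.exp (-y⁻¹)) (𝓝[>] 0) (𝓝[>] 0) := by
  refine tendsto_nhdsWithin_iff.2 ⟨?_, Eventually.of_forall fun y => Real.exp_pos _⟩
  exact Real.tendsto_exp_neg_atTop_nhds_zero.comp tendsto_inv_nhdsGT_zero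

theorem ell_exp_neg_inv (y : ℝ) : ell (Real.exp (-y⁻¹)) = y := by
  rw [ell, Real.log_exp, neg_neg, inv_inv]

theorem isConvergent_of_eventually {F : Series} (hF : F.support ⊆ depthLe 2)
    (h : ∀ᶠ y in 𝓝[>] 0, Summable fun e => |F.coeff e| * monomialFun e y) : IsConvergent F := by
  obtain ⟨d, hd, hsub⟩ := mem_nhdsGT_iff_exists_Ioo_subset.1 (h.and eventually_admissible)
  refine ⟨d, hd, fun y hy => ?_⟩
  obtain ⟨h1, h2⟩ := hsub hy
  refine h1.congr fun e => ?_
  rw [abs_mul]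
  by_cases he : F.coeff e = 0
  · rw [he, abs_zero, zero_mul, zero_mul]
  · rw [monomialFun_eq_weight (hF he), abs_of_pos ((isWeight_weight 1 h2).pos e)]

theorem evalSum_weight_one {F : Series} (hF : F.support ⊆ depthLe 2) (x : ℝ) :
    evalSum (weight 1 x) F = sumFun F x := by
  refine tsum_congr fun e => ?_
  by_cases he : F.coeff e = 0
  · rw [he, zero_mul, zero_mul]
  · rw [monomialFun_eq_weight (hF he)]

namespace DulacLead

variable {F : Series} {α : ℝ} {m : ℕ} (h : DulacLead F α m)

include h in
theorem exists_solution (c : ℝ) :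
    ∃ θ, IsSolution α m c (tail F) (genSet α m (tail F)) θ := by
  obtain ⟨θ, h1, h2, h3⟩ := exists_invOp_fixedPoint h.α_pos h.isGenerating' c
  exact ⟨θ, h1, h2, h3⟩

include h in
theorem exists_solution_truncX (c N : ℝ) :
    ∃ θ, IsSolution α m c (truncX N (tail F)) (genSet α m (tail F)) θ := by
  obtain ⟨θ, h1, h2, h3⟩ := exists_invOp_fixedPoint h.α_pos (h.isGenerating N) c
  exact ⟨θ, h1, h2, h3⟩

include h in
theorem finite_support_truncX (N : ℝ) : (truncX N (tail F)).support.Finite :=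
  (h.finite_le N).subset fun _ he =>
    ⟨support_tail_subset F (support_truncX_subset N _ he), le_of_mem_support_truncX he⟩

variable {c : ℝ} {θ θ' : Series} {N : ℝ}

include h in
theorem eventually_normLe (hc : 0 < c)
    (hθ' : IsSolution α m c (truncX N (tail F)) (genSet α m (tail F)) θ') {η : ℝ} (hη : 0 < η) :
    ∀ᶠ x in 𝓝[>] 0, NormLe (weight η x) (invSeries α m c θ') 1 := by
  have hα := h.α_pos
  have hS := eventually_isSmall (c := c) (S := (h.finite_support_truncX N).toFinset) hη
    (h.isGenerating N) (fun e => by rw [Finite.mem_toFinset])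
  have hd : expo₂ (1 / α) (m / α) ∈ depthLe 2 :=
    depthLe_mono (by norm_num) (expo₂_mem_depthLe _ _)
  have hpos : 0 < expo₂ (1 / α) (m / α) := by
    refine Expo.lt_of_at 0 (by simp) ?_
    rw [expo₂_at_zero, Expo.at_zero]
    positivity
  have ht := ((tendsto_weight hη hd hpos).const_mul c).mul_const (Real.exp 1)
  rw [mul_zero, zero_mul] at ht
  filter_upwards [hS, ht.eventually (eventually_le_nhds one_pos)] with x hx hle
  exact (normLe_invSeries hc hx.weight (orderTop_pos_of_fil (h.isGenerating N).pos hθ'.supp)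
    (normLe_fixedPoint hα hx (h.isGenerating N) hθ'.iter)).mono hle

include h in
theorem coeff_invSeries_eq (hθ : IsSolution α m c (tail F) (genSet α m (tail F)) θ)
    (hθ' : IsSolution α m c (truncX N (tail F)) (genSet α m (tail F)) θ') {e : Expo}
    (he : e.at 0 ≤ N / α - 1) :
    (invSeries α m c θ).coeff e = (invSeries α m c θ').coeff e := by
  by_contra hne
  refine absurd (h.support_invSeries_sub hθ.supp hθ'.supp hθ.iter hθ'.iter (e := e) ?_)
    (not_lt.2 he)
  exact sub_ne_zero.2 hne

include h in
theorem block_invSeries_eq (hθ : IsSolution α m c (tail F) (genSet α m (tail F)) θ)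
    (hθ' : IsSolution α m c (truncX N (tail F)) (genSet α m (tail F)) θ') {a : ℝ}
    (ha : a ≤ N / α - 1) :
    block a (invSeries α m c θ) = block a (invSeries α m c θ') := by
  ext e
  exact h.coeff_invSeries_eq hθ hθ' (by rwa [consExpo_at_zero])

include h in
theorem depth_of_support {y : Series} (hy : y.support ⊆ invExpoSet F α m) :
    y.support ⊆ depthLe 2 := (h.isInfTransseries_of_support hy).1.1

-- For N = α(a+1) one has N/α - 1 = a, so the block is that of the truncated inverse. That series
-- converges absolutely for small x, hence its block converges at ℓ(x), and every small y equals
-- ℓ(e^{-1/y}).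
include h in
theorem isConvergent_block (hc : 0 < c) (hθ : IsSolution α m c (tail F) (genSet α m (tail F)) θ)
    (a : ℝ) : IsConvergent (block a (invSeries α m c θ)) := by
  have hα := h.α_pos
  obtain ⟨θ', hθ'⟩ := h.exists_solution_truncX c (α * (a + 1))
  have hd := h.depth_of_support (h.support_invSeries c hθ'.supp)
  rw [h.block_invSeries_eq hθ hθ' (a := a) (by field_simp; linarith)]
  refine isConvergent_of_eventually (fun e he => depthLe_mono (by norm_num)
    (support_block_depth hd he)) ?_
  have h1 : ∀ᶠ x in 𝓝[>] (0 : ℝ), Summable fun e =>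
      |(block a (invSeries α m c θ')).coeff e| * monomialFun e (ell x) := by
    filter_upwards [h.eventually_normLe hc hθ' one_pos, eventually_admissible] with x hx hx'
    exact summable_block hd hx'.1 (hx.summable (isWeight_weight 1 hx')) a
  filter_upwards [tendsto_exp_neg_inv.eventually h1] with y hy
  rwa [ell_exp_neg_inv] at hy

include h in
/-- The blocks of the formal inverse. -/
theorem exists_laurentBlock (hθ : IsSolution α m c (tail F) (genSet α m (tail F)) θ) :
    ∃ M : ℝ → ℕ, ∀ β, IsLaurentBlock (block (β / α) (invSeries α m c θ))
      (-(M β : ℝ) + m * β / α) (fun i k => (block (β / α) (invSeries α m c θ)).coeff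
        (expo₂ (-(M β : ℝ) + m * β / α + k) ((i : ℝ) - k))) ∧
      ∀ i k : ℕ, k < i → (block (β / α) (invSeries α m c θ)).coeff
        (expo₂ (-(M β : ℝ) + m * β / α + k) ((i : ℝ) - k)) = 0 := by
  have hα := h.α_pos
  have hsup := h.support_invSeries c hθ.supp
  have hd := h.depth_of_support hsup
  obtain ⟨M, hM⟩ := h.exists_form
  have key : ∀ β, ∀ e ∈ (block (β / α) (invSeries α m c θ)).support, ∃ K a : ℕ, a ≤ K ∧
      e.at 0 = -(M β : ℝ) + m * β / α + K ∧ e.at 1 = -a := by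
    intro β e he
    obtain ⟨-, β', -, h0, K, a, haK, h1, h2⟩ := hM _ (hsup he)
    rw [consExpo_at_zero] at h0
    have hβ : β' = β := by field_simp at h0; exact h0.symm
    subst hβ
    exact ⟨K, a, haK, by rw [← consExpo_at_succ (β' / α) e 0]; exact h1,
      by rw [← consExpo_at_succ (β' / α) e 1]; exact h2⟩
  refine ⟨M, fun β => ⟨⟨fun _ _ => rfl, fun e he => ?_⟩, fun i k hik => ?_⟩⟩
  · obtain ⟨K, a, haK, h0, h1⟩ := key β e he
    -- The monomial y^{γ+K} ℓ(y)^{-a} equals y^γ ℓ(y)^{K-a} (y/ℓ(y))^K. Indices with i > k would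
    -- require a negative a, so their coefficients vanish.
    refine ⟨K - a, K, depthLe_one_ext (support_block_depth hd he) (expo₂_mem_depthLe _ _) ?_ ?_⟩
    · rw [expo₂_at_zero, h0]
    · rw [expo₂_at_one, h1, Nat.cast_sub haK]; ring
  · by_contra hne
    obtain ⟨K, a, haK, h0, h1⟩ := key β _ hne
    rw [expo₂_at_one] at h1
    have h2 : (k : ℝ) < i := by exact_mod_cast hik
    have h3 : (0 : ℝ) ≤ a := Nat.cast_nonneg a
    linarith

include h in
/-- The asymptotic expansion of the inverse of a truncation. -/
theorem isLittleO_truncX (hc : 0 < c) (hθ : IsSolution α m c (tail F) (genSet α m (tail F)) θ)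
    (hθ' : IsSolution α m c (truncX N (tail F)) (genSet α m (tail F)) θ') {M : ℝ}
    (hMN : M ≤ N / α - 1) :
    (fun x => evalSum (weight 1 x) (invSeries α m c θ') -
      ∑ᶠ a ∈ {a ∈ xSupport (invSeries α m c θ) | a ≤ M},
        sumFun (block a (invSeries α m c θ)) (ell x) * x ^ a) =o[𝓝[>] 0] fun x => x ^ M := by
  classical
  have hsup := h.support_invSeries c hθ'.supp
  have hd := h.depth_of_support hsup
  have htr := (h.isInfTransseries_of_support hsup).1
  obtain ⟨δ, hδ, hgap⟩ := exists_gap (fun M => htr.finite_xSupport M) M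
  have hset : {a ∈ xSupport (invSeries α m c θ) | a ≤ M} =
      {a ∈ xSupport (invSeries α m c θ') | a ≤ M} := by
    ext a
    refine and_congr_left fun ha => ?_
    constructor
    · rintro ⟨e, he, rfl⟩
      refine ⟨e, ?_, rfl⟩
      rwa [HahnSeries.mem_support, ← h.coeff_invSeries_eq hθ hθ' (ha.trans hMN)]
    · rintro ⟨e, he, rfl⟩
      refine ⟨e, ?_, rfl⟩
      rwa [HahnSeries.mem_support, h.coeff_invSeries_eq hθ hθ' (ha.trans hMN)]
  simp only [hset, finsum_mem_eq_finite_toFinset_sum _ (htr.finite_xSupport M)]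
  -- The truncated inverse has norm at most 1 for every η > 0 and small x, so κ = 0 is allowed.
  have htail := isLittleO_tail (F := invSeries α m c θ') (κ := 0) hδ hgap (fun η hη _ =>
    ⟨1, by simpa only [mul_zero, Real.rpow_zero, mul_one] using h.eventually_normLe hc hθ' hη⟩)
  refine htail.congr' ?_ EventuallyEq.rfl
  filter_upwards [h.eventually_normLe hc hθ' one_pos, eventually_admissible] with x hx hx'
  rw [← evalSum_sub_blocks hd (hx.summable' (isWeight_weight 1 hx')) (htr.finite_xSupport M)]
  congr 1
  refine Finset.sum_congr rfl fun a ha => ?_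
  rw [h.block_invSeries_eq hθ hθ' (((Finite.mem_toFinset _).1 ha).2.trans hMN)]

end DulacLead

end

noncomputable section

/-! ### Derivatives of Dulac germs -/

/-- With s = (ζ+1)^{1/2} the map is s² - 1 + C s, so its inverse is found from the quadratic formula
s = (q - C)/2, q² = C² + 4(z+1). On a half-strip q has large real part and bounded imaginary part,
so s is the principal root of ζ+1. The bound Re q ≥ A is designed to give Re s ≥ R + 3. -/
theorem exists_strip_subset_quadraticDomain {C R : ℝ} (hC : 0 < C) (hR : 0 < R) :
    ∃ T : ℝ, ∀ z : ℂ, T < z.re → |z.im| < 1 → z ∈ quadraticDomain C R := by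
  set A := 2 * (R + 3) + C with hA
  refine ⟨A ^ 2, fun z hz him => ?_⟩
  have hA0 : 6 < A := by rw [hA]; linarith
  set w : ℂ := C ^ 2 + 4 * (z + 1) with hw
  have hwre : w.re = C ^ 2 + 4 * (z.re + 1) := by
    simp [hw, ← Complex.ofReal_pow]
  have hwim : w.im = 4 * z.im := by
    simp [hw, ← Complex.ofReal_pow]
  have hwA : A ^ 2 ≤ w.re := by rw [hwre]; nlinarith [sq_nonneg C, sq_nonneg A]
  obtain ⟨q, hq, hq0⟩ : ∃ q : ℂ, q ^ 2 = w ∧ 0 ≤ q.re := by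
    obtain ⟨q, hq⟩ := IsAlgClosed.exists_pow_nat_eq w (n := 2) (by norm_num)
    rcases le_total 0 q.re with h | h
    · exact ⟨q, hq, h⟩
    · exact ⟨-q, by rw [neg_sq, hq], by simpa using h⟩
  have hre : q.re ^ 2 - q.im ^ 2 = w.re := by
    rw [← hq, sq q, Complex.mul_re]; ring
  have him2 : 2 * (q.re * q.im) = w.im := by
    rw [← hq, sq q, Complex.mul_im]; ring
  have hqA : A ≤ q.re := by
    refine le_of_sq_le_sq ?_ hq0
    nlinarith [sq_nonneg q.im]
  have hqim : |q.im| ≤ 1 := by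
    have h1 : q.re * |q.im| = 2 * |z.im| := by
      rw [← abs_of_nonneg hq0, ← abs_mul]
      have : q.re * q.im = 2 * z.im := by linarith
      rw [this, abs_mul]; norm_num
    nlinarith [abs_nonneg q.im]
  set s : ℂ := (q - C) / 2 with hs
  have hsre : s.re = (q.re - C) / 2 := by simp [hs]
  have hsim : s.im = q.im / 2 := by simp [hs]
  have hs3 : R + 3 ≤ s.re := by rw [hsre]; linarith
  have hζ : R + 1 < (s ^ 2 - 1).re := by
    have : (s ^ 2 - 1).re = s.re ^ 2 - s.im ^ 2 - 1 := by
      rw [sq s, Complex.sub_re, Complex.mul_re, Complex.one_re]; ring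
    rw [this, hsim]
    have h1 : q.im ^ 2 ≤ 1 := by rw [← sq_abs]; nlinarith [abs_nonneg q.im]
    nlinarith
  refine ⟨s ^ 2 - 1, ⟨by linarith, ?_⟩, ?_⟩
  · exact (by linarith : R < (s ^ 2 - 1).re).trans_le (Complex.re_le_norm _)
  · have h1 : ((s ^ 2 - 1 + 1 : ℂ)) ^ (1 / 2 : ℂ) = s := by
      rw [sub_add_cancel, one_div, Complex.sq_cpow_two_inv (by linarith)]
    simp only [h1]
    have h2 : q = 2 * s + C := by rw [hs]; ring
    rw [h2, hw] at hq
    linear_combination hq / 4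

/-- Cauchy's estimate on discs of radius 1/2 inside the strip: 2! B/(1/2)² = 8B. -/
theorem hasDerivAt_bounded_of_strip {Φ : ℂ → ℂ} {T B : ℝ}
    (hd : ∀ z : ℂ, T < z.re → |z.im| < 1 → DifferentiableAt ℂ Φ z)
    (hB : ∀ z : ℂ, T < z.re → |z.im| < 1 → ‖Φ z‖ ≤ B) :
    ∃ u₁ u₂ : ℝ → ℝ, ∀ t : ℝ, T + 1 < t → HasDerivAt (fun t : ℝ => (Φ t).re) (u₁ t) t ∧
      HasDerivAt u₁ (u₂ t) t ∧ |u₂ t| ≤ 8 * B := by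
  refine ⟨fun t => (deriv Φ t).re, fun t => (deriv (deriv Φ) t).re, fun t ht => ?_⟩
  set S : Set ℂ := {z | T < z.re} ∩ {z | |z.im| < 1} with hS
  have hSo : IsOpen S := (isOpen_lt continuous_const Complex.continuous_re).inter
    (isOpen_lt (continuous_abs.comp Complex.continuous_im) continuous_const)
  have hdS : DifferentiableOn ℂ Φ S := fun z hz => (hd z hz.1 hz.2).differentiableWithinAt
  have hball : ∀ z : ℂ, ‖z - t‖ ≤ 1 / 2 → z ∈ S := by
    intro z hz
    have h1 := (Complex.abs_re_le_norm (z - t)).trans hz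
    have h2 := (Complex.abs_im_le_norm (z - t)).trans hz
    rw [Complex.sub_re, Complex.ofReal_re] at h1
    rw [Complex.sub_im, Complex.ofReal_im, sub_zero] at h2
    refine ⟨?_, ?_⟩
    · change T < z.re
      linarith [(abs_le.1 h1).1]
    · change |z.im| < 1
      linarith
  have htS : (t : ℂ) ∈ S := hball t (by simp)
  refine ⟨(hd t htS.1 htS.2).hasDerivAt.real_of_complex, ?_, ?_⟩
  · exact ((hdS.deriv hSo).differentiableAt (hSo.mem_nhds htS)).hasDerivAt.real_of_complex
  · refine (Complex.abs_re_le_norm _).trans ?_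
    have h1 := Complex.norm_iteratedDeriv_le_of_forall_mem_sphere_norm_le (c := (t : ℂ)) (f := Φ)
      (C := B) 2 (by norm_num : (0 : ℝ) < 1 / 2) ?_ ?_
    · rw [iteratedDeriv_succ, iteratedDeriv_one] at h1
      refine h1.trans (le_of_eq ?_)
      norm_num
      ring
    · refine (hdS.mono fun z hz => hball z ?_).diffContOnCl
      rw [closure_ball _ (by norm_num)] at hz
      exact mem_closedBall_iff_norm.1 hz
    · intro z hz
      have := hball z (mem_sphere_iff_norm.1 hz).le
      exact hB z this.1 this.2

/-- A function that is exponentially small and has a bounded second derivative has an exponentially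
small derivative. -/
theorem deriv_small_of_second_bounded {w w₁ w₂ : ℝ → ℝ} {T C N : ℝ} (hN : 0 < N)
    (h1 : ∀ t, T < t → HasDerivAt w (w₁ t) t) (h2 : ∀ t, T < t → HasDerivAt w₁ (w₂ t) t)
    (hC : ∀ t, T < t → |w₂ t| ≤ C) (hw : ∀ t, T < t → |w t| ≤ Real.exp (-(N * t))) :
    ∀ t, T < t → |w₁ t| ≤ (2 + C) * Real.exp (-(N * t / 2)) := by
  intro t ht
  -- A step of this length balances the two errors: the difference quotient of w is of order
  -- e^{-Nt}/h, and the second derivative costs C h.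
  set h := Real.exp (-(N * t / 2)) with hh
  have hpos : 0 < h := Real.exp_pos _
  have hhh : Real.exp (-(N * t)) = h * h := by rw [hh, ← Real.exp_add]; congr 1; ring
  have hlt : t < t + h := by linarith
  obtain ⟨ξ, hξ, hξe⟩ := exists_hasDerivAt_eq_slope w w₁ hlt
    (fun s hs => (h1 s (ht.trans_le hs.1)).continuousAt.continuousWithinAt)
    (fun s hs => h1 s (ht.trans hs.1))
  obtain ⟨ζ, hζ, hζe⟩ := exists_hasDerivAt_eq_slope w₁ w₂ hξ.1
    (fun s hs => (h2 s (ht.trans_le hs.1)).continuousAt.continuousWithinAt)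
    (fun s hs => h2 s (ht.trans hs.1))
  have hξt : 0 < ξ - t := sub_pos.2 hξ.1
  have e1 : w₁ t = w₁ ξ - w₂ ζ * (ξ - t) := by rw [hζe]; field_simp; ring
  have e2 : |w₁ ξ| ≤ 2 * h := by
    rw [hξe, add_sub_cancel_left, abs_div, abs_of_pos hpos, div_le_iff₀ hpos]
    have a1 := hw t ht
    have a2 := hw (t + h) (ht.trans hlt)
    have a3 : Real.exp (-(N * (t + h))) ≤ Real.exp (-(N * t)) := by
      refine Real.exp_le_exp.2 ?_
      nlinarith
    have a4 := abs_sub (w (t + h)) (w t)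
    rw [hhh] at a1 a3
    linarith
  have e3 : |w₂ ζ * (ξ - t)| ≤ C * h := by
    rw [abs_mul, abs_of_pos hξt]
    have b1 := hC ζ (ht.trans hζ.1)
    have b2 : ξ - t ≤ h := by linarith [hξ.2]
    exact mul_le_mul b1 b2 hξt.le ((abs_nonneg _).trans b1)
  rw [e1]
  refine (abs_sub _ _).trans ?_
  linarith

/-- The function `t^r e^{-b t}`. -/
def powExp (r b t : ℝ) : ℝ := t ^ r * Real.exp (-b * t)

theorem hasDerivAt_powExp (r b : ℝ) {t : ℝ} (ht : 0 < t) :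
    HasDerivAt (powExp r b) (r * powExp (r - 1) b t - b * powExp r b t) t := by
  have h1 := Real.hasDerivAt_rpow_const (x := t) (p := r) (Or.inl ht.ne')
  have h2 : HasDerivAt (fun t => Real.exp (-b * t)) (Real.exp (-b * t) * (-b)) t := by
    simpa using ((hasDerivAt_id t).const_mul (-b)).exp
  refine (h1.mul h2).congr_deriv ?_
  unfold powExp
  ring

theorem monomialFun_exp_neg {e : Expo} (he : e ∈ depthLe 1) {t : ℝ} (ht : 0 < t) :
    monomialFun e (Real.exp (-t)) = powExp (-e.at 1) (e.at 0) t := by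
  rw [monomialFun_eq (depthLe_mono (by norm_num) he), he 2 (by norm_num), Real.rpow_zero, mul_one,
    ell, Real.log_exp, neg_neg, ← Real.exp_mul, powExp, Real.inv_rpow ht.le, Real.rpow_neg ht.le,
    mul_comm]
  congr 2
  ring

theorem powExp_isLittleO {r b r' b' : ℝ} (h : b' < b ∨ b = b' ∧ r < r') :
    powExp r b =o[atTop] powExp r' b' := by
  have h0 : Tendsto (powExp (r - r') (b - b')) atTop (𝓝 0) := by
    rcases h with h | ⟨h1, h2⟩
    · exact tendsto_rpow_mul_exp_neg_mul_atTop_nhds_zero _ _ (sub_pos.2 h)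
    · have := tendsto_rpow_neg_atTop (sub_pos.2 h2)
      refine this.congr fun t => ?_
      rw [powExp, h1]
      simp
  refine IsLittleO.congr' (((isLittleO_one_iff ℝ).2 h0).mul_isBigO
    (isBigO_refl (powExp r' b') _)) ?_ (by simp)
  filter_upwards [eventually_gt_atTop 0] with t ht
  unfold powExp
  have e1 : t ^ r = t ^ (r - r') * t ^ r' := by rw [← Real.rpow_add ht, sub_add_cancel]
  have e2 : Real.exp (-b * t) = Real.exp (-(b - b') * t) * Real.exp (-b' * t) := by
    rw [← Real.exp_add]; congr 1; ring
  rw [e1, e2]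
  ring

theorem powExp_pos {r b t : ℝ} (ht : 0 < t) : 0 < powExp r b t :=
  mul_pos (Real.rpow_pos_of_pos ht r) (Real.exp_pos _)

theorem powExp_bounded (r : ℝ) {b : ℝ} (hb : 0 < b) : ∀ᶠ t in atTop, |powExp r b t| ≤ 1 := by
  have := (tendsto_rpow_mul_exp_neg_mul_atTop_nhds_zero r b hb).abs
  rw [abs_zero] at this
  exact this.eventually (eventually_le_nhds one_pos)

section PowExpSum

variable {ι : Type*} (S : Finset ι) (a r b : ι → ℝ)

/-- Finite sums of functions `t^r e^{-b t}` have bounded second derivatives. -/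
theorem powExpSum_deriv (hb : ∀ i ∈ S, 0 < b i) :
    ∃ p₂ : ℝ → ℝ, ∃ C : ℝ, ∀ᶠ t in atTop,
      HasDerivAt (fun t => ∑ i ∈ S, a i * powExp (r i) (b i) t)
        (∑ i ∈ S, a i * (r i * powExp (r i - 1) (b i) t - b i * powExp (r i) (b i) t)) t ∧
      HasDerivAt (fun t => ∑ i ∈ S, a i * (r i * powExp (r i - 1) (b i) t -
        b i * powExp (r i) (b i) t)) (p₂ t) t ∧ |p₂ t| ≤ C := by
  refine ⟨fun t => ∑ i ∈ S, a i * (r i * ((r i - 1) * powExp (r i - 1 - 1) (b i) t -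
    b i * powExp (r i - 1) (b i) t) - b i * (r i * powExp (r i - 1) (b i) t -
    b i * powExp (r i) (b i) t)),
    ∑ i ∈ S, |a i| * (|r i| * (|r i - 1| + |b i|) + |b i| * (|r i| + |b i|)), ?_⟩
  have hbd : ∀ᶠ t in atTop, ∀ i ∈ S, |powExp (r i - 1 - 1) (b i) t| ≤ 1 ∧
      |powExp (r i - 1) (b i) t| ≤ 1 ∧ |powExp (r i) (b i) t| ≤ 1 := by
    rw [Filter.eventually_all_finset]
    intro i hi
    exact (powExp_bounded _ (hb i hi)).and ((powExp_bounded _ (hb i hi)).and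
      (powExp_bounded _ (hb i hi)))
  filter_upwards [hbd, eventually_gt_atTop 0] with t hbt ht
  refine ⟨?_, ?_, ?_⟩
  · exact HasDerivAt.fun_sum fun i _ => (hasDerivAt_powExp (r i) (b i) ht).const_mul (a i)
  · exact HasDerivAt.fun_sum fun i _ => (((hasDerivAt_powExp (r i - 1) (b i) ht).const_mul
      (r i)).sub ((hasDerivAt_powExp (r i) (b i) ht).const_mul (b i))).const_mul (a i)
  · refine (Finset.abs_sum_le_sum_abs _ _).trans (Finset.sum_le_sum fun i hi => ?_)
    obtain ⟨h1, h2, h3⟩ := hbt i hi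
    rw [abs_mul]
    refine mul_le_mul_of_nonneg_left ?_ (abs_nonneg _)
    have key : ∀ x y p q : ℝ, |p| ≤ 1 → |q| ≤ 1 → |x * p - y * q| ≤ |x| + |y| := by
      intro x y p q hp hq
      refine (abs_sub _ _).trans ?_
      rw [abs_mul, abs_mul]
      exact add_le_add (mul_le_of_le_one_right (abs_nonneg _) hp)
        (mul_le_of_le_one_right (abs_nonneg _) hq)
    refine (abs_sub _ _).trans ?_
    rw [abs_mul, abs_mul]
    exact add_le_add (mul_le_mul_of_nonneg_left (key _ _ _ _ h1 h2) (abs_nonneg _))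
      (mul_le_mul_of_nonneg_left (key _ _ _ _ h2 h3) (abs_nonneg _))

end PowExpSum

end

noncomputable section

/-! ### The inverse of a Dulac germ -/

theorem IsDulacExpansion.tendsto_comp {g : ℝ → ℝ} {F : Series} (hexp : IsDulacExpansion g F)
    (N : ℝ) (hfin : {e ∈ F.support | e.at 0 ≤ N}.Finite) :
    (fun t => g (Real.exp (-t)) -
      ∑ e ∈ hfin.toFinset, F.coeff e * powExp (-e.at 1) (e.at 0) t) =o[atTop]
      fun t => Real.exp (-(N * t)) := by
  have h1 : Tendsto (fun t : ℝ => Real.exp (-t)) atTop (𝓝[>] 0) :=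
    tendsto_nhdsWithin_iff.2 ⟨Real.tendsto_exp_neg_atTop_nhds_zero,
      Eventually.of_forall fun t => Real.exp_pos _⟩
  have h2 := hexp.2 N
  simp only [finsum_mem_eq_finite_toFinset_sum _ hfin] at h2
  refine (h2.comp_tendsto h1).congr' ?_ ?_
  · filter_upwards [eventually_gt_atTop 0] with t ht
    simp only [Function.comp_apply]
    congr 1
    refine Finset.sum_congr rfl fun e he => ?_
    have hd : e ∈ depthLe 1 := fun i hi => hexp.1.1.1.1.1 e ((Finite.mem_toFinset _).1 he).1 i hi
    rw [monomialFun_exp_neg hd ht]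
  · refine Eventually.of_forall fun t => ?_
    simp only [Function.comp_apply]
    rw [← Real.exp_mul]
    congr 1
    ring

theorem IsQuasiAnalytic.exists_deriv {g : ℝ → ℝ} (hg : IsQuasiAnalytic g) :
    ∃ (u u₁ u₂ : ℝ → ℝ) (C : ℝ), ∀ᶠ t in atTop, u t = g (Real.exp (-t)) ∧
      HasDerivAt u (u₁ t) t ∧ HasDerivAt u₁ (u₂ t) t ∧ |u₂ t| ≤ C := by
  obtain ⟨C, R, hC, hR, Φ, hd, ⟨B, hB⟩, hΦ⟩ := hg
  obtain ⟨T, hT⟩ := exists_strip_subset_quadraticDomain hC hR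
  have hSo : IsOpen ({z : ℂ | T < z.re} ∩ {z : ℂ | |z.im| < 1}) :=
    (isOpen_lt continuous_const Complex.continuous_re).inter
      (isOpen_lt (continuous_abs.comp Complex.continuous_im) continuous_const)
  obtain ⟨u₁, u₂, hu⟩ := hasDerivAt_bounded_of_strip (Φ := Φ) (T := T) (B := B)
    (fun z h1 h2 => hd.differentiableAt (mem_of_superset (hSo.mem_nhds ⟨h1, h2⟩)
      fun z hz => hT z hz.1 hz.2)) (fun z h1 h2 => hB z (hT z h1 h2))
  refine ⟨fun t => (Φ t).re, u₁, u₂, 8 * B, ?_⟩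
  filter_upwards [hΦ, eventually_gt_atTop (T + 1)] with t h1 h2
  exact ⟨by rw [h1, Complex.ofReal_re], hu t h2⟩

/-- In t = -log x the germ and its truncated expansion both have bounded second derivatives, so
their exponentially small difference has an exponentially small derivative. The derivative of the
truncation is dominated by -aα t^m e^{-αt}, and the sign and size of g' follow. The bound is weaker
than the true order of g' but any power suffices below. -/
theorem DulacLead.deriv_lower_bound {F : Series} {α : ℝ} {m : ℕ} (h : DulacLead F α m) {g : ℝ → ℝ}
    (hg : IsDulacGerm g) (hexp : IsDulacExpansion g F) :
    ∃ κ > 0, ∀ᶠ x in 𝓝[>] 0, AnalyticAt ℝ g x ∧ κ * x ^ α ≤ deriv g x := by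
  classical
  have hα := h.α_pos
  set a := F.leadingCoeff with ha
  have ha0 : 0 < a := h.lead_pos
  -- Interpolation halves the rate, and N/2 = α + 1 still beats the leading rate α.
  set N := 2 * α + 2 with hN
  set A := (h.finite_le N).toFinset with hA
  have hApos : ∀ e ∈ A, 0 < e.at 0 := fun e he => h.series.1.1.2 e ((Finite.mem_toFinset _).1 he).1
  obtain ⟨u, u₁, u₂, C, hu⟩ := hg.2.2.exists_deriv
  obtain ⟨p₂, C', hp⟩ := powExpSum_deriv A (fun e => F.coeff e) (fun e => -e.at 1)
    (fun e => e.at 0) hApos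
  set p := fun t => ∑ e ∈ A, F.coeff e * powExp (-e.at 1) (e.at 0) t with hpdef
  set p₁ := fun t => ∑ e ∈ A, F.coeff e * (-e.at 1 * powExp (-e.at 1 - 1) (e.at 0) t -
    e.at 0 * powExp (-e.at 1) (e.at 0) t) with hp₁def
  have hw := (hexp.tendsto_comp N (h.finite_le N)).bound one_pos
  -- the difference between the germ and its truncated expansion
  obtain ⟨T, hT⟩ := eventually_atTop.1 ((hu.and hp).and hw)
  have hsmall := deriv_small_of_second_bounded (w := fun t => u t - p t)
    (w₁ := fun t => u₁ t - p₁ t) (w₂ := fun t => u₂ t - p₂ t) (T := T) (C := C + C') (N := N)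
    (by positivity) (fun t ht => (hT t ht.le).1.1.2.1.sub (hT t ht.le).1.2.1)
    (fun t ht => (hT t ht.le).1.1.2.2.1.sub (hT t ht.le).1.2.2.1)
    (fun t ht => (abs_sub _ _).trans (add_le_add (hT t ht.le).1.1.2.2.2 (hT t ht.le).1.2.2.2))
    (fun t ht => by
      have := (hT t ht.le).2
      rw [one_mul, Real.norm_eq_abs, Real.norm_eq_abs, abs_of_pos (Real.exp_pos _)] at this
      rw [(hT t ht.le).1.1.1]
      exact this)
  -- the derivative of the truncated expansion
  have hlead : expo₂ α (-(m : ℝ)) ∈ A := by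
    rw [hA, Finite.mem_toFinset]
    refine ⟨h.order_mem, ?_⟩
    rw [expo₂_at_zero, hN]; linarith
  have hcoef : F.coeff (expo₂ α (-(m : ℝ))) = a := by
    rw [ha, HahnSeries.leadingCoeff_eq, h.order]
  have hp₁ : (fun t => p₁ t + a * α * powExp m α t) =o[atTop] powExp m α := by
    have hrest : (fun t => a * (m * powExp (m - 1) α t) + ∑ e ∈ A.erase (expo₂ α (-(m : ℝ))),
        F.coeff e * (-e.at 1 * powExp (-e.at 1 - 1) (e.at 0) t -
          e.at 0 * powExp (-e.at 1) (e.at 0) t)) =o[atTop] powExp m α := by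
      refine IsLittleO.add (((powExp_isLittleO (Or.inr ⟨rfl, by linarith⟩)).const_mul_left
        _).const_mul_left _) (IsLittleO.fun_sum fun e he => ?_)
      have hne := (Finset.mem_erase.1 he).1
      have heF := ((Finite.mem_toFinset _).1 (Finset.mem_erase.1 he).2).1
      have hcmp : α < e.at 0 ∨ e.at 0 = α ∧ -e.at 1 < m := by
        rcases (h.le_at_zero heF).eq_or_lt with h0 | h0
        · refine Or.inr ⟨h0.symm, ?_⟩
          have h1 := h.le_at_one heF h0.symm
          refine lt_of_le_of_ne (by linarith) fun h2 => hne ?_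
          refine depthLe_one_ext (h.depth heF) (expo₂_mem_depthLe _ _) ?_ ?_
          · rw [expo₂_at_zero, h0]
          · rw [expo₂_at_one]; linarith
        · exact Or.inl h0
      have hcmp' : α < e.at 0 ∨ e.at 0 = α ∧ -e.at 1 - 1 < m :=
        hcmp.imp id fun h3 => ⟨h3.1, by linarith [h3.2]⟩
      exact (((powExp_isLittleO hcmp').const_mul_left _).sub
        ((powExp_isLittleO hcmp).const_mul_left _)).const_mul_left _
    refine hrest.congr_left fun t => ?_
    simp only [hp₁def]
    rw [← Finset.add_sum_erase A _ hlead, hcoef, expo₂_at_zero, expo₂_at_one, neg_neg]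
    ring
  have hκ : 0 < a * α / 4 := by positivity
  refine ⟨a * α / 4, hκ, ?_⟩
  have hfinal : ∀ᶠ t in atTop, a * α / 4 * Real.exp (-(α * t)) ≤ -u₁ t := by
    have hsm : ∀ᶠ t : ℝ in atTop, (2 + (C + C')) * Real.exp (-t) ≤ a * α / 4 := by
      have := Real.tendsto_exp_neg_atTop_nhds_zero.const_mul (2 + (C + C'))
      rw [mul_zero] at this
      exact this.eventually (eventually_le_nhds hκ)
    filter_upwards [hp₁.bound (show 0 < a * α / 2 by positivity), hsm, eventually_gt_atTop T,
      eventually_ge_atTop 1] with t h1 h2 h3 h4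
    have h5 := hsmall t h3
    have hq : Real.exp (-(α * t)) ≤ powExp m α t := by
      rw [powExp, neg_mul]
      exact le_mul_of_one_le_left (Real.exp_pos _).le
        (Real.one_le_rpow h4 (Nat.cast_nonneg m))
    have hq0 : 0 < powExp m α t := powExp_pos (by linarith)
    rw [Real.norm_eq_abs, Real.norm_eq_abs, abs_of_pos hq0] at h1
    have h6 : Real.exp (-(N * t / 2)) = Real.exp (-t) * Real.exp (-(α * t)) := by
      rw [← Real.exp_add, hN]; congr 1; ring
    rw [h6, ← mul_assoc] at h5
    have h7 := mul_le_mul_of_nonneg_right h2 (Real.exp_pos (-(α * t))).le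
    have h8 := (abs_le.1 h5).2
    have h9 := (abs_le.1 h1).2
    have h10 := mul_le_mul_of_nonneg_left hq (show 0 ≤ a * α / 2 by positivity)
    linarith
  obtain ⟨d, hd, hgd⟩ := hg.1
  have hu' : ∀ᶠ t in atTop, ∀ᶠ s in 𝓝 t, u s = g (Real.exp (-s)) := by
    obtain ⟨T', hT'⟩ := eventually_atTop.1 hu
    filter_upwards [eventually_gt_atTop T'] with t ht
    filter_upwards [lt_mem_nhds ht] with s hs
    exact (hT' s hs.le).1
  filter_upwards [tendsto_neg_log.eventually (hfinal.and (hu.and hu')), Ioo_mem_nhdsGT hd,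
    Ioo_mem_nhdsGT one_pos] with x hx hxd hx1
  obtain ⟨h1, h2, h3⟩ := hx
  have hx0 := hxd.1
  refine ⟨hgd x hxd, ?_⟩
  have hexpx : Real.exp (-(-Real.log x)) = x := by rw [neg_neg, Real.exp_log hx0]
  have e1 : HasDerivAt (fun t => g (Real.exp (-t))) (u₁ (-Real.log x)) (-Real.log x) :=
    h2.2.1.congr_of_eventuallyEq (h3.mono fun s hs => hs.symm)
  have e2 : HasDerivAt (fun t => g (Real.exp (-t))) (deriv g x * (x * -1)) (-Real.log x) := by
    have e3 : HasDerivAt (fun t : ℝ => Real.exp (-t)) (x * -1) (-Real.log x) := by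
      have := ((hasDerivAt_id (-Real.log x)).neg).exp
      simpa [Real.exp_log hx0] using this
    have e4 : HasDerivAt g (deriv g x) (Real.exp (-(-Real.log x))) := by
      rw [hexpx]; exact (hgd x hxd).differentiableAt.hasDerivAt
    exact e4.comp (-Real.log x) e3
  have e5 := e1.unique e2
  have e6 : Real.exp (-(α * -Real.log x)) = x ^ α := by
    rw [Real.rpow_def_of_pos hx0]; congr 1; ring
  rw [e5, e6] at h1
  -- The t-derivative of the germ is -x g'(x); the factor x is discarded at the end since x < 1 and
  -- g' ≥ 0.
  have e7 : a * α / 4 * x ^ α ≤ deriv g x * x := by linarith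
  have e8 : 0 ≤ a * α / 4 * x ^ α := by positivity
  have e9 : 0 ≤ deriv g x := by
    by_contra hneg
    nlinarith
  nlinarith [hx1.2]

/-- Germs that are analytic and tend to `0` with positive derivative have analytic inverses. -/
theorem exists_inverse_germ {g : ℝ → ℝ} (h0 : Tendsto g (𝓝[>] 0) (𝓝[>] 0)) {d : ℝ} (hd : 0 < d)
    (hg : ∀ x ∈ Ioo 0 d, AnalyticAt ℝ g x ∧ 0 < deriv g x) :
    ∃ gInv : ℝ → ℝ, IsInverseGerm g gInv ∧ IsAnalyticGerm gInv := by
  have hcont : ContinuousOn g (Ioo 0 d) := fun x hx => (hg x hx).1.continuousAt.continuousWithinAt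
  have hmono : StrictMonoOn g (Ioo 0 d) := by
    refine strictMonoOn_of_deriv_pos (convex_Ioo 0 d) hcont fun x hx => ?_
    rw [interior_Ioo] at hx
    exact (hg x hx).2
  have hpos : ∀ x ∈ Ioo 0 d, 0 < g x := by
    intro x hx
    have h1 := h0.eventually (self_mem_nhdsWithin : Ioi (0 : ℝ) ∈ 𝓝[>] 0)
    obtain ⟨y, hy1, hy2⟩ := (h1.and (Ioo_mem_nhdsGT hx.1)).exists
    exact (mem_Ioi.1 hy1).trans (hmono ⟨hy2.1, hy2.2.trans hx.2⟩ hx hy2.2)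
  set b := d / 2 with hb
  have hbm : b ∈ Ioo 0 d := ⟨by positivity, by rw [hb]; linarith⟩
  have hsurj : ∀ x ∈ Ioo 0 (g b), ∃ y ∈ Ioo 0 b, g y = x := by
    intro x hx
    have h1 : ∀ᶠ y in 𝓝[>] 0, g y < x :=
      (h0.mono_right nhdsWithin_le_nhds).eventually (eventually_lt_nhds hx.1)
    obtain ⟨y, hy1, hy2⟩ := (h1.and (Ioo_mem_nhdsGT hbm.1)).exists
    obtain ⟨z, hz, hzx⟩ := intermediate_value_Ioo hy2.2.le
      (hcont.mono fun z hz => ⟨hy2.1.trans_le hz.1, hz.2.trans_lt hbm.2⟩) ⟨hy1, hx.2⟩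
    exact ⟨z, ⟨hy2.1.trans hz.1, hz.2⟩, hzx⟩
  choose! gInv hgI using hsurj
  have hsub : Ioo 0 b ⊆ Ioo 0 d := Ioo_subset_Ioo_right hbm.2.le
  have hleft : ∀ y ∈ Ioo 0 b, gInv (g y) = y := by
    intro y hy
    have h1 : g y ∈ Ioo 0 (g b) := ⟨hpos y (hsub hy), hmono (hsub hy) hbm hy.2⟩
    exact hmono.injOn (hsub (hgI _ h1).1) (hsub hy) (hgI _ h1).2
  have hgb := hpos b hbm
  refine ⟨gInv, ⟨h0, ?_, ?_, ?_⟩, g b, hgb, ?_⟩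
  · refine tendsto_nhdsWithin_iff.2 ⟨?_, ?_⟩
    · refine (nhdsGT_basis (0 : ℝ)).tendsto_iff (Metric.nhds_basis_ball) |>.2 fun ε hε => ?_
      set ε' := min (ε / 2) (b / 2) with hε'
      have hε0 : 0 < ε' := lt_min (by linarith) (by linarith [hbm.1])
      have hεb : ε' ∈ Ioo 0 b := ⟨hε0, (min_le_right _ _).trans_lt (by linarith [hbm.1])⟩
      refine ⟨g ε', hpos _ (hsub hεb), fun x hx => ?_⟩
      have hx' : x ∈ Ioo 0 (g b) := ⟨hx.1, hx.2.trans (hmono (hsub hεb) hbm hεb.2)⟩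
      obtain ⟨h1, h2⟩ := hgI x hx'
      have h3 : gInv x < ε' := by
        rw [← hmono.lt_iff_lt (hsub h1) (hsub hεb), h2]; exact hx.2
      rw [Metric.mem_ball, Real.dist_eq, sub_zero, abs_of_pos h1.1]
      have := min_le_left (ε / 2) (b / 2)
      linarith
    · filter_upwards [Ioo_mem_nhdsGT hgb] with x hx using (hgI x hx).1.1
  · filter_upwards [Ioo_mem_nhdsGT hgb] with x hx using (hgI x hx).2
  · filter_upwards [Ioo_mem_nhdsGT hbm.1] with x hx using hleft x hx
  · intro x hx
    obtain ⟨h1, h2⟩ := hgI x hx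
    obtain ⟨h3, h4⟩ := hg _ (hsub h1)
    -- Analyticity of the inverse may be tested after composition with g, whose derivative does not
    -- vanish, and that composite is locally the identity.
    rw [← h2, ← analyticAt_comp_iff_of_deriv_ne_zero h3 h4.ne']
    refine analyticAt_id.congr ?_
    filter_upwards [Ioo_mem_nhds h1.1 h1.2] with y hy
    exact (hleft y hy).symm

end

noncomputable section

/-! ### The asymptotic expansion of the inverse germ -/

namespace DulacLead

variable {F : Series} {α : ℝ} {m : ℕ} (h : DulacLead F α m)

include h in
theorem exists_coeff : ∃ c : ℝ, 0 < c ∧ F.leadingCoeff * (c ^ α * α ^ (-(m : ℝ))) = 1 := by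
  have hα := h.α_pos
  have hb : 0 < F.leadingCoeff * α ^ (-(m : ℝ)) :=
    mul_pos h.lead_pos (Real.rpow_pos_of_pos hα _)
  refine ⟨(F.leadingCoeff * α ^ (-(m : ℝ))) ^ (-1 / α), Real.rpow_pos_of_pos hb _, ?_⟩
  rw [← Real.rpow_mul hb.le, div_mul_cancel₀ _ hα.ne', Real.rpow_neg_one]
  have := h.lead_pos.ne'
  field_simp

-- The expansion cut at α/2 has no terms. This crude bound gives g → 0 and, applied at g⁻¹(x), a
-- lower bound for the inverse.
include h in
theorem isLittleO_half {g : ℝ → ℝ} (hexp : IsDulacExpansion g F) :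
    g =o[𝓝[>] 0] fun x => x ^ (α / 2) := by
  have hα := h.α_pos
  have h1 := hexp.2 (α / 2)
  have hempty : {e ∈ F.support | e.at 0 ≤ α / 2} = ∅ := by
    refine eq_empty_of_forall_notMem fun e he => ?_
    have h2 := h.le_at_zero he.1
    have h3 : e.at 0 ≤ α / 2 := he.2
    linarith
  simp only [hempty, finsum_mem_empty, sub_zero] at h1
  exact h1

-- Positivity follows from monotonicity: near 0 the derivative is positive and the limit at 0 is 0.
include h in
theorem tendsto_germ {g : ℝ → ℝ} (hg : IsDulacGerm g) (hexp : IsDulacExpansion g F) :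
    Tendsto g (𝓝[>] 0) (𝓝[>] 0) := by
  have hα := h.α_pos
  have h0 : Tendsto g (𝓝[>] 0) (𝓝 0) := by
    have h1 := (h.isLittleO_half hexp).trans
      (isLittleO_rpow_rpow (show (0 : ℝ) < α / 2 by positivity))
    simp only [Real.rpow_zero] at h1
    exact (isLittleO_one_iff ℝ).1 h1
  refine tendsto_nhdsWithin_iff.2 ⟨h0, ?_⟩
  obtain ⟨κ, hκ, hev⟩ := h.deriv_lower_bound hg hexp
  obtain ⟨d, hd, hsub⟩ := mem_nhdsGT_iff_exists_Ioo_subset.1 hev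
  have hmono : StrictMonoOn g (Ioo 0 d) := by
    refine strictMonoOn_of_deriv_pos (convex_Ioo 0 d)
      (fun x hx => (hsub hx).1.continuousAt.continuousWithinAt) fun x hx => ?_
    rw [interior_Ioo] at hx
    exact (mul_pos hκ (Real.rpow_pos_of_pos hx.1 α)).trans_le (hsub hx).2
  filter_upwards [Ioo_mem_nhdsGT (mem_Ioi.1 hd)] with x hx
  have hx2 : x / 2 ∈ Ioo 0 d := ⟨by linarith [hx.1], by linarith [hx.1, hx.2]⟩
  have h2 : 0 ≤ g (x / 2) := by
    refine le_of_tendsto h0 ?_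
    filter_upwards [Ioo_mem_nhdsGT hx2.1] with y hy
    exact (hmono ⟨hy.1, hy.2.trans hx2.2⟩ hx2 hy.2).le
  exact h2.trans_lt (hmono hx2 hx (by linarith [hx.1]))

include h in
theorem exists_inverse {g : ℝ → ℝ} (hg : IsDulacGerm g) (hexp : IsDulacExpansion g F) :
    ∃ gInv : ℝ → ℝ, IsInverseGerm g gInv ∧ IsAnalyticGerm gInv := by
  obtain ⟨κ, hκ, hev⟩ := h.deriv_lower_bound hg hexp
  obtain ⟨d, hd, hsub⟩ := mem_nhdsGT_iff_exists_Ioo_subset.1 hev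
  exact exists_inverse_germ (h.tendsto_germ hg hexp) hd fun x hx =>
    ⟨(hsub hx).1, (mul_pos hκ (Real.rpow_pos_of_pos hx.1 α)).trans_le (hsub hx).2⟩

variable {c : ℝ} {θ' : Series} {N : ℝ}

-- The value is c x^{1/α} ℓ^{m/α} e^T with |T| ≤ 1. Doubling and halving the power of x absorbs the
-- logarithm and the constants.
include h in
theorem evalSum_bounds (hc : 0 < c)
    (hθ' : IsSolution α m c (truncX N (tail F)) (genSet α m (tail F)) θ') :
    ∀ᶠ x in 𝓝[>] 0, x ^ (2 / α) ≤ evalSum (weight 1 x) (invSeries α m c θ') ∧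
      evalSum (weight 1 x) (invSeries α m c θ') ≤ x ^ (1 / (2 * α)) := by
  have hα := h.α_pos
  have hS := eventually_isSmall (c := c) (S := (h.finite_support_truncX N).toFinset) one_pos
    (h.isGenerating N) (fun e => by rw [Finite.mem_toFinset])
  have hw : ∀ a b : ℝ, 0 < a → Tendsto (fun x => weight 1 x (expo₂ a b)) (𝓝[>] 0) (𝓝 0) := by
    intro a b ha
    refine tendsto_weight one_pos (depthLe_mono (by norm_num) (expo₂_mem_depthLe _ _)) ?_
    refine Expo.lt_of_at 0 (by simp) ?_
    rwa [expo₂_at_zero, Expo.at_zero]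
  have hlow := (hw (1 / α) (-(m / α)) (by positivity)).eventually
    (eventually_le_nhds (show 0 < c * Real.exp (-1) by positivity))
  have hup := (hw (1 / (2 * α)) (m / α) (by positivity)).eventually
    (eventually_le_nhds (show 0 < (c * Real.exp 1)⁻¹ by positivity))
  filter_upwards [hS, eventually_admissible, hlow, hup] with x hx hx' h1 h2
  have hθ := normLe_fixedPoint hα hx (h.isGenerating N) hθ'.iter
  have hw' := isWeight_weight 1 hx'
  have hT := abs_le.1 (hθ.abs_evalSum_le hx.weight)
  rw [evalSum_invSeries hx.weight (orderTop_pos_of_fil (h.isGenerating N).pos hθ'.supp) hθ]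
  have hx0 := hx'.1
  have hℓ := hx'.2.1
  have hv : ∀ a b : ℝ, weight 1 x (expo₂ a b) = x ^ a * ell x ^ b := fun a b => by
    rw [weight, expo₂_at_zero, expo₂_at_one, expo₂_mem_depthLe _ _ 2 (by norm_num),
      Real.rpow_zero, mul_one, one_mul]
  rw [hv] at h1 h2 ⊢
  have hX : 0 < x ^ (1 / α) * ell x ^ ((m : ℝ) / α) := by positivity
  have e1 := Real.exp_le_exp.2 hT.1
  have e2 := Real.exp_le_exp.2 hT.2
  constructor
  · have e3 : x ^ (2 / α) = x ^ (1 / α) * ell x ^ (-((m : ℝ) / α)) *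
        (x ^ (1 / α) * ell x ^ ((m : ℝ) / α)) := by
      rw [Real.rpow_neg hℓ.le, show (2 : ℝ) / α = 1 / α + 1 / α by ring, Real.rpow_add hx0]
      field_simp
    rw [e3]
    calc _ ≤ c * Real.exp (-1) * (x ^ (1 / α) * ell x ^ ((m : ℝ) / α)) :=
          mul_le_mul_of_nonneg_right h1 hX.le
      _ = c * (x ^ (1 / α) * ell x ^ ((m : ℝ) / α)) * Real.exp (-1) := by ring
      _ ≤ _ := mul_le_mul_of_nonneg_left e1 (by positivity)
  · have e3 : x ^ (1 / α) = x ^ (1 / (2 * α)) * x ^ (1 / (2 * α)) := by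
      rw [← Real.rpow_add hx0]; congr 1; field_simp; ring
    calc c * (x ^ (1 / α) * ell x ^ ((m : ℝ) / α)) * Real.exp (evalSum (weight 1 x) θ')
        ≤ c * (x ^ (1 / α) * ell x ^ ((m : ℝ) / α)) * Real.exp 1 :=
          mul_le_mul_of_nonneg_left e2 (by positivity)
      _ = (c * Real.exp 1) * (x ^ (1 / (2 * α)) * ell x ^ ((m : ℝ) / α)) * x ^ (1 / (2 * α)) := by
          rw [e3]; ring
      _ ≤ (c * Real.exp 1) * (c * Real.exp 1)⁻¹ * x ^ (1 / (2 * α)) := by gcongr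
      _ = x ^ (1 / (2 * α)) := by rw [mul_inv_cancel₀ (by positivity), one_mul]

include h in
/-- The inverse of a truncation is an exact solution of the truncated equation. -/
theorem truncated_eq (hc : 0 < c) (hac : F.leadingCoeff * (c ^ α * α ^ (-(m : ℝ))) = 1)
    (hN : α ≤ N) (hθ' : IsSolution α m c (truncX N (tail F)) (genSet α m (tail F)) θ') :
    ∀ᶠ x in 𝓝[>] 0, ∑ e ∈ (h.finite_le N).toFinset,
      F.coeff e * monomialFun e (evalSum (weight 1 x) (invSeries α m c θ')) = x := by
  classical
  have hα := h.α_pos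
  have hS := eventually_isSmall (c := c) (S := (h.finite_support_truncX N).toFinset) one_pos
    (h.isGenerating N) (fun e => by rw [Finite.mem_toFinset])
  filter_upwards [hS, eventually_admissible] with x hx hx'
  have key := sum_monomialFun_evalSum hα hc hx' hx (h.isGenerating N) hθ'.supp hθ'.fix hθ'.iter hac
  refine Eq.trans ?_ key
  have hlead : F.order ∈ (h.finite_le N).toFinset := by
    rw [Finite.mem_toFinset, h.order]
    exact ⟨h.order_mem, by rwa [expo₂_at_zero]⟩
  rw [← Finset.add_sum_erase _ _ hlead, HahnSeries.leadingCoeff_eq, h.order]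
  congr 1
  refine Finset.sum_congr ?_ fun e he => ?_
  · ext e
    rw [Finset.mem_erase, Finite.mem_toFinset, Finite.mem_toFinset, ← h.order]
    constructor
    · rintro ⟨h1, h2, h3⟩
      rwa [HahnSeries.mem_support, coeff_truncX_of_le _ h3, coeff_tail_of_ne h1]
    · intro h1
      have h2 := support_truncX_subset N _ h1
      refine ⟨?_, support_tail_subset F h2, le_of_mem_support_truncX h1⟩
      rintro rfl
      exact h2 (coeff_tail_order F)
  · rw [Finite.mem_toFinset] at he
    have h2 := support_truncX_subset N _ he
    rw [coeff_truncX_of_le _ (le_of_mem_support_truncX he), coeff_tail_of_ne]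
    rintro rfl
    exact h2 (coeff_tail_order F)

-- Let Y be the value of the truncated inverse. It solves the truncated equation exactly, so |g(Y) -
-- x| ≤ Y^N ≤ x^{N/(2α)}. Both Y and g⁻¹(x) are at least x^{2/α}, where g' ≥ κ x²; the mean value
-- theorem therefore costs a factor x^{-2}.
include h in
theorem isBigO_sub_truncated {g gInv : ℝ → ℝ} (hg : IsDulacGerm g) (hexp : IsDulacExpansion g F)
    (hinv : IsInverseGerm g gInv) (hc : 0 < c)
    (hac : F.leadingCoeff * (c ^ α * α ^ (-(m : ℝ))) = 1) (hN : α ≤ N)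
    (hθ' : IsSolution α m c (truncX N (tail F)) (genSet α m (tail F)) θ') :
    (fun x => gInv x - evalSum (weight 1 x) (invSeries α m c θ')) =O[𝓝[>] 0]
      fun x => x ^ (N / (2 * α) - 2) := by
  have hα := h.α_pos
  set Y := fun x => evalSum (weight 1 x) (invSeries α m c θ') with hY
  have hbd := h.evalSum_bounds hc hθ'
  have hYt : Tendsto Y (𝓝[>] 0) (𝓝[>] 0) := by
    have h1 : Tendsto (fun x : ℝ => x ^ (1 / (2 * α))) (𝓝[>] 0) (𝓝 0) := by
      have h2 := isLittleO_rpow_rpow (show (0 : ℝ) < 1 / (2 * α) by positivity)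
      simp only [Real.rpow_zero] at h2
      exact (isLittleO_one_iff ℝ).1 h2
    have hp : ∀ᶠ x in 𝓝[>] (0 : ℝ), 0 < Y x := by
      filter_upwards [hbd, self_mem_nhdsWithin] with x hx hx0
      exact (Real.rpow_pos_of_pos hx0 _).trans_le hx.1
    refine tendsto_nhdsWithin_iff.2 ⟨?_, hp⟩
    exact tendsto_of_tendsto_of_tendsto_of_le_of_le' tendsto_const_nhds h1
      (hp.mono fun x hx => hx.le) (hbd.mono fun x hx => hx.2)
  have hgY : ∀ᶠ x in 𝓝[>] 0, |g (Y x) - x| ≤ x ^ (N / (2 * α)) := by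
    have h1 := hexp.2 N
    simp only [finsum_mem_eq_finite_toFinset_sum _ (h.finite_le N)] at h1
    have h2 := hYt.eventually (h1.bound one_pos)
    filter_upwards [h2, h.truncated_eq hc hac hN hθ', hbd, self_mem_nhdsWithin,
      hYt.eventually self_mem_nhdsWithin] with x h3 h4 h5 hx0 hY0
    have hx0' : 0 < x := hx0
    have hY0' : 0 < Y x := hY0
    rw [h4, one_mul, Real.norm_eq_abs, Real.norm_eq_abs,
      abs_of_pos (Real.rpow_pos_of_pos hY0' N)] at h3
    refine h3.trans ?_
    calc Y x ^ N ≤ (x ^ (1 / (2 * α))) ^ N :=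
          Real.rpow_le_rpow hY0'.le h5.2 (hα.le.trans hN)
      _ = x ^ (N / (2 * α)) := by rw [← Real.rpow_mul hx0'.le]; congr 1; ring
  have hgI : ∀ᶠ x in 𝓝[>] 0, x ^ (2 / α) ≤ gInv x := by
    have h1 := hinv.2.1.eventually ((h.isLittleO_half hexp).bound one_pos)
    filter_upwards [h1, hinv.2.2.1, self_mem_nhdsWithin, hinv.2.1.eventually self_mem_nhdsWithin]
      with x h2 h3 hx0 hI0
    have hx0' : 0 < x := hx0
    have hI0' : 0 < gInv x := hI0
    rw [h3, one_mul, Real.norm_eq_abs, Real.norm_eq_abs, abs_of_pos hx0',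
      abs_of_pos (Real.rpow_pos_of_pos hI0' _)] at h2
    calc x ^ (2 / α) ≤ (gInv x ^ (α / 2)) ^ (2 / α) :=
          Real.rpow_le_rpow hx0'.le h2 (by positivity)
      _ = gInv x := by
          rw [← Real.rpow_mul hI0'.le, show α / 2 * (2 / α) = 1 by field_simp, Real.rpow_one]
  obtain ⟨κ, hκ, hev⟩ := h.deriv_lower_bound hg hexp
  obtain ⟨d, hd, hsub⟩ := mem_nhdsGT_iff_exists_Ioo_subset.1 hev
  refine IsBigO.of_bound κ⁻¹ ?_
  filter_upwards [hbd, hgY, hgI, hinv.2.2.1, self_mem_nhdsWithin,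
    hYt.eventually (Ioo_mem_nhdsGT (mem_Ioi.1 hd)),
    hinv.2.1.eventually (Ioo_mem_nhdsGT (mem_Ioi.1 hd))] with x h1 h2 h3 h4 hx0 h5 h6
  have hx0' : 0 < x := hx0
  set D := Ico (x ^ (2 / α)) d with hD
  have hxp : 0 < x ^ (2 / α) := Real.rpow_pos_of_pos hx0' _
  have hDsub : D ⊆ Ioo 0 d := fun z hz => ⟨hxp.trans_le hz.1, hz.2⟩
  have hmvt := Convex.mul_sub_le_image_sub_of_le_deriv (D := D) (f := g) (C := κ * x ^ (2 : ℝ))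
    (convex_Ico _ _) (fun z hz => (hsub (hDsub hz)).1.continuousAt.continuousWithinAt)
    (fun z hz => (hsub (hDsub (interior_subset hz))).1.differentiableAt.differentiableWithinAt)
    (fun z hz => by
      have hz' := interior_subset hz
      refine le_trans ?_ (hsub (hDsub hz')).2
      refine mul_le_mul_of_nonneg_left ?_ hκ.le
      calc x ^ (2 : ℝ) = (x ^ (2 / α)) ^ α := by
            rw [← Real.rpow_mul hx0'.le]; congr 1; field_simp
        _ ≤ z ^ α := Real.rpow_le_rpow hxp.le hz'.1 hα.le)
  have hYD : Y x ∈ D := ⟨h1.1, h5.2⟩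
  have hID : gInv x ∈ D := ⟨h3, h6.2⟩
  have habs : κ * x ^ (2 : ℝ) * |gInv x - Y x| ≤ |g (Y x) - x| := by
    rcases le_total (Y x) (gInv x) with hle | hle
    · have := hmvt _ hYD _ hID hle
      rw [h4] at this
      rw [abs_of_nonneg (sub_nonneg.2 hle), abs_sub_comm]
      exact this.trans (le_abs_self _)
    · have := hmvt _ hID _ hYD hle
      rw [h4] at this
      rw [abs_sub_comm, abs_of_nonneg (sub_nonneg.2 hle)]
      exact this.trans (le_abs_self _)
  have h7 := habs.trans h2
  rw [Real.norm_eq_abs, Real.norm_eq_abs, abs_of_pos (Real.rpow_pos_of_pos hx0' _),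
    Real.rpow_sub hx0']
  have h8 : 0 < κ * x ^ (2 : ℝ) := by positivity
  rw [← le_div_iff₀' h8] at h7
  refine h7.trans (le_of_eq ?_)
  field_simp

include h in
/-- The asymptotic expansion of the inverse germ. -/
theorem isLittleO_inverse {g gInv : ℝ → ℝ} (hg : IsDulacGerm g) (hexp : IsDulacExpansion g F)
    (hinv : IsInverseGerm g gInv) (hc : 0 < c)
    (hac : F.leadingCoeff * (c ^ α * α ^ (-(m : ℝ))) = 1) {θ : Series}
    (hθ : IsSolution α m c (tail F) (genSet α m (tail F)) θ) (M : ℝ) :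
    (fun x => gInv x - ∑ᶠ a ∈ {a ∈ xSupport (invSeries α m c θ) | a ≤ M},
      sumFun (block a (invSeries α m c θ)) (ell x) * x ^ a) =o[𝓝[>] 0] fun x => x ^ M := by
  have hα := h.α_pos
  -- Now N/(2α) - 2 = |M| + 1 > M makes the difference from the germ negligible, and N/α - 1 ≥ M
  -- makes all blocks up to x^M those of the full inverse.
  set N := 2 * α * (|M| + 3) with hNdef
  have hM := le_abs_self M
  have hM0 := abs_nonneg M
  have hN : α ≤ N := by rw [hNdef]; nlinarith
  obtain ⟨θ', hθ'⟩ := h.exists_solution_truncX c N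
  have hMN : M ≤ N / α - 1 := by
    have : N / α = 2 * (|M| + 3) := by rw [hNdef]; field_simp
    rw [this]; linarith
  have h1 := h.isLittleO_truncX hc hθ hθ' hMN
  have h2 : M < N / (2 * α) - 2 := by
    have : N / (2 * α) = |M| + 3 := by rw [hNdef]; field_simp
    rw [this]; linarith
  have h3 := (h.isBigO_sub_truncated hg hexp hinv hc hac hN hθ').trans_isLittleO
    (isLittleO_rpow_rpow h2)
  refine (h3.add h1).congr_left fun x => ?_
  ring

end DulacLead

end

noncomputable section

/-! ### Sectional expansions of convergent series -/

theorem isAnalyticGerm_zero : IsAnalyticGerm fun _ => 0 := ⟨1, one_pos, analyticOnNhd_const⟩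

theorem eq_expo₂_zero {e : Expo} (he : e ∈ depthLe 0) : e = expo₂ (e.at 0) 0 := by
  refine depthLe_one_ext (depthLe_mono (by norm_num) he) (expo₂_mem_depthLe _ _) ?_ ?_
  · rw [expo₂_at_zero]
  · rw [expo₂_at_one, he 1 (by norm_num)]

section FiniteSupport

variable {B : Series} (hd : B.support ⊆ depthLe 0) (hfin : (xSupport B).Finite)

include hd in
theorem sumFun_of_finite (y : ℝ) :
    sumFun B y = ∑ a ∈ hfin.toFinset, B.coeff (expo₂ a 0) * y ^ a := by
  have hinj : Function.Injective fun a => expo₂ a 0 := fun a b hab => by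
    simpa only [expo₂_at_zero] using congrArg (fun e : Expo => e.at 0) hab
  rw [sumFun, ← hinj.tsum_eq, tsum_eq_sum (s := hfin.toFinset)]
  · refine Finset.sum_congr rfl fun a _ => ?_
    rw [monomialFun_eq (depthLe_mono (by norm_num) (expo₂_mem_depthLe _ _)), expo₂_at_zero,
      expo₂_at_one, expo₂_mem_depthLe _ _ 2 (by norm_num), Real.rpow_zero, Real.rpow_zero,
      mul_one, mul_one]
  · intro a ha
    have : B.coeff (expo₂ a 0) = 0 := by
      by_contra hne
      exact ha (hfin.mem_toFinset.2 ⟨expo₂ a 0, hne, expo₂_at_zero a 0⟩)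
    rw [this, zero_mul]
  · intro e he
    have hmem : e ∈ B.support := fun h => he (by simp [h])
    exact ⟨e.at 0, (eq_expo₂_zero (hd hmem)).symm⟩

include hd hfin in
theorem finite_support_of_xSupport : B.support.Finite := by
  refine (hfin.image fun a => expo₂ a 0).subset fun e he => ?_
  exact ⟨e.at 0, ⟨e, he, rfl⟩, (eq_expo₂_zero (hd he)).symm⟩

include hd hfin in
theorem isSum_of_finite : IsSum B (sumFun B) := by
  refine ⟨⟨1, one_pos, fun y _ => ?_⟩, EventuallyEq.rfl⟩
  refine summable_of_ne_finset_zero (s := (finite_support_of_xSupport hd hfin).toFinset)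
    fun e he => ?_
  have : B.coeff e = 0 := by
    by_contra hne
    exact he ((finite_support_of_xSupport hd hfin).mem_toFinset.2 hne)
  simp [this]

include hd hfin in
theorem isSectionalExpansion_of_finite (s : Series → ℝ → ℝ) :
    IsSectionalExpansion s 0 B (sumFun B) := by
  classical
  have hsum : sumFun B = fun y => ∑ a ∈ hfin.toFinset, B.coeff (expo₂ a 0) * y ^ a :=
    funext fun y => sumFun_of_finite hd hfin y
  refine ⟨⟨fun e he => hd he, ?_⟩, ⟨1, one_pos, fun y hy => ?_⟩, fun M => ?_⟩
  · intro k hk p M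
    obtain rfl : k = 0 := by omega
    refine hfin.subset ?_
    rintro r ⟨-, e, he, -, rfl⟩
    exact ⟨e, he, rfl⟩
  · rw [hsum]
    exact Finset.analyticAt_fun_sum _ fun a _ => analyticAt_const.mul (analyticAt_rpow hy.1 a)
  · have hset : {a ∈ xSupport B | a ≤ M} = ↑(hfin.toFinset.filter fun a => a ≤ M) := by
      ext a; simp
    simp only [hset, finsum_mem_coe_finset]
    have h1 : (fun x : ℝ => ∑ a ∈ hfin.toFinset.filter fun a => ¬ a ≤ M,
        B.coeff (expo₂ a 0) * x ^ a) =o[𝓝[>] 0] fun x => x ^ M := by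
      refine IsLittleO.fun_sum fun a ha => IsLittleO.const_mul_left ?_ _
      exact isLittleO_rpow_rpow (not_le.1 (Finset.mem_filter.1 ha).2)
    refine h1.congr_left fun x => ?_
    rw [hsum]
    simp only
    rw [← Finset.sum_filter_add_sum_filter_not hfin.toFinset (fun a => a ≤ M), add_sub_cancel_left]

end FiniteSupport

/-- For a coherent section, the coefficients of the sectional expansion may be computed from sums
of the blocks. -/
theorem isSectionalExpansion_succ {s : Series → ℝ → ℝ} (hs : IsCoherent s) {j : ℕ} {F : Series}
    {f : ℝ → ℝ} (hF : IsTransseries (j + 1) F) (hf : IsAnalyticGerm f) {φ : ℝ → ℝ → ℝ}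
    (hφ : ∀ a ∈ xSupport F, IsSectionalExpansion s j (block a F) (φ a) ∧ IsSum (block a F) (φ a))
    (ho : ∀ M : ℝ, (fun x => f x - ∑ᶠ a ∈ {a ∈ xSupport F | a ≤ M},
      sumFun (block a F) (ell x) * x ^ a) =o[𝓝[>] 0] fun x => x ^ M) :
    IsSectionalExpansion s (j + 1) F f := by
  refine ⟨hF, hf, fun a ha => ⟨φ a, (hφ a ha).1⟩, fun M => ?_⟩
  have hfin := hF.finite_xSupport M
  have h1 := ho M
  simp only [finsum_mem_eq_finite_toFinset_sum _ hfin] at h1 ⊢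
  refine h1.congr' ?_ EventuallyEq.rfl
  have h2 : ∀ᶠ x in 𝓝[>] (0 : ℝ), ∀ a ∈ hfin.toFinset,
      sumFun (block a F) (ell x) = s (block a F) (ell x) := by
    rw [Filter.eventually_all_finset]
    intro a ha
    have hφa := hφ a (hfin.mem_toFinset.1 ha).1
    exact tendsto_ell.eventually (hφa.2.2.symm.trans (hs j _ _ hφa.1 hφa.2).symm)
  filter_upwards [h2] with x hx
  rw [Finset.sum_congr rfl fun a ha => by rw [hx a ha]]

/-- Reindexing of an expansion in powers of `x` by the exponent set of the inverse. -/
theorem DulacLead.isLittleO_exponentSet {F : Series} {α : ℝ} {m j : ℕ} (h : DulacLead F α m)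
    {y : Series} (hT : IsTransseries j y) (hxs : xSupport y ⊆ (fun β => β / α) '' exponentSet F α)
    {f : ℝ → ℝ → ℝ} (hsum : ∀ β, IsSum (block (β / α) y) (f β)) {g : ℝ → ℝ} {b : ℝ}
    (h1 : (fun x => g x - ∑ᶠ a ∈ {a ∈ xSupport y | a ≤ b / α},
      sumFun (block a y) (ell x) * x ^ a) =o[𝓝[>] 0] fun x => x ^ (b / α)) :
    (fun x => g x - ∑ᶠ β ∈ {β ∈ exponentSet F α | β ≤ b}, f β (ell x) * x ^ (β / α))
      =o[𝓝[>] 0] fun x => x ^ (b / α) := by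
  have hα := h.α_pos
  have hfin := h.finite_exponentSet b
  have hfin' := hT.finite_xSupport (b / α)
  simp only [finsum_mem_eq_finite_toFinset_sum _ hfin]
  simp only [finsum_mem_eq_finite_toFinset_sum _ hfin'] at h1
  refine h1.congr' ?_ EventuallyEq.rfl
  have h2 : ∀ᶠ x in 𝓝[>] (0 : ℝ), ∀ β ∈ hfin.toFinset,
      f β (ell x) = sumFun (block (β / α) y) (ell x) := by
    rw [Filter.eventually_all_finset]
    exact fun β _ => tendsto_ell.eventually (hsum β).2
  filter_upwards [h2] with x hx
  congr 1
  have hinj : Function.Injective fun β : ℝ => β / α := fun β β' hβ => (div_left_inj' hα.ne').1 hβ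
  rw [Finset.sum_congr (s₁ := hfin.toFinset) rfl fun β hβ => by rw [hx β hβ],
    ← Finset.sum_image (s := hfin.toFinset) (g := fun β : ℝ => β / α)
      (f := fun a => sumFun (block a y) (ell x) * x ^ a) hinj.injOn]
  refine Finset.sum_subset ?_ fun a ha hna => ?_
  · intro a ha
    obtain ⟨h3, h4⟩ := hfin'.mem_toFinset.1 ha
    obtain ⟨β, hβ, rfl⟩ := hxs h3
    exact Finset.mem_image.2 ⟨β, hfin.mem_toFinset.2 ⟨hβ, (div_le_div_iff_of_pos_right hα).1 h4⟩,
      rfl⟩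
  -- Elements of the exponent set that do not occur in the series have zero blocks and contribute
  -- nothing.
  · obtain ⟨β, hβ, rfl⟩ := Finset.mem_image.1 ha
    have h3 : β / α ∉ xSupport y := fun h3 => hna (hfin'.mem_toFinset.2
      ⟨h3, (div_le_div_iff_of_pos_right hα).2 (hfin.mem_toFinset.1 hβ).2⟩)
    rw [block_eq_zero_of_notMem h3]
    simp [sumFun]

/-! ### Laurent blocks as sectional expansions of their sums -/

section LaurentBlock

variable {F : Series} {γ : ℝ} {c : ℕ → ℕ → ℝ}

/-- The power of y fixes k, and the vanishing for i > k leaves finitely many powers of ℓ. Hence the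
blocks of a Laurent block are finite sums. -/
theorem IsLaurentBlock.finite_at_one (hF : IsLaurentBlock F γ c) (hc : ∀ i k, k < i → c i k = 0)
    (a : ℝ) : {r : ℝ | ∃ e ∈ F.support, e.at 0 = a ∧ e.at 1 = r}.Finite := by
  by_cases hk : ∃ k : ℕ, γ + k = a
  · obtain ⟨k, hk⟩ := hk
    refine ((finite_Iic k).image fun i : ℕ => (i : ℝ) - k).subset ?_
    rintro r ⟨e, he, h0, rfl⟩
    obtain ⟨i, k', rfl⟩ := hF.2 e he
    rw [expo₂_at_zero] at h0
    obtain rfl : k' = k := by exact_mod_cast (by linarith : (k' : ℝ) = k)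
    refine ⟨i, mem_Iic.2 ?_, (expo₂_at_one _ _).symm⟩
    by_contra hlt
    exact he (by rw [hF.1, hc i k' (not_le.1 hlt)])
  · convert finite_empty
    refine eq_empty_of_forall_notMem ?_
    rintro r ⟨e, he, h0, -⟩
    obtain ⟨i, k, rfl⟩ := hF.2 e he
    exact hk ⟨k, by rw [← h0, expo₂_at_zero]⟩

theorem IsLaurentBlock.isTransseries (hF : IsLaurentBlock F γ c)
    (hc : ∀ i k, k < i → c i k = 0) : IsTransseries 1 F := by
  refine ⟨fun e he => hF.depth he, fun k hk p M => ?_⟩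
  interval_cases k
  · refine ((finite_Iic ⌊M - γ⌋₊).image fun k : ℕ => γ + (k : ℝ)).subset ?_
    rintro r ⟨hr, e, he, -, rfl⟩
    obtain ⟨i, k, rfl⟩ := hF.2 e he
    rw [expo₂_at_zero] at hr ⊢
    exact ⟨k, mem_Iic.2 (Nat.le_floor (by linarith)), rfl⟩
  · refine (hF.finite_at_one hc (p 0)).subset ?_
    rintro r ⟨-, e, he, h0, rfl⟩
    exact ⟨e, he, h0 0 one_pos, rfl⟩

theorem IsLaurentBlock.finite_xSupport_block (hF : IsLaurentBlock F γ c)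
    (hc : ∀ i k, k < i → c i k = 0) (a : ℝ) : (xSupport (block a F)).Finite := by
  refine (hF.finite_at_one hc a).subset ?_
  rintro r ⟨e, he, rfl⟩
  exact ⟨consExpo a e, he, consExpo_at_zero a e, consExpo_at_succ a e 0⟩

theorem IsConvergent.eventually_summable (hF : F.support ⊆ depthLe 2) (hc : IsConvergent F) :
    ∀ᶠ x in 𝓝[>] 0, Summable fun e => F.coeff e * weight 1 x e := by
  obtain ⟨d, hd, h⟩ := hc
  filter_upwards [Ioo_mem_nhdsGT hd] with x hx
  refine (h x hx).of_abs.congr fun e => ?_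
  by_cases he : F.coeff e = 0
  · rw [he, zero_mul, zero_mul]
  · rw [monomialFun_eq_weight (hF he)]

/-- The blocks are finite sums and thus harmless for a coherent section. The remainder is handled by
`isLittleO_tail` with κ = γ, the norm bound coming from convergence of the two-variable series. -/
theorem IsLaurentBlock.isSectionalExpansion {s : Series → ℝ → ℝ} (hs : IsCoherent s)
    (hF : IsLaurentBlock F γ c) (hc : ∀ i k, k < i → c i k = 0) (hconv : IsConvergent F)
    {f : ℝ → ℝ} (hf : ∀ y, f y = y ^ γ * taylorSum c (ell y) (y / ell y)) :
    IsSectionalExpansion s 1 F f := by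
  obtain ⟨r, h0, hr⟩ := hF.exists_summable hconv
  have hT := hF.isTransseries hc
  have hd2 : F.support ⊆ depthLe 2 := fun e he => depthLe_mono (by norm_num) (hF.depth he)
  refine isSectionalExpansion_succ hs hT (isAnalyticGerm_taylorSum h0 hr hf)
    (φ := fun a => sumFun (block a F)) (fun a _ => ?_) fun M => ?_
  · have hd := support_block_depth (a := a) hF.depth
    have hfin := hF.finite_xSupport_block hc a
    exact ⟨isSectionalExpansion_of_finite hd hfin s, isSum_of_finite hd hfin⟩
  · have hfin := hT.finite_xSupport M
    obtain ⟨δ, hδ, hgap⟩ := exists_gap (fun M => hT.finite_xSupport M) M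
    simp only [finsum_mem_eq_finite_toFinset_sum _ hfin]
    refine (isLittleO_tail hδ hgap fun η hη _ => hF.normLe hconv hη).congr' ?_ EventuallyEq.rfl
    filter_upwards [hconv.eventually_summable hd2, (hF.isSum hconv hf).2] with x h1 h2
    rw [h2, ← evalSum_weight_one hd2, evalSum_sub_blocks hd2 h1 hfin]

end LaurentBlock

/-! ### Uniqueness of sectional expansions -/

theorem isSectionalExpansion_zero (s : Series → ℝ → ℝ) (j : ℕ) :
    IsSectionalExpansion s j 0 fun _ => 0 := by
  have hT : IsTransseries j 0 := ⟨fun e he => absurd rfl he, fun k _ p M => by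
    convert finite_empty
    refine eq_empty_of_forall_notMem ?_
    rintro r ⟨-, e, he, -⟩
    exact he rfl⟩
  have hx : xSupport 0 = ∅ := by
    refine eq_empty_of_forall_notMem ?_
    rintro r ⟨e, he, -⟩
    exact he rfl
  have ho : ∀ (φ : ℝ → ℝ → ℝ) (M : ℝ), (fun x => 0 - ∑ᶠ a ∈ {a ∈ xSupport 0 | a ≤ M}, φ a x)
      =o[𝓝[>] 0] fun x : ℝ => x ^ M := by
    intro φ M
    have hempty : {a ∈ xSupport 0 | a ≤ M} = ∅ := by
      rw [hx]; exact eq_empty_of_forall_notMem fun a ha => ha.1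
    simp only [hempty, finsum_mem_empty, sub_zero]
    exact isLittleO_zero _ _
  cases j with
  | zero => exact ⟨hT, isAnalyticGerm_zero, ho _⟩
  | succ j => exact ⟨hT, isAnalyticGerm_zero, fun a ha => by rw [hx] at ha; exact ha.elim, ho _⟩

/-- The first coefficients in which two expansions of the same germ differ have a difference of
positive order. -/
theorem isLittleO_coeff_sub {S S' : Set ℝ} (hS : ∀ M : ℝ, {a ∈ S | a ≤ M}.Finite)
    (hS' : ∀ M : ℝ, {a ∈ S' | a ≤ M}.Finite) {φ φ' : ℝ → ℝ → ℝ} (hφ : ∀ a ∉ S, φ a = 0)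
    (hφ' : ∀ a ∉ S', φ' a = 0) {f f' : ℝ → ℝ}
    (hf : ∀ M : ℝ, (fun x => f x - ∑ᶠ a ∈ {a ∈ S | a ≤ M}, φ a x * x ^ a)
      =o[𝓝[>] 0] fun x => x ^ M)
    (hf' : ∀ M : ℝ, (fun x => f' x - ∑ᶠ a ∈ {a ∈ S' | a ≤ M}, φ' a x * x ^ a)
      =o[𝓝[>] 0] fun x => x ^ M)
    (hff' : ∀ M : ℝ, (fun x => f x - f' x) =o[𝓝[>] 0] fun x => x ^ M) {a₀ : ℝ}
    (ha₀ : ∀ a < a₀, φ a = φ' a) :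
    ∃ ε : ℝ, 0 < ε ∧ (fun x => φ a₀ x - φ' a₀ x) =o[𝓝[>] 0] fun x => x ^ ε := by
  classical
  have hT : ∀ M : ℝ, {a ∈ S ∪ S' | a ≤ M}.Finite := fun M => by
    refine ((hS M).union (hS' M)).subset ?_
    rintro a ⟨ha | ha, hM⟩
    · exact Or.inl ⟨ha, hM⟩
    · exact Or.inr ⟨ha, hM⟩
  by_cases hmem : a₀ ∈ S ∪ S'
  swap
  · refine ⟨1, one_pos, ?_⟩
    rw [hφ a₀ fun h => hmem (Or.inl h), hφ' a₀ fun h => hmem (Or.inr h)]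
    simp only [Pi.zero_apply, sub_zero]
    exact isLittleO_zero _ _
  obtain ⟨δ, hδ, hgap⟩ := exists_gap hT a₀
  refine ⟨δ / 2, half_pos hδ, ?_⟩
  -- No exponent lies strictly between a₀ and a₀ + δ, and the coefficients below a₀ coincide, so
  -- cutting halfway into the gap leaves only the coefficient at a₀.
  set M := a₀ + δ / 2 with hM
  have hsum : ∀ {R : Set ℝ} {ψ : ℝ → ℝ → ℝ} (_ : R ⊆ S ∪ S') (_ : ∀ a ∉ R, ψ a = 0) (x : ℝ),
      ∑ᶠ a ∈ {a ∈ R | a ≤ M}, ψ a x * x ^ a = ∑ a ∈ (hT M).toFinset, ψ a x * x ^ a := by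
    intro R ψ hR hψ x
    have hRfin : {a ∈ R | a ≤ M}.Finite := (hT M).subset fun a ha => ⟨hR ha.1, ha.2⟩
    rw [finsum_mem_eq_finite_toFinset_sum _ hRfin]
    refine Finset.sum_subset ?_ fun a ha hna => ?_
    · intro a ha
      rw [hRfin.mem_toFinset] at ha
      exact (hT M).mem_toFinset.2 ⟨hR ha.1, ha.2⟩
    · have h1 : a ∉ R := fun h => hna (hRfin.mem_toFinset.2 ⟨h, ((hT M).mem_toFinset.1 ha).2⟩)
      rw [hψ a h1, Pi.zero_apply, zero_mul]
  have h1 := hf M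
  have h2 := hf' M
  simp only [hsum subset_union_left hφ] at h1
  simp only [hsum subset_union_right hφ'] at h2
  have h3 : (fun x => (φ a₀ x - φ' a₀ x) * x ^ a₀) =o[𝓝[>] 0] fun x => x ^ M := by
    refine ((hff' M).sub (h1.sub h2)).congr_left fun x => ?_
    have h4 : ∑ a ∈ (hT M).toFinset, φ a x * x ^ a - ∑ a ∈ (hT M).toFinset, φ' a x * x ^ a =
        (φ a₀ x - φ' a₀ x) * x ^ a₀ := by
      rw [← Finset.sum_sub_distrib, Finset.sum_eq_single a₀]
      · ring
      · intro a ha hne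
        obtain ⟨h5, h6⟩ := (hT M).mem_toFinset.1 ha
        have h7 : a < a₀ := by
          by_contra hlt
          have := hgap a h5 (lt_of_le_of_ne (not_lt.1 hlt) hne.symm)
          linarith
        rw [ha₀ a h7, sub_self]
      · intro hna
        exact absurd ((hT M).mem_toFinset.2 ⟨hmem, by linarith⟩) hna
    rw [← h4]; ring
  have h5 := h3.mul_isBigO (isBigO_refl (fun x : ℝ => x ^ (-a₀)) (𝓝[>] 0))
  refine h5.congr' ?_ ?_
  · filter_upwards [self_mem_nhdsWithin] with x hx
    rw [mul_assoc, ← Real.rpow_add hx, add_neg_cancel, Real.rpow_zero, mul_one]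
  · filter_upwards [self_mem_nhdsWithin] with x hx
    rw [← Real.rpow_add hx, hM]
    congr 1; ring

/-- Any positive power of x is smaller than every power of ℓ(x), and y = ℓ(e^{-1/y}) transports this
to the variable y. -/
theorem flat_of_comp_ell {D : ℝ → ℝ} {ε : ℝ} (hε : 0 < ε)
    (h : (fun x => D (ell x)) =o[𝓝[>] 0] fun x => x ^ ε) (M : ℝ) :
    D =o[𝓝[>] 0] fun y => y ^ M := by
  have h1 : Tendsto (fun x => weight 1 x (expo₂ ε (-M))) (𝓝[>] 0) (𝓝 0) := by
    refine tendsto_weight one_pos (depthLe_mono (by norm_num) (expo₂_mem_depthLe _ _)) ?_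
    refine Expo.lt_of_at 0 (by simp) ?_
    rw [expo₂_at_zero, Expo.at_zero]; exact hε
  have h2 : (fun x : ℝ => x ^ ε) =o[𝓝[>] 0] fun x => ell x ^ M := by
    refine (((isLittleO_one_iff ℝ).2 h1).mul_isBigO
      (isBigO_refl (fun x : ℝ => ell x ^ M) (𝓝[>] 0))).congr' ?_ (by simp)
    filter_upwards [eventually_admissible] with x hx
    rw [weight, expo₂_at_zero, expo₂_at_one, expo₂_mem_depthLe _ _ 2 (by norm_num),
      Real.rpow_zero, mul_one, one_mul, mul_assoc, ← Real.rpow_add hx.2.1, neg_add_cancel,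
      Real.rpow_zero, mul_one]
  refine ((h.trans h2).comp_tendsto tendsto_exp_neg_inv).congr (fun y => ?_) fun y => ?_
  · rw [Function.comp_apply, ell_exp_neg_inv]
  · rw [Function.comp_apply, ell_exp_neg_inv]

theorem coeff_eq_of_lt_order_sub {F F' : Series} {e : Expo} (h : e.at 0 < (F - F').order.at 0) :
    F.coeff e = F'.coeff e := by
  have := HahnSeries.coeff_eq_zero_of_lt_order (Expo.lt_of_at 0 (by simp) h)
  rwa [HahnSeries.coeff_sub, sub_eq_zero] at this

/-- Induction on depth, stated for germs that agree only up to a flat difference, since this is all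
that is known about the sections of the blocks. At the power of x of the first differing exponent,
the sections of the two blocks agree up to a flat germ, so the blocks agree by induction, a
contradiction. -/
theorem isSectionalExpansion_unique {s : Series → ℝ → ℝ} (hs : IsSection s) (j : ℕ) :
    ∀ {F F' : Series} {f f' : ℝ → ℝ}, IsSectionalExpansion s j F f →
      IsSectionalExpansion s j F' f' →
      (∀ M : ℝ, (fun x => f x - f' x) =o[𝓝[>] 0] fun x => x ^ M) → F = F' := by
  classical
  induction j with
  | zero =>
    intro F F' f f' hF hF' hff'
    by_contra hne
    have hD : (F - F').coeff (F - F').order ≠ 0 :=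
      mt HahnSeries.coeff_order_eq_zero.1 (sub_ne_zero.2 hne)
    set e := (F - F').order with he
    have hcoeff : ∀ {H : Series} (a : ℝ), a ∉ xSupport H → H.coeff (expo₂ a 0) = 0 := by
      intro H a ha
      by_contra h
      exact ha ⟨expo₂ a 0, h, expo₂_at_zero _ _⟩
    have he0 : e = expo₂ (e.at 0) 0 := by
      refine eq_expo₂_zero fun i hi => ?_
      by_cases h : F.coeff e = 0
      · refine hF'.1.1 e (fun h' => hD ?_) i hi
        rw [HahnSeries.coeff_sub, h, h', sub_zero]
      · exact hF.1.1 e h i hi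
    obtain ⟨ε, hε, ho⟩ := isLittleO_coeff_sub (φ := fun a _ => F.coeff (expo₂ a 0))
      (φ' := fun a _ => F'.coeff (expo₂ a 0)) hF.1.finite_xSupport hF'.1.finite_xSupport
      (fun a ha => funext fun _ => hcoeff a ha) (fun a ha => funext fun _ => hcoeff a ha)
      hF.2.2 hF'.2.2 hff' (a₀ := e.at 0) fun a ha => funext fun _ =>
        coeff_eq_of_lt_order_sub (by rwa [expo₂_at_zero])
    have h1 := ho.trans (isLittleO_rpow_rpow hε)
    simp only [Real.rpow_zero] at h1
    have h2 := tendsto_nhds_unique ((isLittleO_one_iff ℝ).1 h1) tendsto_const_nhds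
    rw [← he0] at h2
    exact hD (by rw [HahnSeries.coeff_sub, h2])
  | succ j ih =>
    intro F F' f f' hF hF' hff'
    by_contra hne
    have hD : (F - F').coeff (F - F').order ≠ 0 :=
      mt HahnSeries.coeff_order_eq_zero.1 (sub_ne_zero.2 hne)
    set e := (F - F').order with he
    -- A section may send 0 to a nonzero flat germ. Setting the value to 0 there makes absent blocks
    -- contribute nothing, as `isLittleO_coeff_sub` requires.
    set σ : Series → ℝ → ℝ := fun B => if B = 0 then fun _ => 0 else s B with hσ
    have hσexp : ∀ {H : Series} {f : ℝ → ℝ} (_ : IsSectionalExpansion s (j + 1) H f) (a : ℝ),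
        IsSectionalExpansion s j (block a H) (σ (block a H)) := by
      intro H f hH a
      by_cases h0 : block a H = 0
      · rw [hσ]; simp only [h0, if_true]; exact isSectionalExpansion_zero s j
      · rw [hσ]; simp only [h0, if_false]
        obtain ⟨φ, hφ⟩ := hH.2.2.1 a (by
          by_contra h; exact h0 (block_eq_zero_of_notMem h))
        exact hs j _ _ hφ
    have hσsum : ∀ {H : Series} {f : ℝ → ℝ} (_ : IsSectionalExpansion s (j + 1) H f) (M : ℝ),
        (fun x => f x - ∑ᶠ a ∈ {a ∈ xSupport H | a ≤ M}, σ (block a H) (ell x) * x ^ a)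
          =o[𝓝[>] 0] fun x => x ^ M := by
      intro H f hH M
      refine (hH.2.2.2 M).congr_left fun x => ?_
      congr 1
      refine finsum_mem_congr rfl fun a ha => ?_
      have h0 : block a H ≠ 0 := by
        obtain ⟨e, he, rfl⟩ := ha.1
        obtain ⟨e', he'⟩ := exists_consExpo e
        intro h
        have h1 : (block (e.at 0) H).coeff e' = 0 := by rw [h]; rfl
        rw [coeff_block, ← he'] at h1
        exact he h1
      rw [hσ]; simp only [h0, if_false]
    have hσzero : ∀ {H : Series} (a : ℝ), a ∉ xSupport H →
        (fun x => σ (block a H) (ell x)) = 0 := by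
      intro H a ha
      rw [block_eq_zero_of_notMem ha, hσ]
      simp only [if_true]
      rfl
    obtain ⟨ε, hε, ho⟩ := isLittleO_coeff_sub (φ := fun a x => σ (block a F) (ell x))
      (φ' := fun a x => σ (block a F') (ell x)) hF.1.finite_xSupport hF'.1.finite_xSupport
      hσzero hσzero (hσsum hF) (hσsum hF') hff' (a₀ := e.at 0) fun a ha => by
        have : block a F = block a F' := by
          ext e'
          rw [coeff_block, coeff_block]
          exact coeff_eq_of_lt_order_sub (by rwa [consExpo_at_zero])
        simp only [this]
    have hblock := ih (hσexp hF (e.at 0)) (hσexp hF' (e.at 0)) fun M =>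
      flat_of_comp_ell (D := fun y => σ (block (e.at 0) F) y - σ (block (e.at 0) F') y) hε ho M
    obtain ⟨e', he'⟩ := exists_consExpo e
    refine hD ?_
    rw [HahnSeries.coeff_sub, he', ← coeff_block, ← coeff_block, hblock, sub_self]

end

end Dulac

/-! ### Assembly of the formal inverse, its blocks and the inverse germ -/

theorem mainTheorem7 (g : ℝ → ℝ) (hg : IsDulacGerm g)
    (gHat : Series) (hexp : IsDulacExpansion g gHat)
    (α : ℝ) (m : ℕ) (hord : gHat.order = expo₂ α (-(m : ℝ)))
    (hpos : 0 < gHat.leadingCoeff) :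
    ∃ (gInv : ℝ → ℝ) (gHatInv : Series),
      -- the inverse germ, analytic
      IsInverseGerm g gInv ∧ IsAnalyticGerm gInv ∧
      -- the formal inverse in `L̂₂`, and its uniqueness
      IsInfTransseries 2 gHatInv ∧ IsFormalInverse gHat gHatInv ∧
      (∀ H : Series, IsInfTransseries 2 H → IsFormalInverse gHat H → H = gHatInv) ∧
      -- it is the sectional asymptotic expansion of the inverse germ
      (∀ s : Series → ℝ → ℝ, IsIntegralSection s →
        IsSectionalExpansion s 2 gHatInv gInv ∧
        ∀ H : Series, IsSectionalExpansion s 2 H gInv → H = gHatInv) ∧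
      -- the blocks and the expansion in powers `x^{β/α}`, `β ∈ 𝒜`
      xSupport gHatInv ⊆ (fun β => β / α) '' exponentSet gHat α ∧
      ∃ (M : ℝ → ℕ) (G : ℝ → ℝ → ℝ → ℝ) (c : ℝ → ℕ → ℕ → ℝ) (f : ℝ → ℝ → ℝ),
        (∀ β ∈ exponentSet gHat α,
          HasTaylor₂ (G β) (c β) ∧
          IsLaurentBlock (block (β / α) gHatInv) (-(M β : ℝ) + m * β / α) (c β) ∧
          (∀ y, f β y = y ^ (-(M β : ℝ) + m * β / α) * G β (ell y) (y / ell y)) ∧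
          IsAnalyticGerm (f β) ∧
          IsSum (block (β / α) gHatInv) (f β)) ∧
        ∀ b ∈ exponentSet gHat α,
          (fun x => gInv x - ∑ᶠ β ∈ {β ∈ exponentSet gHat α | β ≤ b}, f β (ell x) * x ^ (β / α))
            =o[𝓝[>] 0] fun x => x ^ (b / α) := by
  have h : DulacLead gHat α m := ⟨hexp.1, hord, hpos⟩
  have hα := h.α_pos
  obtain ⟨c, hc, hac⟩ := h.exists_coeff
  obtain ⟨θ, hθ⟩ := h.exists_solution c
  obtain ⟨gInv, hinv, hana⟩ := h.exists_inverse hg hexp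
  obtain ⟨M, hM⟩ := h.exists_laurentBlock hθ
  set y := invSeries α m c θ with hy
  have hθ0 := orderTop_pos_of_fil h.isGenerating'.pos hθ.supp
  have hsupp := h.support_invSeries c hθ.supp
  have hinf := h.isInfTransseries_of_support hsupp
  have hlead : IsLeading 0 y := isLeading_invSeries hα hc hθ0
  have hcomp : comp y gHat = idSeries := by
    have h1 := comp_invSeries hα hc h.isGenerating' hθ.supp hθ.fix hac
    have h2 : HahnSeries.single (expo₂ α (-(m : ℝ))) gHat.leadingCoeff + tail gHat = gHat := by
      rw [tail, hord, add_sub_cancel]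
    rwa [h2] at h1
  have hformal : IsFormalInverse gHat y := by
    refine isFormalInverse_of_comp h.depth h.isLeading hinf.1.1 hlead ?_ hcomp
    rw [hy, invSeries, expForm_order hθ0 _ hc.ne']
    exact expo₂_mem_depthLe _ _
  obtain ⟨k, hk⟩ : ∃ k : ℝ → ℕ → ℕ → ℝ, k = fun β (i n : ℕ) => (block (β / α) y).coeff
      (expo₂ (-(M β : ℝ) + m * β / α + n) ((i : ℝ) - n)) := ⟨_, rfl⟩
  obtain ⟨f, hf⟩ : ∃ f : ℝ → ℝ → ℝ, ∀ β t, f β t =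
      t ^ (-(M β : ℝ) + m * β / α) * taylorSum (k β) (ell t) (t / ell t) := ⟨_, fun _ _ => rfl⟩
  have hL : ∀ β, IsLaurentBlock (block (β / α) y) (-(M β : ℝ) + m * β / α) (k β) ∧
      ∀ i n, n < i → k β i n = 0 := by
    rw [hk]; exact hM
  have hconv : ∀ a, IsConvergent (block a y) := h.isConvergent_block hc hθ
  have hsum : ∀ β, IsSum (block (β / α) y) (f β) := fun β =>
    (hL β).1.isSum (hconv _) (hf β)
  have hxs := h.xSupport_of_support hsupp
  refine ⟨gInv, y, hinv, hana, hinf, hformal, fun H hH hHinv =>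
    formalInverse_unique h.depth h.isLeading hlead hcomp hH hHinv, fun s hs => ?_, hxs, M,
    fun β => taylorSum (k β), k, f, fun β _ => ?_, fun b _ => ?_⟩
  · have hsec : IsSectionalExpansion s 2 y gInv := by
      -- Coherence identifies the sections of the convergent blocks with their sums. The block at
      -- x^a is the one indexed by β = aα.
      refine isSectionalExpansion_succ hs.2.1 hinf.1 hana (φ := fun a => f (a * α)) ?_
        (h.isLittleO_inverse hg hexp hinv hc hac hθ)
      intro a _
      have ha : a = a * α / α := by field_simp
      have h1 := (hL (a * α)).1.isSectionalExpansion hs.2.1 (hL (a * α)).2 (hconv _)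
        (hf (a * α))
      have h2 := hsum (a * α)
      rw [← ha] at h1 h2
      exact ⟨h1, h2⟩
    refine ⟨hsec, fun H hH => isSectionalExpansion_unique hs.1 2 hH hsec fun N => ?_⟩
    simp only [sub_self]
    exact isLittleO_zero _ _
  · obtain ⟨r, hr0, hr⟩ := (hL β).1.exists_summable (hconv _)
    exact ⟨hasTaylor₂_taylorSum hr0 hr, (hL β).1, hf β, isAnalyticGerm_taylorSum hr0 hr (hf β),
      hsum β⟩
  · exact h.isLittleO_exponentSet hinf.1 hxs hsum (h.isLittleO_inverse hg hexp hinv hc hac hθ _)
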